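/- Let $(M,g)$ be a smooth Riemannian manifold with boundary (put $\sigma=1$), or a smooth Lorentzian manifold of signature $(-,+,\dots,+)$ with timelike boundary (put $\sigma=-1$), of dimension $n=d+1$. Let $p\in\partial M$ and let $(x^1,\dots,x^{d},x^n)$ be boundary normal coordinates around $p$: $x^n\ge 0$ in $M$, $x^n=0$ on $\partial M$, and $g=g_{\alpha\beta}\,dx^\alpha dx^\beta+(dx^n)^2$. The normal jet of $g$ at $p$ is the family of symmetric bilinear forms $\partial_n^m g_{\alpha\beta}(p)$, $m\ge 0$, on $T_p\partial M$. Let $v\in T_p\partial M$ be a strictly convex direction, i.e. $\mathrm{II}(v,v)=g(\nabla_v\nu,v)>0$ with $\nu=-\partial_n$ the outward unit normal, and assume that $v$ is timelike in the Lorentzian case. For $x\in\partial M$ and an inward pointing $w\in T_xM$, the exit time $\tau(x,w)$ is the largest time up to which the geodesic $\gamma$ with $\gamma(0)=x$, $\dot\gamma(0)=w$ stays in $M$; the scattering relation is $S(x,w)=(\gamma(\tau),\dot\gamma(\tau))$. (1) (Determination.) The normal jet of $g$ at $p$ is determined by the restriction of $S$ to the inward directions in a neighbourhood of $(p,v)$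 and the boundary metric $g|_{T\partial M\times T\partial M}$ near $p$, both written in the coordinates above: for each $d$ and $\sigma$ there is a map $R$, independent of $(M,g)$, of the coordinates, of $p$ and of $v$, that sends these data together with $(p,v)$ to $(\partial_n^m g_{\alpha\beta}(p))_{m\ge 0}$. (2) (Construction.) Suppose $g(v,v)=\sigma$, and let $v_\varepsilon=\sqrt{1-\sigma\varepsilon^2}\,v+\varepsilon\,\partial_n$. For all small $\varepsilon>0$ the exit time $\tau(\varepsilon)=\tau(p,v_\varepsilon)$ and $S(p,v_\varepsilon)=(y(\varepsilon),\eta(\varepsilon))$ are defined (with $y(\varepsilon)$ in the coordinate neighbourhood), $y$ and $\tau$ are differentiable in $\varepsilon$, and $\tau'(\varepsilon)=\sigma\, g(y'(\varepsilon),\eta(\varepsilon)^{\tan})$, where $\eta^{\tan}=\eta^\alpha\partial_\alpha$ is the part of $\eta$ tangential to $\partial M$. There are real numbers $a_k$ with $$\tau(\varepsilon)=\sum_{k=0}^{N}a_k\varepsilon^k+O(\varepsilon^{N+1})\quad(\varepsilon\to0^+)\qquad\text{for every }N,$$ and $a_0=0$. With $K=\tfrac12\partial_n g_{\alpha\beta}(p)v^\alpha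 v^\beta<0$ one has $a_1=-2/K$, and for every $m\ge 2$ $$a_{2m-1}=\frac12\Big(-\frac2K\Big)^{m+1}\frac{m!}{(2m)!}\;\partial_n^m g_{\alpha\beta}(p)\,v^\alpha v^\beta+P_m .$$ Here $P_m$ is the value of a polynomial with rational coefficients, which depends only on $m$, $d$ and $\sigma$, in the components $v^\alpha$, the entries $g^{\alpha\beta}(p)$ of the inverse of the boundary metric, $K^{-1}$, and the tangential derivatives (of any order, including order $0$) at $p$ of the functions $\partial_n^k g_{\alpha\beta}|_{\partial M}$ with $k<m$ only. -/

import Mathlib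

open Set Filter Topology Asymptotics
open scoped Manifold ContDiff

/-! Manifolds with boundary of dimension `d + 1` are modelled on the half-space
`{x : 0 ≤ x 0}`: the coordinate of index `0` is the normal coordinate `xⁿ`, the remaining `d`
coordinates are the tangential ones. -/

noncomputable section

/-- The coordinate space `ℝ × ℝᵈ`, normal coordinate first. -/
abbrev CoordSpace (d : ℕ) : Type := EuclideanSpace ℝ (Fin (d + 1))

/-- The coordinate vector (or point) with normal component `a` and tangential components `u`. -/
def coordVec {d : ℕ} (a : ℝ) (u : Fin d → ℝ) : CoordSpace d :=
  WithLp.toLp 2 (Fin.cons a u : Fin (d + 1) → ℝ)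

/-- The tangential components of a coordinate vector. -/
def tangPart {d : ℕ} (w : CoordSpace d) : Fin d → ℝ := fun α => w α.succ

/-- Charts of a manifold with boundary. -/
abbrev BdChart (d : ℕ) (M : Type*) [TopologicalSpace M] : Type _ :=
  OpenPartialHomeomorph M (EuclideanHalfSpace (d + 1))

section Metric

variable {d : ℕ} {M : Type*} [TopologicalSpace M] [ChartedSpace (EuclideanHalfSpace (d + 1)) M]

/-- Components in the chart `e`, at the coordinate point `x`, of a field `b` of bilinear forms on
the tangent spaces: `b` evaluated on the tangent vectors with coordinates `u` and `w`. -/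
def chartForm
    (b : ∀ q : M, TangentSpace (𝓡∂ (d + 1)) q →L[ℝ] TangentSpace (𝓡∂ (d + 1)) q →L[ℝ] ℝ)
    (e : BdChart d M) (x u w : CoordSpace d) : ℝ :=
  b ((e.extend (𝓡∂ (d + 1))).symm x)
    (mfderivWithin 𝓘(ℝ, CoordSpace d) (𝓡∂ (d + 1)) (e.extend (𝓡∂ (d + 1))).symm
      (range (𝓡∂ (d + 1))) x u)
    (mfderivWithin 𝓘(ℝ, CoordSpace d) (𝓡∂ (d + 1)) (e.extend (𝓡∂ (d + 1))).symm
      (range (𝓡∂ (d + 1))) x w)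

variable (d M) in
/-- A smooth symmetric two-tensor on `M`; smoothness is that of the components in every smooth
chart, up to the boundary. -/
structure SymTensor where
  val : ∀ q : M, TangentSpace (𝓡∂ (d + 1)) q →L[ℝ] TangentSpace (𝓡∂ (d + 1)) q →L[ℝ] ℝ
  symm : ∀ q u w, val q u w = val q w u
  smooth : ∀ e ∈ IsManifold.maximalAtlas (𝓡∂ (d + 1)) ∞ M, ∀ u w : CoordSpace d,
    ContDiffOn ℝ ∞ (fun x => chartForm val e x u w) (e.extend (𝓡∂ (d + 1))).target

/-- Components of `g` in the chart `e`. -/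
def SymTensor.inChart (g : SymTensor d M) (e : BdChart d M) (x u w : CoordSpace d) : ℝ :=
  chartForm g.val e x u w

/-- The two settings: Riemannian manifolds with boundary, and Lorentzian manifolds with timelike
boundary. -/
inductive MetricKind
  | riemannian
  | lorentzian

/-- The value of `g(v, v)` on the unit vectors considered: `1`, respectively `-1` (timelike). -/
def MetricKind.sign : MetricKind → ℝ
  | .riemannian => 1
  | .lorentzian => -1

/-- `g` is a Riemannian metric; respectively `g` is a Lorentzian metric (signature
`(-, +, …, +)`) and the boundary is timelike, i.e. each of its tangent hyperplanes contains a
timelike vector. -/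
def SymTensor.IsMetric (g : SymTensor d M) : MetricKind → Prop
  | .riemannian => ∀ q, ∀ u : TangentSpace (𝓡∂ (d + 1)) q, u ≠ 0 → 0 < g.val q u u
  | .lorentzian =>
      (∀ q, ∃ u : TangentSpace (𝓡∂ (d + 1)) q, g.val q u u < 0 ∧
        ∀ w : TangentSpace (𝓡∂ (d + 1)) q, g.val q u w = 0 → w ≠ 0 → 0 < g.val q w w) ∧
      (∀ e ∈ IsManifold.maximalAtlas (𝓡∂ (d + 1)) ∞ M,
        ∀ x ∈ (e.extend (𝓡∂ (d + 1))).target, x 0 = 0 →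
          ∃ u : CoordSpace d, u 0 = 0 ∧ g.inChart e x u u < 0)

/-- Christoffel symbols of the first kind (Koszul formula) in the chart `e`:
`g(∇_u v, w)` for constant coordinate fields `u`, `v`, `w`. -/
def SymTensor.christoffel (g : SymTensor d M) (e : BdChart d M) (x u v w : CoordSpace d) : ℝ :=
  (fderivWithin ℝ (fun y => g.inChart e y v w) (range (𝓡∂ (d + 1))) x u
    + fderivWithin ℝ (fun y => g.inChart e y u w) (range (𝓡∂ (d + 1))) x v
    - fderivWithin ℝ (fun y => g.inChart e y u v) (range (𝓡∂ (d + 1))) x w) / 2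

/-- `g(∇_u X, w)` at `x`, for the Levi-Civita connection `∇` and a vector field `X` given by its
components in the chart `e`. -/
def SymTensor.covDeriv (g : SymTensor d M) (e : BdChart d M) (x u : CoordSpace d)
    (X : CoordSpace d → CoordSpace d) (w : CoordSpace d) : ℝ :=
  g.inChart e x (fderivWithin ℝ X (range (𝓡∂ (d + 1))) x u) w + g.christoffel e x u (X x) w

/-- `γ : [0, T] → M` is a geodesic: in every smooth chart, `γ'' + Γ(γ', γ') = 0` (written with
lowered index), with one-sided derivatives at the end points. -/
def SymTensor.IsGeodesic (g : SymTensor d M) (γ : ℝ → M) (T : ℝ) : Prop :=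
  ContinuousOn γ (Icc 0 T) ∧
  ∀ e ∈ IsManifold.maximalAtlas (𝓡∂ (d + 1)) ∞ M, ∀ t ∈ Icc 0 T, γ t ∈ e.source →
    ∃ (u : ℝ → CoordSpace d) (a : CoordSpace d),
      (∀ᶠ s in 𝓝[Icc 0 T] t,
        HasDerivWithinAt (fun r => e.extend (𝓡∂ (d + 1)) (γ r)) (u s) (Icc 0 T) s) ∧
      HasDerivWithinAt u a (Icc 0 T) t ∧
      ∀ w, g.inChart e (e.extend (𝓡∂ (d + 1)) (γ t)) a w
        + g.christoffel e (e.extend (𝓡∂ (d + 1)) (γ t)) (u t) (u t) w = 0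

/-- `γ : [0, T] → M` is a geodesic of `M` starting at the boundary point with tangential
coordinates `x`, with initial velocity `v` (in the coordinates of `e`). -/
def SymTensor.IsGeodesicFrom (g : SymTensor d M) (e : BdChart d M) (x : Fin d → ℝ)
    (v : CoordSpace d) (γ : ℝ → M) (T : ℝ) : Prop :=
  g.IsGeodesic γ T ∧ coordVec 0 x ∈ (e.extend (𝓡∂ (d + 1))).target ∧
  γ 0 = (e.extend (𝓡∂ (d + 1))).symm (coordVec 0 x) ∧
  HasDerivWithinAt (fun r => e.extend (𝓡∂ (d + 1)) (γ r)) v (Icc 0 T) 0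

/-- The geodesic from `(x, v)` has exit time `T`, i.e. `T` is the largest time up to which it
exists in `M`, and it exits at the boundary point `y` with velocity `w`; everything is written in
the coordinates of `e`. -/
def SymTensor.ExitsAt (g : SymTensor d M) (e : BdChart d M) (x : Fin d → ℝ) (v : CoordSpace d)
    (T : ℝ) (y : Fin d → ℝ) (w : CoordSpace d) : Prop :=
  0 < T ∧
  (∃ γ : ℝ → M, g.IsGeodesicFrom e x v γ T ∧ γ T ∈ e.source ∧
    e.extend (𝓡∂ (d + 1)) (γ T) = coordVec 0 y ∧
    HasDerivWithinAt (fun r => e.extend (𝓡∂ (d + 1)) (γ r)) w (Icc 0 T) T) ∧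
  ∀ T' > T, ¬ ∃ γ : ℝ → M, g.IsGeodesicFrom e x v γ T'

/-- The scattering relation `S(x, v) = (y, w)`, in the coordinates of `e`. -/
def SymTensor.Scatters (g : SymTensor d M) (e : BdChart d M) (x : Fin d → ℝ) (v : CoordSpace d)
    (y : Fin d → ℝ) (w : CoordSpace d) : Prop :=
  ∃ T, g.ExitsAt e x v T y w

/-- `e` is a chart of boundary normal (semi-geodesic) coordinates:
`g = g_{αβ} dx^α dx^β + (dxⁿ)²`. -/
def SymTensor.IsBoundaryNormal (g : SymTensor d M) (e : BdChart d M) : Prop :=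
  e ∈ IsManifold.maximalAtlas (𝓡∂ (d + 1)) ∞ M ∧
  ∀ x ∈ (e.extend (𝓡∂ (d + 1))).target,
    g.inChart e x (coordVec 1 0) (coordVec 1 0) = 1 ∧
    ∀ u : Fin d → ℝ, g.inChart e x (coordVec 1 0) (coordVec 0 u) = 0

/-- The boundary metric at the boundary point with tangential coordinates `x`. -/
def SymTensor.bdMetric (g : SymTensor d M) (e : BdChart d M) (x u w : Fin d → ℝ) : ℝ :=
  g.inChart e (coordVec 0 x) (coordVec 0 u) (coordVec 0 w)

/-- The second fundamental form `II(u, w) = g(∇_u ν, w)` of the boundary in boundary normal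
coordinates, where the outward unit normal field `ν` is `-∂ₙ`. -/
def SymTensor.secondForm (g : SymTensor d M) (e : BdChart d M) (x u w : Fin d → ℝ) : ℝ :=
  g.covDeriv e (coordVec 0 x) (coordVec 0 u) (fun _ => -coordVec 1 0) (coordVec 0 w)

/-- The normal derivatives of the metric at the boundary: `∂ₙᵐ g_{αβ}(x) u^α w^β`. -/
def SymTensor.normalDeriv (g : SymTensor d M) (e : BdChart d M) (m : ℕ)
    (x u w : Fin d → ℝ) : ℝ :=
  iteratedDerivWithin m
    (fun t : ℝ => g.inChart e (coordVec t x) (coordVec 0 u) (coordVec 0 w)) (Ici 0) 0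

/-- The constant `K = ½ ∂ₙ g_{αβ}(x) w^α w^β`. -/
def SymTensor.convexityConst (g : SymTensor d M) (e : BdChart d M) (x w : Fin d → ℝ) : ℝ :=
  g.normalDeriv e 1 x w w / 2

/-- The family of unit directions `w_ε = √(1 ∓ ε²) w + ε ∂ₙ` approaching the tangential
direction `w`. -/
def tiltedDir {d : ℕ} (kind : MetricKind) (w : Fin d → ℝ) (ε : ℝ) : CoordSpace d :=
  coordVec ε (√(1 - kind.sign * ε ^ 2) • w)

/-- Iterated partial derivatives `∂_{α₁} ⋯ ∂_{α_r} f` on `ℝᵈ`. -/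
def iterPartial {d : ℕ} : List (Fin d) → ((Fin d → ℝ) → ℝ) → (Fin d → ℝ) → ℝ
  | [], f => f
  | α :: l, f => fun x => fderiv ℝ (iterPartial l f) x (Pi.single α 1)

/-- Indeterminates for polynomial expressions in the jet of `g` at a boundary point and a
tangential direction `w` there. -/
inductive JetVar (d : ℕ)
  /-- the component `w^α` -/
  | dir (α : Fin d)
  /-- the entry `g^{αβ}` of the inverse of the boundary metric -/
  | inv (α β : Fin d)
  /-- the reciprocal `K⁻¹` -/
  | recip
  /-- the tangential derivative `∂_l ∂ₙᵏ g_{αβ}` -/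
  | jet (k : ℕ) (l : List (Fin d)) (α β : Fin d)

/-- The order of the normal derivatives of `g` that enter an indeterminate. -/
def JetVar.normalOrder {d : ℕ} : JetVar d → ℕ
  | .dir _ => 0
  | .inv _ _ => 0
  | .recip => 1
  | .jet k _ _ _ => k

/-- The values of the indeterminates at the boundary point `x` in the direction `w`. -/
def SymTensor.jetVal (g : SymTensor d M) (e : BdChart d M) (x w : Fin d → ℝ) : JetVar d → ℝ
  | .dir α => w α
  | .inv α β =>
      (Matrix.of fun i j : Fin d => g.bdMetric e x (Pi.single i 1) (Pi.single j 1))⁻¹ α β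
  | .recip => (g.convexityConst e x w)⁻¹
  | .jet k l α β =>
      iterPartial l (fun y => g.normalDeriv e k y (Pi.single α 1) (Pi.single β 1)) x

end Metric

end

/-! Exit time from the data. All geodesics with initial velocity `v_ε` have energy σ, and their
variation field J in ε vanishes at time 0. Since the t-derivative of g(J, γ') is half the
ε-derivative of the energy, J stays orthogonal to γ' (`ExitFamily.bilin_variation`). At the exit y'
= J + τ'η, so g(y', η) = στ' (`ExitFamily.exists_hasDerivAt`). Hence the scattering relation and the
boundary metric give τ', and τ itself because τ → 0 as ε → 0.

Expansion. In boundary normal coordinates the normal acceleration of a geodesic is ½∂ₙg(γ', γ'),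
which starts near K < 0. The normal coordinate is therefore close to the parabola εt + Kt²/2: times
are O(ε), the normal velocity is O(ε), the height is O(ε²), and the exit is near t = -2ε/K. The
velocity, the inverse metric and all derivatives of the metric along the geodesic satisfy an
infinite system with polynomial right-hand sides, in which a further normal derivative always
carries a factor O(ε), the normal velocity, and each integration in t gains another ε. Consequently
the jet of normal order below m determines ∂ₙᵏg along the curve up to O(ε^(2(m-k)))
(`BoundaryFlow.known_flow`). The derivative of order m first enters the acceleration through
½∂ₙᵐg(v, v)/(m-1)! times the (m-1)-st power of the parabola (`BoundaryFlow.known_acc_sub`).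
Integrating twice and evaluating at t = -2ε/K produces a beta integral, hence the factor m!/(2m)!;
solving the exit equation by iteration gives the expansion (`BoundaryFlow.exists_τ_expansion`). The
structure `BoundaryFlow` isolates the system from the manifold, so that the polynomials are chosen
before any metric is given and are universal.

Geodesics. The geodesic field lives on a half-space only. It is extended by a C¹ reflection
(`exists_contDiffAt_extension`), which gives a flow differentiable in the initial value
(`exists_variation`); concavity of the normal coordinate gives a unique transversal exit
(`exists_exit_of_concave`), and an open-closed argument identifies it with the exit of geodesics of
M (`SymTensor.IsChartGeodesic.exitsAt`).

Determination. Let two metrics have the same data. Their exit times agree, hence so do the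
coefficients of the expansions. If the normal derivatives of order below m agree near p, so do their
tangential derivatives, and the coefficient of order 2m-1 yields ∂ₙᵐg(v, v), its factor being
nonzero. All hypotheses are open in (p, v), so this holds for nearby points and directions;
polarization gives ∂ₙᵐg near p and the induction continues
(`SymTensor.IsDatum.eventually_normalDeriv_eq`). -/

noncomputable section

/-! ### Expansions along families of short curves -/

/-- The filter of pairs `(ε, t)` with `ε → 0⁺` and `0 ≤ t ≤ τ ε`. -/
def shortTimes (τ : ℝ → ℝ) : Filter (ℝ × ℝ) :=
  comap Prod.fst (𝓝[>] (0 : ℝ)) ⊓ 𝓟 {z | z.2 ∈ Icc 0 (τ z.1)}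

theorem eventually_shortTimes {τ : ℝ → ℝ} {P : ℝ × ℝ → Prop} :
    (∀ᶠ z in shortTimes τ, P z) ↔ ∀ᶠ ε in 𝓝[>] (0 : ℝ), ∀ t ∈ Icc 0 (τ ε), P (ε, t) := by
  rw [shortTimes, eventually_inf_principal, eventually_comap]
  constructor
  · intro h
    filter_upwards [h] with ε hε t ht using hε (ε, t) rfl ht
  · intro h
    filter_upwards [h] with ε hε z hz hz'
    obtain ⟨a, t⟩ := z
    obtain rfl : a = ε := hz
    exact hε t hz'

theorem tendsto_fst_shortTimes (τ : ℝ → ℝ) : Tendsto Prod.fst (shortTimes τ) (𝓝[>] (0 : ℝ)) :=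
  tendsto_comap.mono_left inf_le_left

theorem isBigO_pow_of_le {m n : ℕ} (h : m ≤ n) :
    (fun ε : ℝ => ε ^ n) =O[𝓝[>] 0] fun ε : ℝ => ε ^ m := by
  refine IsBigO.of_bound 1 ?_
  filter_upwards [Ioo_mem_nhdsGT (zero_lt_one' ℝ)] with ε hε
  rw [one_mul, norm_pow, norm_pow, Real.norm_of_nonneg hε.1.le]
  exact pow_le_pow_of_le_one hε.1.le hε.2.le h

theorem isBigO_shortTimes_pow_of_le (τ : ℝ → ℝ) {m n : ℕ} (h : m ≤ n) :
    (fun z : ℝ × ℝ => z.1 ^ n) =O[shortTimes τ] fun z => z.1 ^ m :=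
  (isBigO_pow_of_le h).comp_tendsto (tendsto_fst_shortTimes τ)

theorem isBigO_shortTimes_iff {τ : ℝ → ℝ} {f : ℝ × ℝ → ℝ} {n : ℕ} :
    f =O[shortTimes τ] (fun z => z.1 ^ n) ↔
      ∃ C, 0 ≤ C ∧ ∀ᶠ ε in 𝓝[>] (0 : ℝ), ∀ t ∈ Icc 0 (τ ε), |f (ε, t)| ≤ C * ε ^ n := by
  constructor
  · intro h
    obtain ⟨C, hC, h⟩ := h.exists_nonneg
    refine ⟨C, hC, ?_⟩
    have := eventually_shortTimes.1 h.bound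
    filter_upwards [this, self_mem_nhdsWithin] with ε hε hpos t ht
    have h1 := hε t ht
    rwa [Real.norm_eq_abs, Real.norm_eq_abs, abs_of_pos (pow_pos (mem_Ioi.1 hpos) n)] at h1
  · rintro ⟨C, -, h⟩
    refine IsBigO.of_bound C (eventually_shortTimes.2 ?_)
    filter_upwards [h, self_mem_nhdsWithin] with ε hε hpos t ht
    rw [Real.norm_eq_abs, Real.norm_eq_abs, abs_of_pos (pow_pos (mem_Ioi.1 hpos) n)]
    exact hε t ht

/-- Integrating in `t` over times of size `O(ε)` gains one order in `ε`. -/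
theorem isBigO_of_hasDerivWithinAt {τ : ℝ → ℝ} (hτ : τ =O[𝓝[>] 0] fun ε : ℝ => ε)
    {f f' : ℝ × ℝ → ℝ} {n : ℕ}
    (hd : ∀ᶠ ε in 𝓝[>] (0 : ℝ), ∀ t ∈ Icc 0 (τ ε),
      HasDerivWithinAt (fun s => f (ε, s)) (f' (ε, t)) (Icc 0 (τ ε)) t)
    (h0 : (fun ε => f (ε, 0)) =O[𝓝[>] 0] fun ε : ℝ => ε ^ (n + 1))
    (h' : f' =O[shortTimes τ] fun z => z.1 ^ n) :
    f =O[shortTimes τ] fun z => z.1 ^ (n + 1) := by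
  obtain ⟨C, hC, h'⟩ := isBigO_shortTimes_iff.1 h'
  obtain ⟨D, hD, hτ⟩ := hτ.exists_nonneg
  obtain ⟨A, hA, h0⟩ := h0.exists_nonneg
  refine isBigO_shortTimes_iff.2 ⟨A + C * D, by positivity, ?_⟩
  filter_upwards [hd, h', hτ.bound, h0.bound, self_mem_nhdsWithin] with ε hd h' hτ h0 hpos t ht
  have hpos : 0 < ε := hpos
  have h1 : |f (ε, t) - f (ε, 0)| ≤ C * ε ^ n * |t - 0| := by
    have := (convex_Icc (0 : ℝ) (τ ε)).norm_image_sub_le_of_norm_hasDerivWithin_le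
      (f := fun s => f (ε, s)) (f' := fun s => f' (ε, s)) (C := C * ε ^ n) (x := 0) (y := t)
      (fun s hs => hd s hs) (fun s hs => h' s hs) ⟨le_rfl, ht.1.trans ht.2⟩ ht
    simpa [Real.norm_eq_abs] using this
  have h2 : |t - 0| ≤ D * ε := by
    rw [sub_zero, abs_of_nonneg ht.1]
    refine ht.2.trans ((le_abs_self _).trans ?_)
    simpa [Real.norm_eq_abs, abs_of_pos hpos] using hτ
  have h3 : |f (ε, 0)| ≤ A * ε ^ (n + 1) := by
    simpa [Real.norm_eq_abs, abs_of_pos hpos] using h0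
  calc |f (ε, t)| ≤ |f (ε, t) - f (ε, 0)| + |f (ε, 0)| := by
        simpa using abs_add_le (f (ε, t) - f (ε, 0)) (f (ε, 0))
    _ ≤ C * ε ^ n * (D * ε) + A * ε ^ (n + 1) := by
        gcongr
        exact h1.trans (by gcongr)
    _ = _ := by ring

/-- The limit at 0 kills the constant coefficient; dividing by X lowers the order by one. This is
the source of every uniqueness statement for expansion coefficients below. -/
theorem Polynomial.coeff_eq_zero_of_isBigO {n : ℕ} {p : Polynomial ℝ}
    (h : (fun ε => p.eval ε) =O[𝓝[>] 0] fun ε : ℝ => ε ^ n) : ∀ k < n, p.coeff k = 0 := by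
  induction n generalizing p with
  | zero => intro k hk; exact absurd hk (Nat.not_lt_zero k)
  | succ n ih =>
    have hp0 : p.coeff 0 = 0 := by
      have h1 : Tendsto (fun ε => p.eval ε) (𝓝[>] 0) (𝓝 (p.eval 0)) :=
        (p.continuous.tendsto 0).mono_left nhdsWithin_le_nhds
      have h2 : Tendsto (fun ε : ℝ => ε ^ (n + 1)) (𝓝[>] 0) (𝓝 0) := by
        have : Tendsto (fun ε : ℝ => ε ^ (n + 1)) (𝓝 0) (𝓝 (0 ^ (n + 1))) :=
          (continuous_pow (n + 1)).tendsto 0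
        rw [zero_pow n.succ_ne_zero] at this
        exact this.mono_left nhdsWithin_le_nhds
      rw [Polynomial.coeff_zero_eq_eval_zero]
      exact tendsto_nhds_unique h1 (h.trans_tendsto h2)
    have hq : (fun ε => p.divX.eval ε) =O[𝓝[>] 0] fun ε : ℝ => ε ^ n := by
      obtain ⟨C, hC⟩ := h.bound
      refine IsBigO.of_bound C ?_
      filter_upwards [hC, self_mem_nhdsWithin] with ε hε hpos
      have hpos : 0 < ε := hpos
      have h3 : p.eval ε = p.divX.eval ε * ε := by
        conv_lhs => rw [← Polynomial.divX_mul_X_add p]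
        simp [hp0]
      rw [h3, norm_mul, pow_succ, norm_mul, ← mul_assoc] at hε
      exact le_of_mul_le_mul_right hε (norm_pos_iff.2 hpos.ne')
    intro k hk
    cases k with
    | zero => exact hp0
    | succ k =>
      have := ih hq k (by omega)
      rwa [Polynomial.coeff_divX] at this

/-! ### The jet of a metric along a family of geodesics -/

/-- The values, along a family of curves parametrized by `ε` and defined for times in
`[0, τ ε]`, of the normal coordinate, of the velocity, of the inverse boundary metric and of all
derivatives of the tangential components of a metric, subject to the geodesic equation in boundary
normal coordinates and to the chain rule. The curves start at the same boundary point with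
velocities `√(1 - s ε²) w + ε ∂ₙ`, and return to the boundary at time `τ ε`. -/
structure BoundaryFlow (d : ℕ) (s : ℚ) where
  baseVal : JetVar d → ℝ
  τ : ℝ → ℝ
  pos : ℝ × ℝ → ℝ
  nvel : ℝ × ℝ → ℝ
  jets : JetVar d → ℝ × ℝ → ℝ
  δ : ℝ
  δ_pos : 0 < δ
  τ_pos : ∀ ε ∈ Ioo 0 δ, 0 < τ ε
  τ_bound : τ =O[𝓝[>] 0] fun ε : ℝ => ε
  jets_bound : ∀ i, jets i =O[shortTimes τ] fun z => z.1 ^ 0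
  pos_zero : ∀ ε ∈ Ioo 0 δ, pos (ε, 0) = 0
  pos_τ : ∀ ε ∈ Ioo 0 δ, pos (ε, τ ε) = 0
  nvel_zero : ∀ ε ∈ Ioo 0 δ, nvel (ε, 0) = ε
  dir_zero : ∀ ε ∈ Ioo 0 δ, ∀ α, jets (.dir α) (ε, 0) = √(1 - s * ε ^ 2) * baseVal (.dir α)
  inv_zero : ∀ ε ∈ Ioo 0 δ, ∀ α β, jets (.inv α β) (ε, 0) = baseVal (.inv α β)
  jet_zero : ∀ ε ∈ Ioo 0 δ, ∀ k l α β, jets (.jet k l α β) (ε, 0) = baseVal (.jet k l α β)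
  pos_deriv : ∀ ε ∈ Ioo 0 δ, ∀ t ∈ Icc 0 (τ ε),
    HasDerivWithinAt (fun r => pos (ε, r)) (nvel (ε, t)) (Icc 0 (τ ε)) t
  nvel_deriv : ∀ ε ∈ Ioo 0 δ, ∀ t ∈ Icc 0 (τ ε),
    HasDerivWithinAt (fun r => nvel (ε, r))
      (1 / 2 * ∑ α, ∑ β, jets (.jet 1 [] α β) (ε, t) * (jets (.dir α) (ε, t)
        * jets (.dir β) (ε, t))) (Icc 0 (τ ε)) t
  dir_deriv : ∀ ε ∈ Ioo 0 δ, ∀ t ∈ Icc 0 (τ ε), ∀ α,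
    HasDerivWithinAt (fun r => jets (.dir α) (ε, r))
      (∑ μ, jets (.inv α μ) (ε, t) *
        (1 / 2 * (∑ β, ∑ γ, jets (.dir β) (ε, t) * jets (.dir γ) (ε, t)
            * jets (.jet 0 [μ] β γ) (ε, t))
          - ∑ β, jets (.dir β) (ε, t) * (jets (.jet 1 [] β μ) (ε, t) * nvel (ε, t)
            + ∑ γ, jets (.dir γ) (ε, t) * jets (.jet 0 [γ] β μ) (ε, t)))) (Icc 0 (τ ε)) t
  inv_deriv : ∀ ε ∈ Ioo 0 δ, ∀ t ∈ Icc 0 (τ ε), ∀ α β,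
    HasDerivWithinAt (fun r => jets (.inv α β) (ε, r))
      (-∑ γ, ∑ μ, jets (.inv α γ) (ε, t) * jets (.inv μ β) (ε, t) *
        (jets (.jet 1 [] γ μ) (ε, t) * nvel (ε, t)
          + ∑ ν, jets (.jet 0 [ν] γ μ) (ε, t) * jets (.dir ν) (ε, t))) (Icc 0 (τ ε)) t
  jet_deriv : ∀ ε ∈ Ioo 0 δ, ∀ t ∈ Icc 0 (τ ε), ∀ k l α β,
    HasDerivWithinAt (fun r => jets (.jet k l α β) (ε, r))
      (jets (.jet (k + 1) l α β) (ε, t) * nvel (ε, t)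
        + ∑ γ, jets (.jet k (γ :: l) α β) (ε, t) * jets (.dir γ) (ε, t)) (Icc 0 (τ ε)) t
  convex : ∑ α, ∑ β, baseVal (.jet 1 [] α β) * (baseVal (.dir α) * baseVal (.dir β)) < 0
  recip_eq : baseVal .recip = (1 / 2 * ∑ α, ∑ β, baseVal (.jet 1 [] α β)
    * (baseVal (.dir α) * baseVal (.dir β)))⁻¹

/-- Polynomial expressions in the indeterminates of normal order less than `m`. -/
abbrev JetPoly (d m : ℕ) : Type := MvPolynomial {i : JetVar d // i.normalOrder < m} ℚ

namespace BoundaryFlow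

variable {d : ℕ} {s : ℚ} {m : ℕ}

theorem eventually_mem (F : BoundaryFlow d s) : ∀ᶠ ε in 𝓝[>] (0 : ℝ), ε ∈ Ioo 0 F.δ :=
  Ioo_mem_nhdsGT F.δ_pos

/-- The constant `K`. -/
def K (F : BoundaryFlow d s) : ℝ :=
  1 / 2 * ∑ α, ∑ β, F.baseVal (.jet 1 [] α β) * (F.baseVal (.dir α) * F.baseVal (.dir β))

theorem K_neg (F : BoundaryFlow d s) : F.K < 0 := by
  have := F.convex
  unfold K
  linarith

/-- Evaluation of a polynomial in `ε`. -/
def evalE (F : BoundaryFlow d s) (ε : ℝ) : Polynomial (JetPoly d m) →+* ℝ :=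
  Polynomial.eval₂RingHom
    ((MvPolynomial.aeval fun i : {i : JetVar d // i.normalOrder < m} => F.baseVal i).toRingHom) ε

/-- Evaluation of a polynomial in `t` and `ε`. -/
def evalT (F : BoundaryFlow d s) (z : ℝ × ℝ) : Polynomial (Polynomial (JetPoly d m)) →+* ℝ :=
  Polynomial.eval₂RingHom (F.evalE z.1) z.2

@[simp] theorem evalE_X (F : BoundaryFlow d s) (ε : ℝ) :
    F.evalE ε (Polynomial.X : Polynomial (JetPoly d m)) = ε := by simp [evalE]

@[simp] theorem evalE_C (F : BoundaryFlow d s) (ε : ℝ) (a : JetPoly d m) :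
    F.evalE ε (Polynomial.C a) = MvPolynomial.aeval (fun i => F.baseVal i.1) a := by
  simp [evalE]

@[simp] theorem evalT_X (F : BoundaryFlow d s) (z : ℝ × ℝ) :
    F.evalT z (Polynomial.X : Polynomial (Polynomial (JetPoly d m))) = z.2 := by simp [evalT]

@[simp] theorem evalT_C (F : BoundaryFlow d s) (z : ℝ × ℝ) (a : Polynomial (JetPoly d m)) :
    F.evalT z (Polynomial.C a) = F.evalE z.1 a := by
  simp [evalT]

theorem evalT_eval (F : BoundaryFlow d s) (ε : ℝ) (p : Polynomial (Polynomial (JetPoly d m)))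
    (T : Polynomial (JetPoly d m)) : F.evalE ε (p.eval T) = F.evalT (ε, F.evalE ε T) p := by
  simp [evalT, Polynomial.eval₂_at_apply]

/-- The family `f` agrees to order `N` with a polynomial in `t` and `ε` with coefficients
polynomial in the jet of normal order less than `m`. -/
def Known (m N : ℕ) (f : BoundaryFlow d s → ℝ × ℝ → ℝ) : Prop :=
  ∃ p : Polynomial (Polynomial (JetPoly d m)), ∀ F : BoundaryFlow d s,
    (fun z => f F z - F.evalT z p) =O[shortTimes F.τ] fun z => z.1 ^ N

/-- The family `f` is `O(ε ^ r)`. -/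
def HasOrder (r : ℕ) (f : BoundaryFlow d s → ℝ × ℝ → ℝ) : Prop :=
  ∀ F, f F =O[shortTimes F.τ] fun z => z.1 ^ r

theorem HasOrder.mono {r r' : ℕ} (h : r' ≤ r) {f : BoundaryFlow d s → ℝ × ℝ → ℝ}
    (hf : HasOrder r f) : HasOrder r' f :=
  fun F => (hf F).trans (isBigO_shortTimes_pow_of_le _ h)

theorem HasOrder.mul {r r' : ℕ} {f g : BoundaryFlow d s → ℝ × ℝ → ℝ}
    (hf : HasOrder r f) (hg : HasOrder r' g) : HasOrder (r + r') fun F z => f F z * g F z := by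
  intro F
  simpa only [pow_add] using (hf F).mul (hg F)

theorem HasOrder.add {r : ℕ} {f g : BoundaryFlow d s → ℝ × ℝ → ℝ}
    (hf : HasOrder r f) (hg : HasOrder r g) : HasOrder r fun F z => f F z + g F z :=
  fun F => (hf F).add (hg F)

theorem HasOrder.sub {r : ℕ} {f g : BoundaryFlow d s → ℝ × ℝ → ℝ}
    (hf : HasOrder r f) (hg : HasOrder r g) : HasOrder r fun F z => f F z - g F z :=
  fun F => (hf F).sub (hg F)

theorem HasOrder.sum {ι : Type*} {u : Finset ι} {r : ℕ}
    {f : ι → BoundaryFlow d s → ℝ × ℝ → ℝ} (hf : ∀ i ∈ u, HasOrder r (f i)) :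
    HasOrder r fun F z => ∑ i ∈ u, f i F z :=
  fun F => (IsBigO.sum fun i hi => hf i hi F).congr_left fun z => by
    simp only [Finset.sum_apply]

theorem hasOrder_const (c : BoundaryFlow d s → ℝ) : HasOrder 0 fun F _ => c F := by
  intro F
  simpa using isBigO_const_const (c F) (one_ne_zero (α := ℝ)) (shortTimes F.τ)

theorem hasOrder_eps : HasOrder 1 fun (_ : BoundaryFlow d s) z => z.1 := by
  intro F
  simpa using isBigO_refl (fun z : ℝ × ℝ => z.1) _

theorem hasOrder_time : HasOrder 1 fun (_ : BoundaryFlow d s) z => z.2 := by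
  intro F
  obtain ⟨C, hC, h⟩ := F.τ_bound.exists_nonneg
  refine isBigO_shortTimes_iff.2 ⟨C, hC, ?_⟩
  filter_upwards [h.bound, self_mem_nhdsWithin] with ε h hpos t ht
  rw [pow_one, abs_of_nonneg ht.1]
  refine ht.2.trans ((le_abs_self _).trans ?_)
  simpa [abs_of_pos (mem_Ioi.1 hpos)] using h

theorem hasOrder_evalE (p : Polynomial (JetPoly d m)) :
    HasOrder 0 fun (F : BoundaryFlow d s) z => F.evalE z.1 p := by
  induction p using Polynomial.induction_on' with
  | add p q hp hq => simpa only [map_add] using hp.add hq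
  | monomial n a =>
    simp only [← Polynomial.C_mul_X_pow_eq_monomial, map_mul, map_pow, evalE_C, evalE_X]
    refine (hasOrder_const _).mul (r' := 0) ?_
    intro F
    exact isBigO_shortTimes_pow_of_le _ (Nat.zero_le _)

theorem Known.mono {N N' : ℕ} (h : N' ≤ N) {f : BoundaryFlow d s → ℝ × ℝ → ℝ}
    (hf : Known m N f) : Known m N' f := by
  obtain ⟨p, hp⟩ := hf
  exact ⟨p, fun F => (hp F).trans (isBigO_shortTimes_pow_of_le _ h)⟩

theorem known_evalT (N : ℕ) (p : Polynomial (Polynomial (JetPoly d m))) :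
    Known m N fun (F : BoundaryFlow d s) z => F.evalT z p :=
  ⟨p, fun F => by simpa using isBigO_zero _ _⟩

theorem known_rat (N : ℕ) (q : ℚ) : Known m N fun (_ : BoundaryFlow d s) _ => (q : ℝ) := by
  simpa using known_evalT (s := s) (d := d) (m := m) N
    (Polynomial.C (Polynomial.C (MvPolynomial.C q)))

theorem HasOrder.known {N : ℕ} {f : BoundaryFlow d s → ℝ × ℝ → ℝ} (hf : HasOrder N f) :
    Known m N f :=
  ⟨0, fun F => by simpa using hf F⟩

theorem Known.add {N : ℕ} {f g : BoundaryFlow d s → ℝ × ℝ → ℝ} (hf : Known m N f)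
    (hg : Known m N g) : Known m N fun F z => f F z + g F z := by
  obtain ⟨p, hp⟩ := hf
  obtain ⟨q, hq⟩ := hg
  refine ⟨p + q, fun F => ((hp F).add (hq F)).congr_left fun z => ?_⟩
  rw [map_add]; ring

theorem Known.neg {N : ℕ} {f : BoundaryFlow d s → ℝ × ℝ → ℝ} (hf : Known m N f) :
    Known m N fun F z => -f F z := by
  obtain ⟨p, hp⟩ := hf
  refine ⟨Polynomial.C (Polynomial.C (MvPolynomial.C (-1))) * p, fun F => ((hp F).neg_left).congr_left fun z => ?_⟩
  simp only [map_mul, evalT_C, evalE_C, MvPolynomial.aeval_C, eq_ratCast]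
  push_cast
  ring

theorem Known.sub {N : ℕ} {f g : BoundaryFlow d s → ℝ × ℝ → ℝ} (hf : Known m N f)
    (hg : Known m N g) : Known m N fun F z => f F z - g F z := by
  simpa only [sub_eq_add_neg] using hf.add hg.neg

theorem Known.sum {ι : Type*} {u : Finset ι} {N : ℕ} {f : ι → BoundaryFlow d s → ℝ × ℝ → ℝ}
    (hf : ∀ i ∈ u, Known m N (f i)) : Known m N fun F z => ∑ i ∈ u, f i F z := by
  classical
  induction u using Finset.induction_on with
  | empty => simpa using known_rat (d := d) (s := s) (m := m) N 0
  | insert a u ha ih =>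
    simp only [Finset.sum_insert ha]
    exact (hf a (Finset.mem_insert_self _ _)).add
      (ih fun i hi => hf i (Finset.mem_insert_of_mem hi))

/-- Products: the order of one factor improves the precision to which the other is needed. -/
theorem Known.mul_of_order {N a b r r' : ℕ} {f g : BoundaryFlow d s → ℝ × ℝ → ℝ}
    (hf : Known m a f) (hg : Known m b g) (hfr : HasOrder r f) (hgr : HasOrder r' g)
    (hra : r ≤ a) (h₁ : N ≤ a + r') (h₂ : N ≤ b + r) : Known m N fun F z => f F z * g F z := by
  obtain ⟨p, hp⟩ := hf
  obtain ⟨q, hq⟩ := hg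
  refine ⟨p * q, fun F => ?_⟩
  -- The splitting is fg - pq = (f - p)g + p(g - q). Since `r ≤ a`, the approximating polynomial p
  -- inherits the order of f.
  have hpr : (fun z => F.evalT z p) =O[shortTimes F.τ] fun z => z.1 ^ r := by
    refine ((hfr F).sub ((hp F).trans (isBigO_shortTimes_pow_of_le _ hra))).congr_left
      fun z => by ring
  have h3 := (((hp F).mul (hgr F)).congr_right fun z => (pow_add _ _ _).symm).trans
    (isBigO_shortTimes_pow_of_le _ h₁)
  have h4 := (((hq F).mul hpr).congr_right fun z => (pow_add _ _ _).symm).trans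
    (isBigO_shortTimes_pow_of_le _ h₂)
  refine (h3.add h4).congr_left fun z => ?_
  rw [map_mul]; ring

theorem Known.mul {N : ℕ} {f g : BoundaryFlow d s → ℝ × ℝ → ℝ}
    (hf : Known m N f) (hg : Known m N g) (hfr : HasOrder 0 f) (hgr : HasOrder 0 g) :
    Known m N fun F z => f F z * g F z :=
  hf.mul_of_order hg hfr hgr (Nat.zero_le _) le_rfl le_rfl

/-- The second antiderivative is recorded as `t ^ 2` times a polynomial `B`, so that the exit
equation can be divided by the exit time inside the polynomial ring. -/
theorem exists_antideriv (p : Polynomial (Polynomial (JetPoly d m))) :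
    ∃ P B : Polynomial (Polynomial (JetPoly d m)), ∀ (F : BoundaryFlow d s) (ε : ℝ),
      (∀ t, HasDerivAt (fun t => F.evalT (ε, t) P) (F.evalT (ε, t) p) t) ∧
      F.evalT (ε, 0) P = 0 ∧
      (∀ t, HasDerivAt (fun t => t ^ 2 * F.evalT (ε, t) B) (F.evalT (ε, t) P) t) ∧
      2 * F.evalT (ε, 0) B = F.evalT (ε, 0) p := by
  induction p using Polynomial.induction_on' with
  | add p q hp hq =>
    obtain ⟨P, B, h⟩ := hp
    obtain ⟨P', B', h'⟩ := hq
    refine ⟨P + P', B + B', fun F ε => ?_⟩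
    obtain ⟨h1, h2, h3, h4⟩ := h F ε
    obtain ⟨h1', h2', h3', h4'⟩ := h' F ε
    simp only [map_add]
    refine ⟨fun t => (h1 t).add (h1' t), by rw [h2, h2', add_zero], fun t => ?_,
      by rw [mul_add, h4, h4']⟩
    simp only [mul_add]
    exact (h3 t).add (h3' t)
  | monomial n a =>
    let c (q : ℚ) : Polynomial (Polynomial (JetPoly d m)) :=
      Polynomial.C (Polynomial.C (MvPolynomial.C q))
    refine ⟨c (1 / (n + 1)) * Polynomial.C a * Polynomial.X ^ (n + 1),
      c (1 / ((n + 1) * (n + 2))) * Polynomial.C a * Polynomial.X ^ n, fun F ε => ?_⟩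
    have hn : (n : ℝ) + 1 ≠ 0 := by positivity
    have hn2 : (n : ℝ) + 2 ≠ 0 := by positivity
    simp only [← Polynomial.C_mul_X_pow_eq_monomial, map_mul, map_pow, evalT_C, evalT_X, c,
      evalE_C, MvPolynomial.aeval_C, eq_ratCast]
    push_cast
    refine ⟨fun t => ?_, by simp, fun t => ?_, ?_⟩
    · refine ((hasDerivAt_pow (n + 1) t).const_mul _).congr_deriv ?_
      push_cast
      field_simp
    · have : HasDerivAt (fun t : ℝ => 1 / (((n : ℝ) + 1) * (n + 2)) * F.evalE ε a * t ^ (n + 2))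
          (1 / ((n : ℝ) + 1) * F.evalE ε a * t ^ (n + 1)) t := by
        refine ((hasDerivAt_pow (n + 2) t).const_mul _).congr_deriv ?_
        push_cast
        field_simp
      convert! this using 2
      ring
    · cases n with
      | zero => simp
      | succ n => simp

/-- Integration of an expansion in `t`. -/
theorem Known.integrate {N : ℕ} {f f' : BoundaryFlow d s → ℝ × ℝ → ℝ}
    (hd : ∀ F : BoundaryFlow d s, ∀ ε ∈ Ioo 0 F.δ, ∀ t ∈ Icc 0 (F.τ ε),
      HasDerivWithinAt (fun r => f F (ε, r)) (f' F (ε, t)) (Icc 0 (F.τ ε)) t)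
    (h0 : ∃ q : Polynomial (JetPoly d m), ∀ F : BoundaryFlow d s,
      (fun ε => f F (ε, 0) - F.evalE ε q) =O[𝓝[>] 0] fun ε : ℝ => ε ^ (N + 1))
    (h' : Known m N f') : Known m (N + 1) f := by
  obtain ⟨q, hq⟩ := h0
  obtain ⟨p, hp⟩ := h'
  obtain ⟨P, _, hP⟩ := exists_antideriv (s := s) p
  refine ⟨P + Polynomial.C q, fun F => ?_⟩
  refine isBigO_of_hasDerivWithinAt F.τ_bound (f' := fun z => f' F z - F.evalT z p) ?_ ?_ (hp F)
  · filter_upwards [F.eventually_mem] with ε hε t ht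
    simp only [map_add, evalT_C]
    exact (hd F ε hε t ht).sub (((hP F ε).1 t).hasDerivWithinAt.add_const _)
  · refine (hq F).congr_left fun ε => ?_
    simp [(hP F ε).2.1]

end BoundaryFlow
end

/-! ### Propagation of expansions along the flow -/

noncomputable section

namespace BoundaryFlow

variable {d : ℕ} {s : ℚ} {m : ℕ}

theorem isBigO_sqrt_sub_one (s : ℝ) :
    (fun ε : ℝ => √(1 - s * ε ^ 2) - 1) =O[𝓝[>] 0] fun ε : ℝ => ε ^ 2 := by
  refine IsBigO.of_bound |s| ?_
  have h1 : ∀ᶠ ε in 𝓝[>] (0 : ℝ), 0 < 1 - s * ε ^ 2 := by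
    have : ContinuousAt (fun ε : ℝ => 1 - s * ε ^ 2) 0 := by fun_prop
    have h2 := this.eventually (p := fun y => 0 < y) (by
      have : (0 : ℝ) < 1 - s * 0 ^ 2 := by norm_num
      exact lt_mem_nhds this)
    exact h2.filter_mono nhdsWithin_le_nhds
  filter_upwards [h1] with ε hε
  have h2 := Real.sq_sqrt hε.le
  have h3 := Real.sqrt_nonneg (1 - s * ε ^ 2)
  have h4 : (√(1 - s * ε ^ 2) - 1) * (√(1 - s * ε ^ 2) + 1) = -(s * ε ^ 2) := by linarith
  calc ‖√(1 - s * ε ^ 2) - 1‖ ≤ ‖√(1 - s * ε ^ 2) - 1‖ * |√(1 - s * ε ^ 2) + 1| := by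
        refine le_mul_of_one_le_right (norm_nonneg _) ?_
        rw [abs_of_nonneg (by linarith)]
        linarith
    _ = ‖-(s * ε ^ 2)‖ := by rw [← h4, norm_mul, Real.norm_eq_abs (√(1 - s * ε ^ 2) + 1)]
    _ = |s| * ‖ε ^ 2‖ := by rw [norm_neg, norm_mul, Real.norm_eq_abs]

theorem eventually_sq_sqrt (s : ℝ) :
    ∀ᶠ ε in 𝓝[>] (0 : ℝ), √(1 - s * ε ^ 2) ^ 2 = 1 - s * ε ^ 2 := by
  have : ContinuousAt (fun ε : ℝ => 1 - s * ε ^ 2) 0 := by fun_prop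
  have h2 := this.eventually (p := fun y => 0 < y) (by
    have : (0 : ℝ) < 1 - s * 0 ^ 2 := by norm_num
    exact lt_mem_nhds this)
  filter_upwards [h2.filter_mono nhdsWithin_le_nhds] with ε hε
  exact Real.sq_sqrt hε.le

-- The root y of 1 - sε² satisfies y = 1 - ½(sε² + (y - 1)²). As y - 1 is O(ε), iterating this
-- identity gains one order each time and keeps the coefficients rational.
variable (d s m) in
theorem exists_sqrt_expansion (N : ℕ) : ∃ q : Polynomial (JetPoly d m),
    ∀ F : BoundaryFlow d s,
      (fun ε : ℝ => √(1 - s * ε ^ 2) - F.evalE ε q) =O[𝓝[>] 0] fun ε : ℝ => ε ^ (N + 1) := by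
  induction N with
  | zero =>
    refine ⟨1, fun F => ?_⟩
    simp only [map_one]
    exact (isBigO_sqrt_sub_one s).trans (isBigO_pow_of_le (by norm_num))
  | succ N ih =>
    obtain ⟨q, hq⟩ := ih
    let c (q : ℚ) : Polynomial (JetPoly d m) := Polynomial.C (MvPolynomial.C q)
    refine ⟨1 + c (-1 / 2) * (c s * Polynomial.X ^ 2 + (q + c (-1)) ^ 2), fun F => ?_⟩
    have h1 : (fun ε : ℝ => √(1 - s * ε ^ 2) - 1) =O[𝓝[>] 0] fun ε : ℝ => ε ^ 1 :=
      (isBigO_sqrt_sub_one s).trans (isBigO_pow_of_le (by norm_num))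
    have h2 : (fun ε : ℝ => √(1 - s * ε ^ 2) + F.evalE ε q - 2) =O[𝓝[>] 0]
        fun ε : ℝ => ε ^ 1 := by
      refine ((h1.const_mul_left 2).sub ((hq F).trans
        (isBigO_pow_of_le (Nat.le_add_left 1 N)))).congr_left fun ε => by ring
    have h3 := (((hq F).mul h2).const_mul_left (-1 / 2)).congr_right fun ε => (pow_add ε _ _).symm
    refine h3.congr' ?_ EventuallyEq.rfl
    filter_upwards [eventually_sq_sqrt (s : ℝ)] with ε hε
    simp only [map_add, map_mul, map_pow, map_one, c, evalE_C, evalE_X, MvPolynomial.aeval_C,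
      eq_ratCast]
    push_cast
    linear_combination (-1 / 2 : ℝ) * hε

theorem hasOrder_jets (i : JetVar d) : HasOrder 0 fun (F : BoundaryFlow d s) => F.jets i :=
  fun F => F.jets_bound i

/-- The acceleration in the normal direction. -/
def acc (F : BoundaryFlow d s) (z : ℝ × ℝ) : ℝ :=
  1 / 2 * ∑ α, ∑ β, F.jets (.jet 1 [] α β) z * (F.jets (.dir α) z * F.jets (.dir β) z)

theorem hasOrder_acc : HasOrder 0 fun (F : BoundaryFlow d s) => F.acc := by
  refine (hasOrder_const fun _ => 1 / 2).mul (r' := 0) (HasOrder.sum fun α _ => HasOrder.sum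
    fun β _ => ?_)
  exact (hasOrder_jets _).mul ((hasOrder_jets _).mul (hasOrder_jets _))

theorem HasOrder.integrate {N : ℕ} {f f' : BoundaryFlow d s → ℝ × ℝ → ℝ}
    (hd : ∀ F : BoundaryFlow d s, ∀ ε ∈ Ioo 0 F.δ, ∀ t ∈ Icc 0 (F.τ ε),
      HasDerivWithinAt (fun r => f F (ε, r)) (f' F (ε, t)) (Icc 0 (F.τ ε)) t)
    (h0 : ∀ F : BoundaryFlow d s, (fun ε => f F (ε, 0)) =O[𝓝[>] 0] fun ε : ℝ => ε ^ (N + 1))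
    (h' : HasOrder N f') : HasOrder (N + 1) f := by
  intro F
  refine isBigO_of_hasDerivWithinAt F.τ_bound ?_ (h0 F) (h' F)
  filter_upwards [F.eventually_mem] with ε hε t ht using hd F ε hε t ht

theorem hasOrder_nvel : HasOrder 1 fun (F : BoundaryFlow d s) => F.nvel := by
  refine HasOrder.integrate (f' := fun F => F.acc) (fun F ε hε t ht => F.nvel_deriv ε hε t ht)
    (fun F => ?_) hasOrder_acc
  refine (isBigO_refl (fun ε : ℝ => ε ^ (0 + 1)) _).congr' ?_ EventuallyEq.rfl
  filter_upwards [F.eventually_mem] with ε hε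
  rw [F.nvel_zero ε hε]; simp

theorem isBigO_sub_congr {f g : ℝ → ℝ} {n : ℕ} (h : ∀ᶠ ε in 𝓝[>] (0 : ℝ), f ε = g ε) :
    (fun ε => f ε - g ε) =O[𝓝[>] 0] fun ε : ℝ => ε ^ n := by
  refine (isBigO_zero (fun ε : ℝ => ε ^ n) (𝓝[>] (0 : ℝ))).congr' ?_ EventuallyEq.rfl
  filter_upwards [h] with ε hε
  rw [hε, sub_self]

theorem exists_init_dir (N : ℕ) (hm : 0 < m) (α : Fin d) : ∃ q : Polynomial (JetPoly d m),
    ∀ F : BoundaryFlow d s,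
      (fun ε => F.jets (.dir α) (ε, 0) - F.evalE ε q) =O[𝓝[>] 0] fun ε : ℝ => ε ^ (N + 1) := by
  obtain ⟨q, hq⟩ := exists_sqrt_expansion d s m N
  refine ⟨q * Polynomial.C (MvPolynomial.X ⟨.dir α, hm⟩), fun F => ?_⟩
  refine ((hq F).const_mul_left (F.baseVal (.dir α))).congr' ?_ EventuallyEq.rfl
  filter_upwards [F.eventually_mem] with ε hε
  rw [F.dir_zero ε hε]
  simp
  ring

theorem exists_init_jet (N : ℕ) {k : ℕ} (hk : k < m) (l : List (Fin d)) (α β : Fin d) :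
    ∃ q : Polynomial (JetPoly d m), ∀ F : BoundaryFlow d s,
      (fun ε => F.jets (.jet k l α β) (ε, 0) - F.evalE ε q)
        =O[𝓝[>] 0] fun ε : ℝ => ε ^ (N + 1) := by
  refine ⟨Polynomial.C (MvPolynomial.X ⟨.jet k l α β, hk⟩), fun F => isBigO_sub_congr ?_⟩
  filter_upwards [F.eventually_mem] with ε hε
  rw [F.jet_zero ε hε]; simp

theorem exists_init_inv (N : ℕ) (hm : 0 < m) (α β : Fin d) :
    ∃ q : Polynomial (JetPoly d m), ∀ F : BoundaryFlow d s,
      (fun ε => F.jets (.inv α β) (ε, 0) - F.evalE ε q)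
        =O[𝓝[>] 0] fun ε : ℝ => ε ^ (N + 1) := by
  refine ⟨Polynomial.C (MvPolynomial.X ⟨.inv α β, hm⟩), fun F => isBigO_sub_congr ?_⟩
  filter_upwards [F.eventually_mem] with ε hε
  rw [F.inv_zero ε hε]; simp

theorem exists_init_nvel (N : ℕ) :
    ∃ q : Polynomial (JetPoly d m), ∀ F : BoundaryFlow d s,
      (fun ε => F.nvel (ε, 0) - F.evalE ε q)
        =O[𝓝[>] 0] fun ε : ℝ => ε ^ (N + 1) := by
  refine ⟨Polynomial.X, fun F => isBigO_sub_congr ?_⟩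
  filter_upwards [F.eventually_mem] with ε hε
  rw [F.nvel_zero ε hε]; simp

/-- The order to which the derivatives of the metric along the curves are determined by the jet of
normal order less than `m`. -/
theorem known_flow (hm : 0 < m) (N : ℕ) :
    Known m (min N (2 * m - 1)) (fun (F : BoundaryFlow d s) => F.nvel) ∧
    (∀ α, Known m (min N (2 * m)) fun (F : BoundaryFlow d s) => F.jets (.dir α)) ∧
    (∀ α β, Known m (min N (2 * m)) fun (F : BoundaryFlow d s) => F.jets (.inv α β)) ∧
    ∀ k l α β, Known m (min N (2 * (m - k))) fun (F : BoundaryFlow d s) =>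
      F.jets (.jet k l α β) := by
  -- Induction on the precision: right-hand sides known to order `N` give the unknowns to order `N +
  -- 1`, up to a cap. The cap `2 * (m - k)` comes from the term of normal order `k + 1` in the
  -- equation; truncated subtraction makes it 0 for `k ≥ m`, where only boundedness is used.
  induction N with
  | zero =>
    simp only [Nat.zero_min]
    exact ⟨(hasOrder_nvel.mono (Nat.zero_le _)).known, fun _ => (hasOrder_jets _).known,
      fun _ _ => (hasOrder_jets _).known, fun _ _ _ _ => (hasOrder_jets _).known⟩
  | succ N ih =>
    obtain ⟨hn, hdir, hinv, hjet⟩ := ih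
    have hnN : N ≤ 2 * m - 1 → Known m N (fun (F : BoundaryFlow d s) => F.nvel) := by
      intro h; rwa [min_eq_left h] at hn
    have hjetN : ∀ k l α β, N ≤ 2 * (m - k) → Known m N fun (F : BoundaryFlow d s) =>
        F.jets (.jet k l α β) := by
      intro k l α β h
      have := hjet k l α β
      rwa [min_eq_left h] at this
    -- The normal velocity is O(ε), so the jet beside it is needed to one order less. With the order
    -- gained by integration, each normal derivative costs two orders.
    have hjn : ∀ k l α β, N ≤ 2 * (m - k) + 1 → N ≤ 2 * m - 1 →
        Known m N fun (F : BoundaryFlow d s) z => F.jets (.jet k l α β) z * F.nvel z := by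
      intro k l α β h h'
      rcases Nat.eq_zero_or_pos N with rfl | hN
      · exact (((hasOrder_jets _).mul hasOrder_nvel).mono (Nat.zero_le _)).known
      · have := (hnN h').mul_of_order (N := N) (hjet k l α β) hasOrder_nvel (hasOrder_jets _) hN
          le_rfl (by omega)
        simpa only [mul_comm] using this
    have hjo : ∀ k l α β, HasOrder 0 fun (F : BoundaryFlow d s) z =>
        F.jets (.jet k l α β) z * F.nvel z :=
      fun k l α β => ((hasOrder_jets _).mul hasOrder_nvel).mono (Nat.zero_le _)
    have hdirN : N ≤ 2 * m → ∀ α, Known m N fun (F : BoundaryFlow d s) => F.jets (.dir α) := by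
      intro h α; have := hdir α; rwa [min_eq_left h] at this
    have hinvN : N ≤ 2 * m → ∀ α β,
        Known m N fun (F : BoundaryFlow d s) => F.jets (.inv α β) := by
      intro h α β; have := hinv α β; rwa [min_eq_left h] at this
    have hO2 : ∀ i j : JetVar d, HasOrder 0 fun (F : BoundaryFlow d s) z =>
        F.jets i z * F.jets j z := fun i j => (hasOrder_jets i).mul (hasOrder_jets j)
    refine ⟨?_, fun α => ?_, fun α β => ?_, fun k l α β => ?_⟩
    · rcases le_or_gt (2 * m - 1) N with h | h
      · rw [min_eq_right (by omega)]; rwa [min_eq_right h] at hn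
      · rw [min_eq_left (by omega)]
        refine Known.integrate (f' := fun F z => F.acc z)
          (fun F ε hε t ht => F.nvel_deriv ε hε t ht)
          (exists_init_nvel N) ?_
        unfold acc
        refine Known.mul (f := fun _ _ => 1 / 2) ?_ ?_ (hasOrder_const _)
          (HasOrder.sum fun α _ => HasOrder.sum fun β _ => (hasOrder_jets _).mul (hO2 _ _))
        · simpa using known_rat (d := d) (s := s) (m := m) N (1 / 2)
        · refine Known.sum fun α _ => Known.sum fun β _ => ?_
          exact (hjetN 1 [] α β (by omega)).mul ((hdirN (by omega) α).mul (hdirN (by omega) β)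
            (hasOrder_jets _) (hasOrder_jets _)) (hasOrder_jets _) (hO2 _ _)
    · rcases le_or_gt (2 * m) N with h | h
      · rw [min_eq_right (by omega)]; have := hdir α; rwa [min_eq_right h] at this
      · rw [min_eq_left (by omega)]
        refine Known.integrate (f' := fun F z => ∑ μ, F.jets (.inv α μ) z *
            (1 / 2 * (∑ β, ∑ γ, F.jets (.dir β) z * F.jets (.dir γ) z * F.jets (.jet 0 [μ] β γ) z)
              - ∑ β, F.jets (.dir β) z * (F.jets (.jet 1 [] β μ) z * F.nvel z
                + ∑ γ, F.jets (.dir γ) z * F.jets (.jet 0 [γ] β μ) z)))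
          (fun F ε hε t ht => F.dir_deriv ε hε t ht α)
          (exists_init_dir N hm α) ?_
        have o1 : ∀ μ β γ, HasOrder 0 fun (F : BoundaryFlow d s) z =>
            F.jets (.dir β) z * F.jets (.dir γ) z * F.jets (.jet 0 [μ] β γ) z :=
          fun μ β γ => (hO2 _ _).mul (hasOrder_jets _)
        have o2 : ∀ μ β, HasOrder 0 fun (F : BoundaryFlow d s) z =>
            F.jets (.jet 1 [] β μ) z * F.nvel z
              + ∑ γ, F.jets (.dir γ) z * F.jets (.jet 0 [γ] β μ) z :=
          fun μ β => (hjo _ _ _ _).add (HasOrder.sum fun γ _ => hO2 _ _)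
        have k1 : Known m N fun (_ : BoundaryFlow d s) _ => (1 / 2 : ℝ) := by
          simpa using known_rat (d := d) (s := s) (m := m) N (1 / 2)
        have o1' : ∀ μ, HasOrder 0 fun (F : BoundaryFlow d s) z => ∑ β, ∑ γ,
            F.jets (.dir β) z * F.jets (.dir γ) z * F.jets (.jet 0 [μ] β γ) z :=
          fun μ => HasOrder.sum fun β _ => HasOrder.sum fun γ _ => o1 μ β γ
        have o2' : ∀ μ, HasOrder 0 fun (F : BoundaryFlow d s) z => ∑ β, F.jets (.dir β) z *
            (F.jets (.jet 1 [] β μ) z * F.nvel z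
              + ∑ γ, F.jets (.dir γ) z * F.jets (.jet 0 [γ] β μ) z) :=
          fun μ => HasOrder.sum fun β _ => (hasOrder_jets _).mul (o2 μ β)
        refine Known.sum fun μ _ => (hinvN (by omega) α μ).mul (Known.sub (k1.mul (Known.sum
          fun β _ => Known.sum fun γ _ => ?_) (hasOrder_const _) (o1' μ)) (Known.sum fun β _ => ?_))
          (hasOrder_jets _) (((hasOrder_const fun _ => 1 / 2).mul (o1' μ)).sub (o2' μ))
        · exact ((hdirN (by omega) β).mul (hdirN (by omega) γ) (hasOrder_jets _)
            (hasOrder_jets _)).mul (hjetN 0 [μ] β γ (by omega)) (hO2 _ _) (hasOrder_jets _)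
        · refine (hdirN (by omega) β).mul ((hjn 1 [] β μ (by omega) (by omega)).add (Known.sum
            fun γ _ => ?_)) (hasOrder_jets _) (o2 μ β)
          exact (hdirN (by omega) γ).mul (hjetN 0 [γ] β μ (by omega)) (hasOrder_jets _)
            (hasOrder_jets _)
    · rcases le_or_gt (2 * m) N with h | h
      · rw [min_eq_right (by omega)]; have := hinv α β; rwa [min_eq_right h] at this
      · rw [min_eq_left (by omega)]
        refine Known.integrate (f' := fun F z => -∑ γ, ∑ μ,
            F.jets (.inv α γ) z * F.jets (.inv μ β) z * (F.jets (.jet 1 [] γ μ) z * F.nvel z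
              + ∑ ν, F.jets (.jet 0 [ν] γ μ) z * F.jets (.dir ν) z))
          (fun F ε hε t ht => F.inv_deriv ε hε t ht α β)
          (exists_init_inv N hm α β) ?_
        refine (Known.sum fun γ _ => Known.sum fun μ _ => ?_).neg
        refine ((hinvN (by omega) α γ).mul (hinvN (by omega) μ β) (hasOrder_jets _)
          (hasOrder_jets _)).mul ((hjn 1 [] γ μ (by omega) (by omega)).add (Known.sum
            fun ν _ => ?_)) (hO2 _ _) ((hjo _ _ _ _).add (HasOrder.sum fun ν _ => hO2 _ _))
        exact (hjetN 0 [ν] γ μ (by omega)).mul (hdirN (by omega) ν) (hasOrder_jets _)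
            (hasOrder_jets _)
    · rcases le_or_gt (2 * (m - k)) N with h | h
      · rw [min_eq_right (by omega)]; have := hjet k l α β; rwa [min_eq_right h] at this
      · rw [min_eq_left (by omega)]
        refine Known.integrate (f' := fun F z => F.jets (.jet (k + 1) l α β) z * F.nvel z
            + ∑ γ, F.jets (.jet k (γ :: l) α β) z * F.jets (.dir γ) z)
          (fun F ε hε t ht => F.jet_deriv ε hε t ht k l α β)
          (exists_init_jet N (by omega) l α β) ?_
        refine (hjn (k + 1) l α β (by omega) (by omega)).add (Known.sum fun γ _ => ?_)
        exact (hjetN k (γ :: l) α β (by omega)).mul (hdirN (by omega) γ) (hasOrder_jets _)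
            (hasOrder_jets _)

end BoundaryFlow
end

/-! ### The beta integral and the leading contribution of the jet of order m -/

noncomputable section

/-- A finite-difference evaluation of the beta integral. -/
theorem sum_choose_div_mul_succ (n c : ℕ) :
    ∑ x ∈ Finset.HasAntidiagonal.antidiagonal n, (n.choose x.1 : ℝ) *
      ((-1) ^ x.1 / (((c + x.1 + 1 : ℕ) : ℝ) * ((c + x.1 + 2 : ℕ) : ℝ)))
      = (n + 1).factorial * c.factorial / (c + n + 2).factorial := by
  induction n generalizing c with
  | zero =>
    have : ((c + 2).factorial : ℝ) = (c + 2 : ℕ) * ((c + 1 : ℕ) * c.factorial) := by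
      rw [Nat.factorial_succ, Nat.factorial_succ]; push_cast; ring
    have h0 : (c.factorial : ℝ) ≠ 0 := by positivity
    simp [this]
    field_simp
  | succ n ih =>
    -- The sum is the integral of s^c (1 - s)^(n+1) over [0, 1], with (1 - s)^n expanded. Pascal's
    -- rule reduces `n + 1` to the sums for `n` at `c` and, with the opposite sign, at `c + 1`.
    have key := Finset.sum_antidiagonal_choose_succ_mul (R := ℝ)
      (fun i _ => (-1) ^ i / (((c + i + 1 : ℕ) : ℝ) * ((c + i + 2 : ℕ) : ℝ))) n
    rw [key]
    have h2 : ∑ x ∈ Finset.HasAntidiagonal.antidiagonal n, (n.choose x.2 : ℝ) *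
        ((-1) ^ (x.1 + 1) / (((c + (x.1 + 1) + 1 : ℕ) : ℝ) * ((c + (x.1 + 1) + 2 : ℕ) : ℝ)))
        = -((n + 1).factorial * (c + 1).factorial / (c + 1 + n + 2).factorial) := by
      rw [← ih (c + 1), ← Finset.sum_neg_distrib]
      refine Finset.sum_congr rfl fun x hx => ?_
      have hx' := Finset.HasAntidiagonal.mem_antidiagonal.1 hx
      rw [Nat.choose_symm_of_eq_add (n := n) (a := x.2) (b := x.1) (by omega)]
      have e1 : c + (x.1 + 1) + 1 = c + 1 + x.1 + 1 := by ring
      have e2 : c + (x.1 + 1) + 2 = c + 1 + x.1 + 2 := by ring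
      rw [e1, e2, pow_succ]
      ring
    rw [h2, ih c]
    have f1 : ((c + (n + 1) + 2).factorial : ℝ) = (c + n + 3 : ℕ) * (c + n + 2).factorial := by
      rw [show c + (n + 1) + 2 = (c + n + 2) + 1 by ring, Nat.factorial_succ]; push_cast; ring
    have f2 : ((c + 1 + n + 2).factorial : ℝ) = (c + n + 3 : ℕ) * (c + n + 2).factorial := by
      rw [show c + 1 + n + 2 = (c + n + 2) + 1 by ring, Nat.factorial_succ]; push_cast; ring
    have f3 : ((c + 1).factorial : ℝ) = (c + 1 : ℕ) * c.factorial := by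
      rw [Nat.factorial_succ]; push_cast; ring
    have f4 : ((n + 1 + 1).factorial : ℝ) = (n + 2 : ℕ) * (n + 1).factorial := by
      rw [Nat.factorial_succ]; push_cast; ring
    rw [f1, f2, f3, f4]
    have h0 : ((c + n + 2).factorial : ℝ) ≠ 0 := by positivity
    push_cast
    field_simp
    ring

/-- The quotient by `t ^ 2` of the second antiderivative of `(ε t + κ t ^ 2) ^ n`. -/
def parabolaInt (n : ℕ) (κ ε t : ℝ) : ℝ :=
  ∑ x ∈ Finset.HasAntidiagonal.antidiagonal n, (n.choose x.1 : ℝ) *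
    (κ ^ x.1 * ε ^ x.2 * t ^ (n + x.1) / (((n + x.1 + 1 : ℕ) : ℝ) * ((n + x.1 + 2 : ℕ) : ℝ)))

theorem exists_antideriv_parabola (n : ℕ) (κ ε : ℝ) : ∃ I : ℝ → ℝ, I 0 = 0 ∧
    (∀ t, HasDerivAt I ((ε * t + κ * t ^ 2) ^ n) t) ∧
    ∀ t, HasDerivAt (fun t => t ^ 2 * parabolaInt n κ ε t) (I t) t := by
  refine ⟨fun t => ∑ x ∈ Finset.HasAntidiagonal.antidiagonal n, (n.choose x.1 : ℝ) *
    (κ ^ x.1 * ε ^ x.2 * t ^ (n + x.1 + 1) / ((n + x.1 + 1 : ℕ) : ℝ)), by simp, fun t => ?_,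
    fun t => ?_⟩
  · have h1 : (ε * t + κ * t ^ 2) ^ n = ∑ x ∈ Finset.HasAntidiagonal.antidiagonal n, (n.choose x.1 : ℝ) *
        (κ ^ x.1 * ε ^ x.2 * t ^ (n + x.1)) := by
      rw [add_comm, (Commute.all _ _).add_pow']
      refine Finset.sum_congr rfl fun x hx => ?_
      have hx' := Finset.HasAntidiagonal.mem_antidiagonal.1 hx
      rw [nsmul_eq_mul, ← hx']
      ring
    rw [h1]
    refine HasDerivAt.fun_sum fun x _ => ?_
    refine ((((hasDerivAt_pow (n + x.1 + 1) t).const_mul (κ ^ x.1 * ε ^ x.2)).div_const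
      ((n + x.1 + 1 : ℕ) : ℝ)).const_mul _).congr_deriv ?_
    have : ((n + x.1 + 1 : ℕ) : ℝ) ≠ 0 := by positivity
    simp only [Nat.add_sub_cancel]
    field_simp
  · have h1 : (fun t : ℝ => t ^ 2 * parabolaInt n κ ε t) = fun t =>
        ∑ x ∈ Finset.HasAntidiagonal.antidiagonal n, (n.choose x.1 : ℝ) * (κ ^ x.1 * ε ^ x.2 * t ^ (n + x.1 + 2)
          / (((n + x.1 + 1 : ℕ) : ℝ) * ((n + x.1 + 2 : ℕ) : ℝ))) := by
      funext t
      rw [parabolaInt, Finset.mul_sum]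
      refine Finset.sum_congr rfl fun x _ => ?_
      ring
    rw [h1]
    refine HasDerivAt.fun_sum fun x _ => ?_
    refine ((((hasDerivAt_pow (n + x.1 + 2) t).const_mul (κ ^ x.1 * ε ^ x.2)).div_const
      (((n + x.1 + 1 : ℕ) : ℝ) * ((n + x.1 + 2 : ℕ) : ℝ))).const_mul _).congr_deriv ?_
    have e : n + x.1 + 2 - 1 = n + x.1 + 1 := by omega
    have h1 : ((n + x.1 + 1 : ℕ) : ℝ) ≠ 0 := by positivity
    have h2 : ((n + x.1 + 2 : ℕ) : ℝ) ≠ 0 := by positivity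
    rw [e]
    field_simp

/-- The time `r * ε` is the second zero of `ε t + κ t ^ 2`. There all terms are of the same size
with alternating signs, and they add up to the beta value of `sum_choose_div_mul_succ` with `c = n`.
-/
theorem parabolaInt_vertex (n : ℕ) {κ r : ℝ} (h : κ * r = -1) (ε : ℝ) :
    parabolaInt n κ ε (r * ε)
      = r ^ n * ((n + 1).factorial * n.factorial / (2 * n + 2).factorial) * ε ^ (2 * n) := by
  have := sum_choose_div_mul_succ n n
  rw [show n + n + 2 = 2 * n + 2 by ring] at this
  rw [← this, parabolaInt, Finset.mul_sum, Finset.sum_mul]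
  refine Finset.sum_congr rfl fun x hx => ?_
  have hx' := Finset.HasAntidiagonal.mem_antidiagonal.1 hx
  have h1 : κ ^ x.1 * ε ^ x.2 * (r * ε) ^ (n + x.1) = (κ * r) ^ x.1 * r ^ n * ε ^ (2 * n) := by
    have : 2 * n = n + x.1 + x.2 := by omega
    rw [this]
    ring
  rw [h1, h]
  ring

namespace BoundaryFlow

variable {d : ℕ} {s : ℚ} {m : ℕ}

theorem hasOrder_jet_sub (k : ℕ) (l : List (Fin d)) (α β : Fin d) :
    HasOrder 1 fun (F : BoundaryFlow d s) z =>
      F.jets (.jet k l α β) z - F.baseVal (.jet k l α β) := by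
  refine HasOrder.integrate (N := 0) (f' := fun F z => F.jets (.jet (k + 1) l α β) z * F.nvel z
    + ∑ γ, F.jets (.jet k (γ :: l) α β) z * F.jets (.dir γ) z)
    (fun F ε hε t ht => (F.jet_deriv ε hε t ht k l α β).sub_const _) (fun F => ?_) ?_
  · refine isBigO_sub_congr ?_
    filter_upwards [F.eventually_mem] with ε hε using F.jet_zero ε hε k l α β
  · exact (((hasOrder_jets _).mul hasOrder_nvel).mono (Nat.zero_le _)).add
      (HasOrder.sum fun γ _ => (hasOrder_jets _).mul (hasOrder_jets _))

theorem hasOrder_dir_sub (α : Fin d) :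
    HasOrder 1 fun (F : BoundaryFlow d s) z => F.jets (.dir α) z - F.baseVal (.dir α) := by
  refine HasOrder.integrate (N := 0) (f' := fun F z => ∑ μ, F.jets (.inv α μ) z *
      (1 / 2 * (∑ β, ∑ γ, F.jets (.dir β) z * F.jets (.dir γ) z * F.jets (.jet 0 [μ] β γ) z)
        - ∑ β, F.jets (.dir β) z * (F.jets (.jet 1 [] β μ) z * F.nvel z
          + ∑ γ, F.jets (.dir γ) z * F.jets (.jet 0 [γ] β μ) z)))
    (fun F ε hε t ht => (F.dir_deriv ε hε t ht α).sub_const _) (fun F => ?_) ?_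
  · refine (((isBigO_sqrt_sub_one s).const_mul_left (F.baseVal (.dir α))).congr' ?_
      EventuallyEq.rfl).trans (isBigO_pow_of_le (by norm_num))
    filter_upwards [F.eventually_mem] with ε hε
    rw [F.dir_zero ε hε α]; ring
  · have hj := hasOrder_jets (d := d) (s := s)
    exact HasOrder.sum fun μ _ => (hj _).mul (((hasOrder_const fun _ => 1 / 2).mul (r' := 0)
      (HasOrder.sum fun β _ => HasOrder.sum fun γ _ => ((hj _).mul (hj _)).mul (hj _))).sub
      (HasOrder.sum fun β _ => (hj _).mul ((((hj _).mul hasOrder_nvel).mono (Nat.zero_le _)).add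
        (HasOrder.sum fun γ _ => (hj _).mul (hj _)))))

theorem hasOrder_dir_mul_sub (α β : Fin d) :
    HasOrder 1 fun (F : BoundaryFlow d s) z => F.jets (.dir α) z * F.jets (.dir β) z
      - F.baseVal (.dir α) * F.baseVal (.dir β) := by
  have h1 := ((hasOrder_dir_sub (s := s) α).mul (hasOrder_jets (.dir β))).add
    ((hasOrder_dir_sub (s := s) β).mul (hasOrder_const fun F => F.baseVal (.dir α)))
  intro F
  exact (h1 F).congr_left fun z => by ring

/-- The jets and directions entering the acceleration start at their base values up to O(ε²) and
have bounded derivatives, so over times O(ε) they move by O(ε). -/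
theorem hasOrder_acc_sub : HasOrder 1 fun (F : BoundaryFlow d s) z => F.acc z - F.K := by
  have h1 : HasOrder 1 fun (F : BoundaryFlow d s) z => ∑ α, ∑ β,
      ((F.jets (.jet 1 [] α β) z - F.baseVal (.jet 1 [] α β))
          * (F.jets (.dir α) z * F.jets (.dir β) z)
        + (F.jets (.dir α) z * F.jets (.dir β) z - F.baseVal (.dir α) * F.baseVal (.dir β))
          * F.baseVal (.jet 1 [] α β)) :=
    HasOrder.sum fun α _ => HasOrder.sum fun β _ => HasOrder.add
      ((hasOrder_jet_sub 1 [] α β).mul ((hasOrder_jets _).mul (hasOrder_jets _)))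
      ((hasOrder_dir_mul_sub α β).mul (hasOrder_const fun F => F.baseVal (.jet 1 [] α β)))
  have h2 := (hasOrder_const (d := d) (s := s) fun _ => 1 / 2).mul h1
  intro F
  refine (h2 F).congr_left fun z => ?_
  simp only [acc, K]
  rw [← mul_sub, ← Finset.sum_sub_distrib]
  congr 1
  refine Finset.sum_congr rfl fun α _ => ?_
  rw [← Finset.sum_sub_distrib]
  refine Finset.sum_congr rfl fun β _ => ?_
  ring

theorem hasOrder_nvel_sub :
    HasOrder 2 fun (F : BoundaryFlow d s) z => F.nvel z - (z.1 + F.K * z.2) := by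
  refine HasOrder.integrate (N := 1) (f' := fun F z => F.acc z - F.K)
    (fun F ε hε t ht => ?_) (fun F => ?_) hasOrder_acc_sub
  · have h1 : HasDerivAt (fun t => ε + F.K * t) F.K t := by
      simpa using ((hasDerivAt_id t).const_mul F.K).const_add ε
    exact (F.nvel_deriv ε hε t ht).sub h1.hasDerivWithinAt
  · refine isBigO_sub_congr ?_
    filter_upwards [F.eventually_mem] with ε hε
    rw [F.nvel_zero ε hε]; simp

/-- The leading part of the normal coordinate. -/
def parabola (F : BoundaryFlow d s) (z : ℝ × ℝ) : ℝ := z.1 * z.2 + F.K / 2 * z.2 ^ 2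

theorem hasOrder_parabola_pow (j : ℕ) :
    HasOrder (2 * j) fun (F : BoundaryFlow d s) z => F.parabola z ^ j := by
  have h1 : HasOrder 2 fun (F : BoundaryFlow d s) z => F.parabola z := by
    have h2 := (hasOrder_eps.mul hasOrder_time).add
      (((hasOrder_const fun F : BoundaryFlow d s => F.K / 2).mul
        (hasOrder_time.mul hasOrder_time)).mono (by norm_num))
    intro F
    exact (h2 F).congr_left fun z => by simp only [parabola]; ring
  intro F
  refine ((h1 F).pow j).congr_right fun z => by rw [pow_mul]

/-- The derivatives of normal order `m` enter the expansion of those of lower order through powers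
of the leading part of the normal coordinate. -/
theorem known_jet_sub_parabola (α β : Fin d) (j : ℕ) (hj : j < m) :
    Known m (2 * j + 1) fun (F : BoundaryFlow d s) z => F.jets (.jet (m - j) [] α β) z
      - F.baseVal (.jet m [] α β) / j.factorial * F.parabola z ^ j := by
  induction j with
  | zero =>
    refine HasOrder.known ?_
    simpa using hasOrder_jet_sub (s := s) m [] α β
  | succ j ih =>
    have ih := ih (by omega)
    have hk : m - (j + 1) + 1 = m - j := by omega
    obtain ⟨hn, hdir, -, hjet⟩ := known_flow (d := d) (s := s) (m := m) (by omega) (2 * m)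
    set c : BoundaryFlow d s → ℝ := fun F => F.baseVal (.jet m [] α β) / j.factorial with hc
    -- The derivative of parabola^(j+1)/(j+1)! is parabola^j/j! times ε + Kt. After subtraction
    -- three terms remain: the induction hypothesis times the normal velocity O(ε); the defect of
    -- the normal velocity from ε + Kt, of order ε², times O(ε^(2j)); and tangential derivatives of
    -- the same normal order, known to order 2j + 2 by `known_flow`.
    refine Known.integrate (N := 2 * j + 2) (f' := fun F z =>
        F.nvel z * (F.jets (.jet (m - j) [] α β) z - c F * F.parabola z ^ j)
        + c F * (F.parabola z ^ j * (F.nvel z - (z.1 + F.K * z.2)))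
        + ∑ γ, F.jets (.jet (m - (j + 1)) [γ] α β) z * F.jets (.dir γ) z)
      (fun F ε hε t ht => ?_) ?_ ?_
    · have h1 := F.jet_deriv ε hε t ht (m - (j + 1)) [] α β
      rw [hk] at h1
      have h2 : HasDerivAt (fun r => F.parabola (ε, r)) (ε + F.K * t) t := by
        have := ((hasDerivAt_id t).const_mul ε).add ((hasDerivAt_pow 2 t).const_mul (F.K / 2))
        refine this.congr_deriv ?_
        simp
        ring
      have h3 := (h2.fun_pow (j + 1)).const_mul (F.baseVal (.jet m [] α β) / (j + 1).factorial)
      refine (h1.sub h3.hasDerivWithinAt).congr_deriv ?_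
      have h4 : ((j + 1).factorial : ℝ) = (j + 1) * j.factorial := by
        rw [Nat.factorial_succ]; push_cast; ring
      have h5 : (j.factorial : ℝ) ≠ 0 := by positivity
      have h6 : (j : ℝ) + 1 ≠ 0 := by positivity
      rw [h4, hc]
      simp only [Nat.add_sub_cancel]
      push_cast
      field_simp
      ring
    · obtain ⟨q, hq⟩ := exists_init_jet (d := d) (s := s) (m := m) (2 * j + 2)
        (k := m - (j + 1)) (by omega) [] α β
      refine ⟨q, fun F => (hq F).congr_left fun ε => ?_⟩
      simp [parabola]
    · refine Known.add (Known.add ?_ ?_) (Known.sum fun γ _ => ?_)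
      · refine hn.mul_of_order ih hasOrder_nvel ?_ (by omega) (r' := 0) (by omega) (by omega)
        exact (hasOrder_jets _).sub ((hasOrder_const c).mul
          ((hasOrder_parabola_pow j).mono (Nat.zero_le _)))
      · refine HasOrder.known ?_
        exact ((hasOrder_const c).mul ((hasOrder_parabola_pow j).mul hasOrder_nvel_sub)).mono
          (by omega)
      · exact ((hjet _ _ _ _).mono (by omega)).mul ((hdir γ).mono (by omega)) (hasOrder_jets _)
          (hasOrder_jets _)

/-- The value of the normal derivative of order `m` of the metric on the given direction. -/
def topJet (m : ℕ) (F : BoundaryFlow d s) : ℝ :=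
  ∑ α, ∑ β, F.baseVal (.jet m [] α β) * (F.baseVal (.dir α) * F.baseVal (.dir β))

/-- Normal order one lies `m - 1` steps below `m`, so `known_jet_sub_parabola` applies with `j = m -
1`. In the leading term the velocities may be frozen at their base values, at the cost of one
further order in ε. This is one order better than `known_flow` and is where the unknown jet becomes
visible. -/
theorem known_acc_sub (hm : 2 ≤ m) :
    Known m (2 * m - 1) fun (F : BoundaryFlow d s) z => F.acc z
      - F.topJet m / 2 / (m - 1).factorial * F.parabola z ^ (m - 1) := by
  obtain ⟨-, hdir, -, -⟩ := known_flow (d := d) (s := s) (m := m) (by omega) (2 * m)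
  have h1 : Known m (2 * m - 1) fun (F : BoundaryFlow d s) z => 1 / 2 * ∑ α, ∑ β,
      ((F.jets (.jet 1 [] α β) z
          - F.baseVal (.jet m [] α β) / (m - 1).factorial * F.parabola z ^ (m - 1))
          * (F.jets (.dir α) z * F.jets (.dir β) z)
        + F.baseVal (.jet m [] α β) / (m - 1).factorial * (F.parabola z ^ (m - 1)
          * (F.jets (.dir α) z * F.jets (.dir β) z - F.baseVal (.dir α) * F.baseVal (.dir β)))) := by
    have o1 : ∀ α β : Fin d, HasOrder 0 fun (F : BoundaryFlow d s) z =>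
        F.jets (.dir α) z * F.jets (.dir β) z := fun α β => (hasOrder_jets _).mul (hasOrder_jets _)
    have o2 : ∀ α β : Fin d, HasOrder 0 fun (F : BoundaryFlow d s) z =>
        F.jets (.jet 1 [] α β) z
          - F.baseVal (.jet m [] α β) / (m - 1).factorial * F.parabola z ^ (m - 1) := fun α β =>
      (hasOrder_jets _).sub ((hasOrder_const fun F => F.baseVal (.jet m [] α β)
        / (m - 1).factorial).mul ((hasOrder_parabola_pow (m - 1)).mono (Nat.zero_le _)))
    have o3 : ∀ α β : Fin d, HasOrder (2 * m - 1) fun (F : BoundaryFlow d s) z =>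
        F.baseVal (.jet m [] α β) / (m - 1).factorial * (F.parabola z ^ (m - 1)
          * (F.jets (.dir α) z * F.jets (.dir β) z - F.baseVal (.dir α) * F.baseVal (.dir β))) :=
      fun α β => ((hasOrder_const fun F => F.baseVal (.jet m [] α β) / (m - 1).factorial).mul
        ((hasOrder_parabola_pow (m - 1)).mul (hasOrder_dir_mul_sub α β))).mono (by omega)
    have k1 : Known m (2 * m - 1) fun (_ : BoundaryFlow d s) _ => (1 / 2 : ℝ) := by
      simpa using known_rat (d := d) (s := s) (m := m) (2 * m - 1) (1 / 2)
    refine k1.mul (Known.sum fun α _ => Known.sum fun β _ => Known.add ?_ (o3 α β).known)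
      (hasOrder_const _) (HasOrder.sum fun α _ => HasOrder.sum fun β _ =>
        ((o2 α β).mul (o1 α β)).add ((o3 α β).mono (Nat.zero_le _)))
    have := known_jet_sub_parabola (s := s) (m := m) α β (m - 1) (by omega)
    rw [show m - (m - 1) = 1 by omega] at this
    exact (this.mono (by omega)).mul (((hdir α).mono (by omega)).mul ((hdir β).mono (by omega))
      (hasOrder_jets _) (hasOrder_jets _)) (o2 α β) (o1 α β)
  convert! h1 using 3 with F z
  have h2 : F.topJet m / 2 / (m - 1).factorial * F.parabola z ^ (m - 1) = 1 / 2 * ∑ α, ∑ β,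
      F.baseVal (.jet m [] α β) / (m - 1).factorial * F.parabola z ^ (m - 1)
        * (F.baseVal (.dir α) * F.baseVal (.dir β)) := by
    simp only [topJet, Finset.mul_sum, Finset.sum_mul, Finset.sum_div]
    refine Finset.sum_congr rfl fun α _ => Finset.sum_congr rfl fun β _ => ?_
    ring
  rw [h2, acc, ← mul_sub, ← Finset.sum_sub_distrib]
  congr 1
  refine Finset.sum_congr rfl fun α _ => ?_
  rw [← Finset.sum_sub_distrib]
  refine Finset.sum_congr rfl fun β _ => ?_
  ring

end BoundaryFlow
end

/-! ### The equation for the exit time and its iterative solution -/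

noncomputable section

namespace BoundaryFlow

variable {d : ℕ} {s : ℚ} {m : ℕ}

theorem tendsto_exit (F : BoundaryFlow d s) :
    Tendsto (fun ε => (ε, F.τ ε)) (𝓝[>] 0) (shortTimes F.τ) := by
  refine fun P hP => mem_map.2 ?_
  filter_upwards [eventually_shortTimes.1 hP, F.eventually_mem] with ε h hε
  exact h _ ⟨(F.τ_pos ε hε).le, le_rfl⟩

theorem tendsto_start (F : BoundaryFlow d s) :
    Tendsto (fun ε => (ε, (0 : ℝ))) (𝓝[>] 0) (shortTimes F.τ) := by
  refine fun P hP => mem_map.2 ?_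
  filter_upwards [eventually_shortTimes.1 hP, F.eventually_mem] with ε h hε
  exact h _ ⟨le_rfl, (F.τ_pos ε hε).le⟩

/-- With acceleration bounded by C the height differs from εt by at most Cτ² on [0, τ]. At the exit
the height is 0, so ετ ≤ Cτ². This lower bound on τ is what permits division by it. -/
theorem isBigO_eps_τ (F : BoundaryFlow d s) : (fun ε : ℝ => ε) =O[𝓝[>] 0] F.τ := by
  obtain ⟨C, hC, h⟩ := isBigO_shortTimes_iff.1 (hasOrder_acc F)
  refine IsBigO.of_bound C ?_
  filter_upwards [h, F.eventually_mem] with ε h hε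
  have hτ := F.τ_pos ε hε
  have h1 : ∀ t ∈ Icc 0 (F.τ ε), ‖F.nvel (ε, t) - ε‖ ≤ C * F.τ ε := by
    intro t ht
    have := (convex_Icc (0 : ℝ) (F.τ ε)).norm_image_sub_le_of_norm_hasDerivWithin_le
      (fun r hr => F.nvel_deriv ε hε r hr) (C := C)
      (fun r hr => by simpa [acc] using h r hr) ⟨le_rfl, hτ.le⟩ ht
    rw [F.nvel_zero ε hε] at this
    refine this.trans ?_
    rw [sub_zero, Real.norm_of_nonneg ht.1]
    exact mul_le_mul_of_nonneg_left ht.2 hC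
  have h2 := (convex_Icc (0 : ℝ) (F.τ ε)).norm_image_sub_le_of_norm_hasDerivWithin_le
    (f := fun t => F.pos (ε, t) - ε * t) (f' := fun t => F.nvel (ε, t) - ε * 1)
    (fun r hr => (F.pos_deriv ε hε r hr).sub
      (((hasDerivAt_id r).const_mul ε).hasDerivWithinAt)) (C := C * F.τ ε)
    (fun r hr => by simpa using h1 r hr) ⟨le_rfl, hτ.le⟩ ⟨hτ.le, le_rfl⟩
  simp only [F.pos_τ ε hε, F.pos_zero ε hε, mul_zero, sub_zero, zero_sub, norm_neg, norm_mul] at h2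
  rw [Real.norm_of_nonneg hτ.le] at h2 ⊢
  exact le_of_mul_le_mul_right h2 hτ

/-- The equation for the exit time. -/
theorem exists_exit_equation (hm : 2 ≤ m) : ∃ B : Polynomial (Polynomial (JetPoly d m)),
    ∀ F : BoundaryFlow d s,
      (fun ε => ε + F.τ ε * (F.evalT (ε, F.τ ε) B + F.topJet m / 2 / (m - 1).factorial
        * parabolaInt (m - 1) (F.K / 2) ε (F.τ ε))) =O[𝓝[>] 0] (fun ε : ℝ => ε ^ (2 * m)) ∧
      (fun ε => F.evalT (ε, 0) B - F.K / 2) =O[𝓝[>] 0] fun ε : ℝ => ε ^ 1 := by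
  obtain ⟨p, hp⟩ := known_acc_sub (d := d) (s := s) hm
  obtain ⟨P, B, hPB⟩ := exists_antideriv (d := d) (s := s) p
  refine ⟨B, fun F => ⟨?_, ?_⟩⟩
  · set c := F.topJet m / 2 / (m - 1).factorial with hc
    choose I hI0 hI1 hI2 using exists_antideriv_parabola (m - 1) (F.K / 2)
    -- Two integrations of the acceleration raise the precision from 2m - 1 to 2m for the normal
    -- velocity and to 2m + 1 for the height.
    have h1 : (fun z : ℝ × ℝ => F.nvel z - (z.1 + F.evalT z P + c * I z.1 z.2))
        =O[shortTimes F.τ] fun z => z.1 ^ (2 * m - 1 + 1) := by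
      refine isBigO_of_hasDerivWithinAt F.τ_bound ?_ ?_ (hp F)
      · filter_upwards [F.eventually_mem] with ε hε t ht
        refine ((F.nvel_deriv ε hε t ht).sub (((((hPB F ε).1 t).const_add ε).add
          ((hI1 ε t).const_mul c)).hasDerivWithinAt)).congr_deriv ?_
        simp only [acc, parabola]
        ring
      · refine isBigO_sub_congr ?_
        filter_upwards [F.eventually_mem] with ε hε
        rw [F.nvel_zero ε hε, (hPB F ε).2.1, hI0]; ring
    have h2 : (fun z : ℝ × ℝ => F.pos z - (z.1 * z.2 + z.2 ^ 2 * F.evalT z B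
          + c * (z.2 ^ 2 * parabolaInt (m - 1) (F.K / 2) z.1 z.2)))
        =O[shortTimes F.τ] fun z => z.1 ^ (2 * m - 1 + 1 + 1) := by
      refine isBigO_of_hasDerivWithinAt F.τ_bound ?_ ?_ h1
      · filter_upwards [F.eventually_mem] with ε hε t ht
        refine ((F.pos_deriv ε hε t ht).sub (((((hasDerivAt_id t).const_mul ε).add
          ((hPB F ε).2.2.1 t)).add ((hI2 ε t).const_mul c)).hasDerivWithinAt)).congr_deriv ?_
        ring
      · refine isBigO_sub_congr ?_
        filter_upwards [F.eventually_mem] with ε hε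
        rw [F.pos_zero ε hε]; ring
    -- The height vanishes at the exit. One factor τ is divided out, and ε = O(τ) turns the error
    -- O(ε^(2m+1))/τ into O(ε^(2m)).
    obtain ⟨C, hC⟩ := (h2.comp_tendsto F.tendsto_exit).bound
    obtain ⟨D, hD0, hD⟩ := (F.isBigO_eps_τ).exists_nonneg
    have key : ∀ᶠ ε in 𝓝[>] (0 : ℝ), ‖ε + F.τ ε * (F.evalT (ε, F.τ ε) B + c
        * parabolaInt (m - 1) (F.K / 2) ε (F.τ ε))‖ ≤ |C| * D * ‖ε ^ (2 * m)‖ := by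
      filter_upwards [hC, hD.bound, F.eventually_mem] with ε hC hD hε
      have hτ := F.τ_pos ε hε
      have e : 2 * m - 1 + 1 + 1 = 2 * m + 1 := by omega
      simp only [Function.comp_apply, F.pos_τ ε hε, e] at hC
      have e2 : 0 - (ε * F.τ ε + F.τ ε ^ 2 * F.evalT (ε, F.τ ε) B + c * (F.τ ε ^ 2
          * parabolaInt (m - 1) (F.K / 2) ε (F.τ ε))) = -((ε + F.τ ε * (F.evalT (ε, F.τ ε) B + c
          * parabolaInt (m - 1) (F.K / 2) ε (F.τ ε))) * F.τ ε) := by ring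
      rw [e2, norm_neg, norm_mul, pow_succ, norm_mul] at hC
      refine le_of_mul_le_mul_right (hC.trans ?_) (norm_pos_iff.2 hτ.ne')
      calc C * (‖ε ^ (2 * m)‖ * ‖ε‖) ≤ |C| * (‖ε ^ (2 * m)‖ * (D * ‖F.τ ε‖)) := by
            gcongr
            exact le_abs_self C
        _ = _ := by ring
    exact IsBigO.of_bound _ key
  · have h1 := ((hp F).comp_tendsto F.tendsto_start).trans
      (isBigO_pow_of_le (show 1 ≤ 2 * m - 1 by omega))
    have h2 := (hasOrder_acc_sub F).comp_tendsto F.tendsto_start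
    refine ((h2.sub h1).const_mul_left (1 / 2)).congr_left fun ε => ?_
    have h3 := (hPB F ε).2.2.2
    -- The exponent is positive because `2 ≤ m`; hence the correction is absent at time 0 and B(ε,
    -- 0) is half the initial acceleration, up to the allowed error.
    have h4 : F.parabola (ε, 0) ^ (m - 1) = 0 := by
      rw [parabola]
      simp
      omega
    simp only [Function.comp_apply, h4, ← h3]
    ring

theorem isBigO_evalE (F : BoundaryFlow d s) (a : Polynomial (JetPoly d m)) :
    (fun ε => F.evalE ε a) =O[𝓝[>] 0] fun _ => (1 : ℝ) := by
  simpa [Function.comp_def] using (hasOrder_evalE a F).comp_tendsto F.tendsto_start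

theorem isBigO_pow_sub_pow {a b c : ℝ → ℝ} (ha : a =O[𝓝[>] 0] fun ε : ℝ => ε)
    (hb : b =O[𝓝[>] 0] fun ε : ℝ => ε) (hab : (fun ε => a ε - b ε) =O[𝓝[>] 0] c) (n : ℕ) :
    (fun ε => a ε ^ (n + 1) - b ε ^ (n + 1)) =O[𝓝[>] 0] fun ε => ε ^ n * c ε := by
  induction n with
  | zero => simpa using hab
  | succ n ih =>
    have h1 := ((ih.mul ha).congr_right (g₂ := fun ε => ε ^ (n + 1) * c ε)
      fun ε => by ring).add ((hb.pow (n + 1)).mul hab)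
    exact h1.congr_left fun ε => by ring

/-- A polynomial with bounded coefficients is Lipschitz on bounded arguments, so substituting an
approximation of the exit time preserves its error. -/
theorem isBigO_evalT_sub (F : BoundaryFlow d s) {a b c : ℝ → ℝ}
    (ha : a =O[𝓝[>] 0] fun ε : ℝ => ε) (hb : b =O[𝓝[>] 0] fun ε : ℝ => ε)
    (hab : (fun ε => a ε - b ε) =O[𝓝[>] 0] c) (p : Polynomial (Polynomial (JetPoly d m))) :
    (fun ε => F.evalT (ε, a ε) p - F.evalT (ε, b ε) p) =O[𝓝[>] 0] c := by
  induction p using Polynomial.induction_on' with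
  | add p q hp hq =>
    refine (hp.add hq).congr_left fun ε => ?_
    simp only [map_add]; ring
  | monomial n q =>
    simp only [← Polynomial.C_mul_X_pow_eq_monomial, map_mul, map_pow, evalT_C, evalT_X,
      ← mul_sub]
    cases n with
    | zero => simpa using isBigO_zero _ _
    | succ n =>
      have h1 := (F.isBigO_evalE q).mul (isBigO_pow_sub_pow ha hb hab n)
      refine h1.trans ?_
      have h2 := (isBigO_pow_of_le (Nat.zero_le n)).mul (isBigO_refl c (𝓝[>] (0 : ℝ)))
      simpa using h2

theorem isBigO_parabolaInt {a : ℝ → ℝ} (ha : a =O[𝓝[>] 0] fun ε : ℝ => ε) (n : ℕ) (κ : ℝ) :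
    (fun ε => parabolaInt n κ ε (a ε)) =O[𝓝[>] 0] fun ε : ℝ => ε ^ (2 * n) := by
  unfold parabolaInt
  refine IsBigO.fun_sum fun x hx => IsBigO.const_mul_left ?_ _
  have hx' := Finset.HasAntidiagonal.mem_antidiagonal.1 hx
  simp only [div_eq_mul_inv]
  have h1 := (((isBigO_refl (fun ε : ℝ => ε ^ x.2) (𝓝[>] 0)).mul (ha.pow (n + x.1))).const_mul_left
    (κ ^ x.1 * (((n + x.1 + 1 : ℕ) : ℝ) * ((n + x.1 + 2 : ℕ) : ℝ))⁻¹))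
  refine (h1.congr_left fun ε => by ring).congr_right fun ε => ?_
  rw [← pow_add]
  congr 1
  omega

theorem isBigO_parabolaInt_sub {a b : ℝ → ℝ} (ha : a =O[𝓝[>] 0] fun ε : ℝ => ε)
    (hb : b =O[𝓝[>] 0] fun ε : ℝ => ε)
    (hab : (fun ε => a ε - b ε) =O[𝓝[>] 0] fun ε : ℝ => ε ^ 2) {n : ℕ} (hn : 0 < n) (κ : ℝ) :
    (fun ε => parabolaInt n κ ε (a ε) - parabolaInt n κ ε (b ε))
      =O[𝓝[>] 0] fun ε : ℝ => ε ^ (2 * n + 1) := by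
  simp only [parabolaInt, ← Finset.sum_sub_distrib]
  refine IsBigO.fun_sum fun x hx => ?_
  have hx' := Finset.HasAntidiagonal.mem_antidiagonal.1 hx
  obtain ⟨j, hj⟩ : ∃ j, n + x.1 = j + 1 := ⟨n + x.1 - 1, by omega⟩
  have h1 := (((isBigO_refl (fun ε : ℝ => ε ^ x.2) (𝓝[>] 0)).mul
    (isBigO_pow_sub_pow ha hb hab j)).const_mul_left (n.choose x.1 *
    (κ ^ x.1 * (((n + x.1 + 1 : ℕ) : ℝ) * ((n + x.1 + 2 : ℕ) : ℝ))⁻¹)))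
  refine (h1.congr_left fun ε => ?_).congr_right fun ε => ?_
  · rw [← hj]
    simp only [div_eq_mul_inv]
    ring
  · rw [← pow_add, ← pow_add]
    congr 1
    omega

theorem isBigO_evalT_exit_sub (F : BoundaryFlow d s)
    {B : Polynomial (Polynomial (JetPoly d m))}
    (hB : (fun ε => F.evalT (ε, 0) B - F.K / 2) =O[𝓝[>] 0] fun ε : ℝ => ε ^ 1) :
    (fun ε => F.evalT (ε, F.τ ε) B - F.K / 2) =O[𝓝[>] 0] fun ε : ℝ => ε := by
  have h1 := F.isBigO_evalT_sub (b := fun _ => 0) F.τ_bound (isBigO_zero _ _)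
    (by simpa using F.τ_bound) B
  simp only [pow_one] at hB
  exact (h1.add hB).congr_left fun ε => by ring

/-- The exit time to first order. -/
theorem isBigO_τ_sub (F : BoundaryFlow d s) :
    (fun ε => F.τ ε - -2 / F.K * ε) =O[𝓝[>] 0] fun ε : ℝ => ε ^ 2 := by
  -- The case `m = 2` suffices: every correction to ε + (K/2)τ = 0 is already O(ε²).
  obtain ⟨B, hB⟩ := exists_exit_equation (d := d) (s := s) (m := 2) le_rfl
  obtain ⟨h1, h2⟩ := hB F
  have h3 := F.isBigO_evalT_exit_sub h2
  have h4 := (F.τ_bound.mul h3).congr_right (g₂ := fun ε : ℝ => ε ^ 2) fun ε => by ring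
  have h5 := ((F.τ_bound.mul (isBigO_parabolaInt F.τ_bound (2 - 1) (F.K / 2))).congr_right
    (g₂ := fun ε : ℝ => ε ^ 3) fun ε => by ring).trans (isBigO_pow_of_le (show 2 ≤ 3 by norm_num))
  have h6 := h1.trans (isBigO_pow_of_le (show 2 ≤ 2 * 2 by norm_num))
  have h7 := (((h6.sub h4).sub (h5.const_mul_left (F.topJet 2 / 2 / (2 - 1).factorial)))
    |>.const_mul_left (2 / F.K))
  refine h7.congr_left fun ε => ?_
  have hK := F.K_neg.ne
  field_simp
  ring

/-- The exit time to higher order. -/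
theorem exists_τ_expansion (hm : 2 ≤ m) : ∃ T : Polynomial (JetPoly d m),
    ∀ F : BoundaryFlow d s,
      (fun ε => F.τ ε - (F.evalE ε T + 1 / 2 * (-2 / F.K) ^ (m + 1)
        * ((m.factorial : ℝ) / (2 * m).factorial) * F.topJet m * ε ^ (2 * m - 1)))
        =O[𝓝[>] 0] fun ε : ℝ => ε ^ (2 * m) := by
  obtain ⟨B, hB⟩ := exists_exit_equation (d := d) (s := s) hm
  obtain ⟨n, rfl⟩ : ∃ n, m = n + 1 := ⟨m - 1, by omega⟩
  let X (i : JetVar d) (hi : i.normalOrder < n + 1) : JetPoly d (n + 1) := MvPolynomial.X ⟨i, hi⟩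
  let Kp : JetPoly d (n + 1) := MvPolynomial.C (1 / 2) * ∑ α, ∑ β,
    X (.jet 1 [] α β) (by simp [JetVar.normalOrder]; omega) *
      (X (.dir α) (Nat.succ_pos n) * X (.dir β) (Nat.succ_pos n))
  have hKp : ∀ F : BoundaryFlow d s, MvPolynomial.aeval (fun i => F.baseVal i.1) Kp = F.K := by
    intro F
    simp [Kp, X, K]
  let r : JetPoly d (n + 1) := X .recip (by simp [JetVar.normalOrder]; omega)
  have hr : ∀ F : BoundaryFlow d s, MvPolynomial.aeval (fun i => F.baseVal i.1) r = F.K⁻¹ := by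
    intro F
    simp [r, X, K, F.recip_eq]
  -- The exit equation solved for its linear term: τ = -2/K (ε + τ(B(ε, τ) - K/2) + …). Since B -
  -- K/2 = O(ε), each application improves an approximation by one order. The indeterminate `recip`
  -- supplies K⁻¹, so the coefficients stay polynomial.
  let next (T : Polynomial (JetPoly d (n + 1))) : Polynomial (JetPoly d (n + 1)) :=
    Polynomial.C (MvPolynomial.C (-2) * r) * (Polynomial.X + T * (B.eval T
      + Polynomial.C (MvPolynomial.C (-1 / 2) * Kp)))
  have hnext : ∀ (F : BoundaryFlow d s) ε T, F.evalE ε (next T) = -2 * F.K⁻¹ * (ε + F.evalE ε T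
      * (F.evalT (ε, F.evalE ε T) B + -1 / 2 * F.K)) := by
    intro F ε T
    simp only [next, map_mul, map_add, evalE_C, evalE_X, evalT_eval, hr, hKp,
      MvPolynomial.aeval_C, eq_ratCast]
    norm_num
  simp only [Nat.add_sub_cancel] at hB
  have step : ∀ {N : ℕ} (T : Polynomial (JetPoly d (n + 1))) (F : BoundaryFlow d s), 1 ≤ N →
      N ≤ 2 * n + 1 →
      (fun ε => F.τ ε - F.evalE ε T) =O[𝓝[>] 0] (fun ε : ℝ => ε ^ N) →
      (fun ε => F.τ ε - (F.evalE ε (next T) + -2 / F.K * (F.topJet (n + 1) / 2 / n.factorial)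
        * (F.τ ε * parabolaInt n (F.K / 2) ε (F.τ ε)))) =O[𝓝[>] 0] fun ε : ℝ => ε ^ (N + 1) := by
    intro N T F hN hN' hT
    obtain ⟨h1, h2⟩ := hB F
    have h3 := F.isBigO_evalT_exit_sub h2
    have hT1 : (fun ε => F.evalE ε T) =O[𝓝[>] 0] fun ε : ℝ => ε := by
      have := F.τ_bound.sub ((hT.trans (isBigO_pow_of_le hN)).congr_right fun ε => pow_one ε)
      exact this.congr_left fun ε => by ring
    have h4 := (hT.mul h3).congr_right fun ε => (pow_succ ε N).symm
    have h5 := (hT1.mul (F.isBigO_evalT_sub F.τ_bound hT1 hT B)).congr_right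
      fun ε => (pow_succ' ε N).symm
    have h6 := h1.trans (isBigO_pow_of_le (show N + 1 ≤ 2 * (n + 1) by omega))
    have h7 := ((h6.sub h4).sub h5).const_mul_left (2 / F.K)
    refine h7.congr_left fun ε => ?_
    rw [hnext]
    have hK := F.K_neg.ne
    field_simp
    ring
  have hS : ∀ F : BoundaryFlow d s, (fun ε => F.τ ε * parabolaInt n (F.K / 2) ε (F.τ ε))
      =O[𝓝[>] 0] fun ε : ℝ => ε ^ (2 * n + 1) := fun F =>
    (F.τ_bound.mul (isBigO_parabolaInt F.τ_bound n (F.K / 2))).congr_right fun ε => by ring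
  -- Up to error O(ε^(2n+1)) the term with the jet of order m = n + 1 disappears in the remainder,
  -- so the iteration uses lower jets only.
  have boot : ∀ N ≤ 2 * n, ∃ T : Polynomial (JetPoly d (n + 1)), ∀ F : BoundaryFlow d s,
      (fun ε => F.τ ε - F.evalE ε T) =O[𝓝[>] 0] fun ε : ℝ => ε ^ (N + 1) := by
    intro N
    induction N with
    | zero => exact fun _ => ⟨0, fun F => by simpa using F.τ_bound⟩
    | succ N ih =>
      intro hN
      obtain ⟨T, hT⟩ := ih (by omega)
      refine ⟨next T, fun F => ?_⟩
      have h1 := step T F (by omega) (by omega) (hT F)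
      have h2 := ((hS F).const_mul_left (-2 / F.K * (F.topJet (n + 1) / 2 / n.factorial))).trans
        (isBigO_pow_of_le (show N + 1 + 1 ≤ 2 * n + 1 by omega))
      exact (h1.add h2).congr_left fun ε => by ring
  obtain ⟨T, hT⟩ := boot (2 * n) le_rfl
  -- One last iteration reaches error O(ε^(2m)). Now the top term counts; in it τ may be replaced by
  -- -2ε/K, since the difference O(ε²) changes it by O(ε^(2m)) only, and `parabolaInt_vertex`
  -- evaluates the result.
  refine ⟨next T, fun F => ?_⟩
  have h1 := step T F (by omega) (by omega) (hT F)
  have hlin : (fun ε => -2 / F.K * ε) =O[𝓝[>] 0] fun ε : ℝ => ε :=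
    (isBigO_refl _ _).const_mul_left _
  have h2 := (F.τ_bound.mul (isBigO_parabolaInt_sub F.τ_bound hlin F.isBigO_τ_sub
    (show 0 < n by omega) (F.K / 2))).congr_right (g₂ := fun ε : ℝ => ε ^ (2 * n + 1 + 1))
    fun ε => by ring
  have h3 := (F.isBigO_τ_sub.mul (isBigO_parabolaInt hlin n (F.K / 2))).congr_right
    (g₂ := fun ε : ℝ => ε ^ (2 * n + 1 + 1)) fun ε => by ring
  have hK := F.K_neg.ne
  have h4 := (h2.add h3).const_mul_left (-2 / F.K * (F.topJet (n + 1) / 2 / n.factorial))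
  have e : 2 * (n + 1) = 2 * n + 1 + 1 := by ring
  have e' : 2 * (n + 1) - 1 = 2 * n + 1 := by omega
  rw [e, show 2 * n + 1 + 1 - 1 = 2 * n + 1 by omega]
  refine (h1.add h4).congr_left fun ε => ?_
  have h5 := parabolaInt_vertex n (κ := F.K / 2) (r := -2 / F.K) (by field_simp) ε
  have h6 : (n.factorial : ℝ) ≠ 0 := by positivity
  rw [h5, show 2 * n + 2 = 2 * n + 1 + 1 by ring]
  generalize parabolaInt n (F.K / 2) ε (F.τ ε) = S
  have h7 : ((2 * n + 1 + 1).factorial : ℝ) ≠ 0 := by positivity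
  generalize ((2 * n + 1 + 1).factorial : ℝ) = f at h7
  generalize -2 / F.K = lam
  field_simp
  ring

end BoundaryFlow
end

/-! ### Universal coefficients of the full expansion -/

noncomputable section

theorem Polynomial.isBigO_eval_sub_sum (p : Polynomial ℝ) (n : ℕ) :
    (fun ε => p.eval ε - ∑ k ∈ Finset.range n, p.coeff k * ε ^ k)
      =O[𝓝[>] 0] fun ε : ℝ => ε ^ n := by
  have h : ∀ ε, p.eval ε - ∑ k ∈ Finset.range n, p.coeff k * ε ^ k
      = ∑ k ∈ Finset.Ico n (n + p.natDegree + 1), p.coeff k * ε ^ k := by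
    intro ε
    rw [Polynomial.eval_eq_sum_range' (n := n + p.natDegree + 1) (by omega),
      Finset.sum_Ico_eq_sub _ (by omega)]
  simp only [h]
  refine IsBigO.fun_sum fun k hk => IsBigO.const_mul_left ?_ _
  exact isBigO_pow_of_le (Finset.mem_Ico.1 hk).1

namespace BoundaryFlow

variable {d : ℕ} {s : ℚ} {m : ℕ}

/-- Each m gives an expansion valid to order 2m whose polynomial part is chosen before the flow. By
uniqueness of coefficients the truncations for different m are compatible and glue to one asymptotic
series; the coefficient of order 2m - 1 is read from the m-th truncation. -/
theorem exists_coefficients (d : ℕ) (s : ℚ) : ∃ P : ℕ → MvPolynomial (JetVar d) ℚ,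
    (∀ m, ∀ i ∈ (P m).vars, i.normalOrder < m) ∧
    ∀ F : BoundaryFlow d s, ∃ a : ℕ → ℝ,
      (∀ N : ℕ, (fun ε => F.τ ε - ∑ k ∈ Finset.range (N + 1), a k * ε ^ k)
        =O[𝓝[>] 0] fun ε => ε ^ (N + 1)) ∧
      a 0 = 0 ∧ a 1 = -2 / F.K ∧
      ∀ m, 2 ≤ m → a (2 * m - 1) = 1 / 2 * (-2 / F.K) ^ (m + 1)
        * ((m.factorial : ℝ) / ((2 * m).factorial : ℝ)) * F.topJet m
          + MvPolynomial.aeval F.baseVal (P m) := by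
  have hT : ∀ m, ∃ T : Polynomial (JetPoly d m), 2 ≤ m → ∀ F : BoundaryFlow d s,
      (fun ε => F.τ ε - (F.evalE ε T + 1 / 2 * (-2 / F.K) ^ (m + 1)
        * ((m.factorial : ℝ) / (2 * m).factorial) * F.topJet m * ε ^ (2 * m - 1)))
        =O[𝓝[>] 0] fun ε : ℝ => ε ^ (2 * m) := by
    intro m
    by_cases hm : 2 ≤ m
    · obtain ⟨T, h⟩ := exists_τ_expansion (d := d) (s := s) hm
      exact ⟨T, fun _ => h⟩
    · exact ⟨0, fun h => absurd h hm⟩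
  choose T hT using hT
  -- The coefficient lives in a ring whose indeterminates have normal order below `m`; after
  -- renaming, this survives as the condition on the variables.
  refine ⟨fun m => MvPolynomial.rename Subtype.val ((T m).coeff (2 * m - 1)), fun m i hi => ?_,
    fun F => ?_⟩
  · classical
    obtain ⟨j, -, rfl⟩ := Finset.mem_image.1 (MvPolynomial.vars_rename _ _ hi)
    exact j.2
  · let lead (m : ℕ) : ℝ := 1 / 2 * (-2 / F.K) ^ (m + 1)
        * ((m.factorial : ℝ) / (2 * m).factorial) * F.topJet m
    let p (m : ℕ) : Polynomial ℝ := (T m).map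
      ((MvPolynomial.aeval fun i : {i : JetVar d // i.normalOrder < m} => F.baseVal i).toRingHom)
        + Polynomial.C (lead m) * Polynomial.X ^ (2 * m - 1)
    have hp : ∀ m, 2 ≤ m → (fun ε => F.τ ε - (p m).eval ε) =O[𝓝[>] 0]
        fun ε : ℝ => ε ^ (2 * m) := by
      intro m hm
      refine (hT m hm F).congr_left fun ε => ?_
      simp [p, lead, evalE, Polynomial.eval_map]
    have hcoeff : ∀ m m' k, 2 ≤ m → 2 ≤ m' → k < 2 * m → k < 2 * m' →
        (p m).coeff k = (p m').coeff k := by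
      intro m m' k hm hm' hk hk'
      have h1 := ((hp m' hm').trans (isBigO_pow_of_le (show k + 1 ≤ 2 * m' by omega))).sub
        ((hp m hm).trans (isBigO_pow_of_le (show k + 1 ≤ 2 * m by omega)))
      have h2 := Polynomial.coeff_eq_zero_of_isBigO (p := p m - p m') (n := k + 1)
        (h1.congr_left fun ε => by simp) k (Nat.lt_succ_self k)
      rw [Polynomial.coeff_sub] at h2
      linarith
    have hsum : ∀ N : ℕ, (fun ε => F.τ ε - ∑ k ∈ Finset.range (N + 1),
        (p (k + 2)).coeff k * ε ^ k) =O[𝓝[>] 0] fun ε => ε ^ (N + 1) := by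
      intro N
      have h1 := (hp (N + 2) (by omega)).trans
        (isBigO_pow_of_le (show N + 1 ≤ 2 * (N + 2) by omega))
      have h2 := Polynomial.isBigO_eval_sub_sum (p (N + 2)) (N + 1)
      refine (h1.add h2).congr_left fun ε => ?_
      have h3 : ∑ k ∈ Finset.range (N + 1), (p (k + 2)).coeff k * ε ^ k
          = ∑ k ∈ Finset.range (N + 1), (p (N + 2)).coeff k * ε ^ k := by
        refine Finset.sum_congr rfl fun k hk => ?_
        have := Finset.mem_range.1 hk
        rw [hcoeff (k + 2) (N + 2) k (by omega) (by omega) (by omega) (by omega)]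
      rw [h3]; ring
    have h01 : ∀ k < 2, (p (k + 2)).coeff k = (Polynomial.C (-2 / F.K) * Polynomial.X).coeff k := by
      intro k hk
      have h1 := (F.isBigO_τ_sub).sub ((hp (k + 2) (by omega)).trans
        (isBigO_pow_of_le (show 2 ≤ 2 * (k + 2) by omega)))
      have h2 := Polynomial.coeff_eq_zero_of_isBigO
        (p := p (k + 2) - Polynomial.C (-2 / F.K) * Polynomial.X) (n := 2)
        (h1.congr_left fun ε => by simp) k hk
      rw [Polynomial.coeff_sub] at h2
      linarith
    -- The index `k + 2` is at least 2 and `p (k + 2)` is accurate beyond order k, so this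
    -- coefficient has stabilized.
    refine ⟨fun k => (p (k + 2)).coeff k, hsum, ?_, ?_, fun m hm => ?_⟩
    · simpa using h01 0 (by norm_num)
    · simpa using h01 1 (by norm_num)
    · simp only
      rw [hcoeff _ m _ (by omega) hm (by omega) (by omega)]
      simp only [p, Polynomial.coeff_add, Polynomial.coeff_map, Polynomial.coeff_C_mul,
        Polynomial.coeff_X_pow, if_true, mul_one, lead, MvPolynomial.aeval_rename,
        Function.comp_def]
      rw [add_comm]
      rfl

end BoundaryFlow
end

noncomputable section

/-! ### Extension of `C¹` maps across a hyperplane -/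

section Reflection

variable {E G : Type*} [NormedAddCommGroup E] [NormedSpace ℝ E] [NormedAddCommGroup G]
  [NormedSpace ℝ G]

/-- A `C¹` map on a half-space extends across the bounding hyperplane, by reflection. -/
theorem exists_contDiffAt_extension {f : E → G} {l : E →L[ℝ] ℝ} {n x₀ : E} (hn : l n = 1)
    (hx₀ : l x₀ = 0) {V : Set E} (hV : V ∈ 𝓝 x₀) (hf : ContDiffOn ℝ 1 f (V ∩ {x | 0 ≤ l x})) :
    ∃ F : E → G, ContDiffAt ℝ 1 F x₀ ∧ ∀ x, 0 ≤ l x → F x = f x := by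
  obtain ⟨V', hV'V, hV'o, hxV'⟩ := mem_nhds_iff.1 hV
  set H : Set E := {x | 0 ≤ l x} with hH
  set H' : Set E := {x | l x ≤ 0} with hH'
  have hHc : IsClosed H := isClosed_le continuous_const l.continuous
  have hHc' : IsClosed H' := isClosed_le l.continuous continuous_const
  have huniq : UniqueDiffOn ℝ H := by
    refine uniqueDiffOn_convex ?_ ?_
    · exact (convex_Ici (0 : ℝ)).linear_preimage l.toLinearMap
    · refine ⟨n, mem_interior_iff_mem_nhds.2 ?_⟩
      filter_upwards [l.continuous.continuousAt.eventually (lt_mem_nhds (by rw [hn]; norm_num :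
        (0 : ℝ) < l n))] with x hx using le_of_lt hx
  have hf' : ContDiffOn ℝ 1 f (H ∩ V') := by
    rw [inter_comm]
    exact hf.mono (inter_subset_inter_left _ hV'V)
  have hd : ∀ x ∈ H ∩ V', HasFDerivWithinAt f (fderivWithin ℝ f H x) H x := by
    intro x hx
    have h1 : DifferentiableWithinAt ℝ f (H ∩ V') x :=
      (hf' x hx).differentiableWithinAt (by norm_num)
    exact ((differentiableWithinAt_inter (hV'o.mem_nhds hx.2)).1 h1).hasFDerivWithinAt
  have hc : ContinuousOn (fderivWithin ℝ f H) (H ∩ V') := by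
    have h1 := hf'.continuousOn_fderivWithin (huniq.inter hV'o) le_rfl
    refine h1.congr fun x hx => ?_
    rw [fderivWithin_inter (hV'o.mem_nhds hx.2)]
  set f' := fderivWithin ℝ f H with hfdef
  set π : E →L[ℝ] E := ContinuousLinearMap.id ℝ E - l.smulRight n with hπ
  set ρ : E →L[ℝ] E := ContinuousLinearMap.id ℝ E - (2 : ℝ) • l.smulRight n with hρ
  have hlπ : ∀ x, l (π x) = 0 := by intro x; simp [hπ, hn]
  have hlρ : ∀ x, l (ρ x) = -l x := by intro x; simp [hρ, hn]; ring
  have hπ0 : ∀ x, l x = 0 → π x = x := by intro x hx; simp [hπ, hx]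
  have hρ0 : ∀ x, l x = 0 → ρ x = x := by intro x hx; simp [hρ, hx]
  have hπρ : (2 : ℝ) • π - ρ = ContinuousLinearMap.id ℝ E := by
    ext x; simp [hπ, hρ, two_smul]; abel
  set W : Set E := V' ∩ (π ⁻¹' V' ∩ ρ ⁻¹' V') with hW
  have hWo : IsOpen W := hV'o.inter ((hV'o.preimage π.continuous).inter
    (hV'o.preimage ρ.continuous))
  have hxW : x₀ ∈ W := ⟨hxV', by simpa [hπ0 x₀ hx₀] using hxV', by simpa [hρ0 x₀ hx₀] using hxV'⟩
  classical
  -- Beyond the hyperplane the map is extrapolated by 2f(πx) - f(ρx), with π the projection onto the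
  -- hyperplane along `n` and ρ the reflection. Both fix the hyperplane, so the values match there;
  -- the derivatives match because 2π - ρ = id.
  set F : E → G := fun x => if 0 ≤ l x then f x else (2 : ℝ) • f (π x) - f (ρ x) with hF
  set F' : E → E →L[ℝ] G := fun x => if 0 ≤ l x then f' x else
    (2 : ℝ) • (f' (π x)).comp π - (f' (ρ x)).comp ρ with hF'
  have hFneg : ∀ x ∈ H', F x = (2 : ℝ) • f (π x) - f (ρ x) := by
    intro x hx
    by_cases h : 0 ≤ l x
    · have h0 : l x = 0 := le_antisymm hx h
      simp [hF, h, hπ0 x h0, hρ0 x h0, two_smul]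
    · simp [hF, h]
  have hF'neg : ∀ x ∈ H', F' x = (2 : ℝ) • (f' (π x)).comp π - (f' (ρ x)).comp ρ := by
    intro x hx
    by_cases h : 0 ≤ l x
    · have h0 : l x = 0 := le_antisymm hx h
      simp only [hF', h, if_true, hπ0 x h0, hρ0 x h0]
      rw [← ContinuousLinearMap.comp_smul, ← ContinuousLinearMap.comp_sub, hπρ,
        ContinuousLinearMap.comp_id]
    · simp [hF', h]
  have hFpos : ∀ x ∈ H, F x = f x := fun x hx => if_pos hx
  have hF'pos : ∀ x ∈ H, F' x = f' x := fun x hx => if_pos hx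
  have hcover : H ∪ H' = univ := by
    ext x; simp [hH, hH', le_total]
  refine ⟨F, contDiffAt_one_iff.2 ⟨F', W, hWo.mem_nhds hxW, ?_, ?_⟩, hFpos⟩
  · have h1 : ∀ x ∈ W, ContinuousWithinAt F' (W ∩ H) x := by
      intro x hx
      by_cases hxH : x ∈ H
      · have hsub : W ∩ H ⊆ H ∩ V' := fun y hy => ⟨hy.2, hy.1.1⟩
        exact ((hc x ⟨hxH, hx.1⟩).mono hsub).congr
          (fun y hy => hF'pos y hy.2) (hF'pos x hxH)
      · exact continuousWithinAt_of_notMem_closure fun h =>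
          hxH (hHc.closure_subset_iff.2 inter_subset_right h)
    have h2 : ∀ x ∈ W, ContinuousWithinAt F' (W ∩ H') x := by
      intro x hx
      by_cases hxH : x ∈ H'
      · have h3 : ContinuousOn (fun x => (2 : ℝ) • (f' (π x)).comp π - (f' (ρ x)).comp ρ)
            (W ∩ H') := by
          have c1 : ContinuousOn (fun x => f' (π x)) (W ∩ H') :=
            hc.comp π.continuous.continuousOn fun y hy => ⟨(hlπ y).ge, hy.1.2.1⟩
          have c2 : ContinuousOn (fun x => f' (ρ x)) (W ∩ H') :=
            hc.comp ρ.continuous.continuousOn fun y hy =>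
              ⟨by change 0 ≤ l (ρ y); rw [hlρ]; exact neg_nonneg.2 hy.2, hy.1.2.2⟩
          have c3 := ((ContinuousLinearMap.compL ℝ E E G).flip π).continuous.comp_continuousOn c1
          have c4 := ((ContinuousLinearMap.compL ℝ E E G).flip ρ).continuous.comp_continuousOn c2
          exact (c3.const_smul (2 : ℝ)).sub c4
        exact (h3 x ⟨hx, hxH⟩).congr (fun y hy => hF'neg y hy.2) (hF'neg x hxH)
      · exact continuousWithinAt_of_notMem_closure fun h =>
          hxH (hHc'.closure_subset_iff.2 inter_subset_right h)
    intro x hx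
    have := (h1 x hx).union (h2 x hx)
    rwa [← inter_union_distrib_left, hcover, inter_univ] at this
  · intro x hx
    have h1 : HasFDerivWithinAt F (F' x) H x := by
      by_cases hxH : x ∈ H
      · rw [hF'pos x hxH]
        exact (hd x ⟨hxH, hx.1⟩).congr (fun y hy => hFpos y hy) (hFpos x hxH)
      · exact HasFDerivWithinAt.of_notMem_closure fun h => hxH (hHc.closure_subset h)
    have h2 : HasFDerivWithinAt F (F' x) H' x := by
      by_cases hxH : x ∈ H'
      · rw [hF'neg x hxH]
        have d1 : HasFDerivWithinAt (fun x => f (π x)) ((f' (π x)).comp π) H' x :=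
          (hd (π x) ⟨(hlπ x).ge, hx.2.1⟩).comp x π.hasFDerivWithinAt fun y _ => (hlπ y).ge
        have d2 : HasFDerivWithinAt (fun x => f (ρ x)) ((f' (ρ x)).comp ρ) H' x := by
          refine (hd (ρ x) ⟨?_, hx.2.2⟩).comp x ρ.hasFDerivWithinAt fun y hy => ?_
          · change 0 ≤ l (ρ x); rw [hlρ]; exact neg_nonneg.2 hxH
          · change 0 ≤ l (ρ y); rw [hlρ]; exact neg_nonneg.2 hy
        exact ((d1.const_smul (2 : ℝ)).sub d2).congr (fun y hy => hFneg y hy) (hFneg x hxH)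
      · exact HasFDerivWithinAt.of_notMem_closure fun h => hxH (hHc'.closure_subset h)
    have := h1.union h2
    rwa [hcover, hasFDerivWithinAt_univ] at this

end Reflection

/-! ### Differentiable dependence on the initial value -/

section Flow

variable {E : Type*} [NormedAddCommGroup E] [NormedSpace ℝ E] [FiniteDimensional ℝ E]

/-- Homogeneity of the Gronwall bound in its data: a common factor η'|ε - ε₀| of initial error and
forcing passes to the conclusion. -/
theorem gronwallBound_mul (a δ K ε x : ℝ) :
    gronwallBound (a * δ) K (a * ε) x = a * gronwallBound δ K ε x := by
  unfold gronwallBound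
  split_ifs <;> ring

/-- Uniform differentiability of a `C¹` map on a ball. -/
theorem exists_uniform_differentiable {f : E → E} {f' : E → E →L[ℝ] E} {z₀ : E} {ρ : ℝ}
    (hd : ∀ z ∈ Metric.closedBall z₀ ρ, HasFDerivAt f (f' z) z)
    (hc : ContinuousOn f' (Metric.closedBall z₀ ρ)) {η : ℝ} (hη : 0 < η) :
    ∃ r > 0, ∀ a ∈ Metric.closedBall z₀ ρ, ∀ b ∈ Metric.closedBall z₀ ρ, ‖a - b‖ < r →
      ‖f a - f b - f' b (a - b)‖ ≤ η * ‖a - b‖ := by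
  have : ProperSpace E := FiniteDimensional.proper ℝ E
  have huc := (isCompact_closedBall z₀ ρ).uniformContinuousOn_of_continuous hc
  obtain ⟨r, hr, h⟩ := Metric.uniformContinuousOn_iff.1 huc η hη
  refine ⟨r, hr, fun a ha b hb hab => ?_⟩
  have hconv : Convex ℝ (Metric.closedBall z₀ ρ ∩ Metric.ball b r) :=
    (convex_closedBall z₀ ρ).inter (convex_ball b r)
  refine hconv.norm_image_sub_le_of_norm_hasFDerivWithin_le' (f' := f')
    (fun x hx => (hd x hx.1).hasFDerivWithinAt) (fun x hx => ?_) ⟨hb, Metric.mem_ball_self hr⟩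
    ⟨ha, by rwa [Metric.mem_ball, dist_eq_norm]⟩
  rw [← dist_eq_norm]
  exact (h x hx.1 b hb hx.2).le

/-- The solutions of the equation of variations along a trajectory are the derivatives of the
flow with respect to the initial value. -/
theorem exists_variation {f : E → E} {f' : E → E →L[ℝ] E} {z₀ : E} {ρ Λ T L : ℝ}
    (hd : ∀ z ∈ Metric.closedBall z₀ ρ, HasFDerivAt f (f' z) z)
    (hc : ContinuousOn f' (Metric.closedBall z₀ ρ))
    (hΛ : ∀ z ∈ Metric.closedBall z₀ ρ, ‖f' z‖ ≤ Λ) (hT : 0 ≤ T) (hΛT : Λ * T ≤ 1 / 2)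
    {Z : ℝ → ℝ → E} {ε₀ : ℝ} {c' : E}
    (hZ : ∀ᶠ ε in 𝓝 ε₀, ∀ t ∈ Icc 0 T,
      HasDerivAt (Z ε) (f (Z ε t)) t ∧ Z ε t ∈ Metric.closedBall z₀ ρ)
    (hL : ∀ᶠ ε in 𝓝 ε₀, ∀ t ∈ Icc 0 T, ‖Z ε t - Z ε₀ t‖ ≤ L * ‖Z ε 0 - Z ε₀ 0‖)
    (h0 : HasDerivAt (fun ε => Z ε 0) c' ε₀) :
    ∃ J : ℝ → E, J 0 = c' ∧
      (∀ t ∈ Icc 0 T, HasDerivWithinAt J (f' (Z ε₀ t) (J t)) (Icc 0 T) t) ∧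
      ∀ η > 0, ∀ᶠ ε in 𝓝 ε₀, ∀ t ∈ Icc 0 T,
        ‖Z ε t - Z ε₀ t - (ε - ε₀) • J t‖ ≤ η * |ε - ε₀| := by
  have hZ₀ := hZ.self_of_nhds
  have hz₀ : Z ε₀ 0 ∈ Metric.closedBall z₀ ρ := (hZ₀ 0 ⟨le_rfl, hT⟩).2
  have hΛ0 : 0 ≤ Λ := (norm_nonneg _).trans (hΛ _ hz₀)
  have hcont : ContinuousOn (fun t => f' (Z ε₀ t)) (Icc 0 T) :=
    hc.comp (fun t ht => (hZ₀ t ht).1.continuousAt.continuousWithinAt) fun t ht => (hZ₀ t ht).2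
  obtain ⟨J, hJ0, hJ⟩ : ∃ J : ℝ → E, J 0 = c' ∧
      ∀ t ∈ Icc 0 T, HasDerivWithinAt J (f' (Z ε₀ t) (J t)) (Icc 0 T) t := by
    -- On the ball of radius ‖c'‖ + 1 about c' the linear field is at most Λ(2‖c'‖ + 1). By ΛT ≤ 1/2
    -- a solution cannot leave this ball before time T, so one application covers all of [0, T].
    have hpl : IsPicardLindelof (fun t x => f' (Z ε₀ t) x) (tmin := 0) (tmax := T)
        ⟨0, le_rfl, hT⟩ c' (‖c'‖₊ + 1) 0 (⟨Λ, hΛ0⟩ * (2 * ‖c'‖₊ + 1)) ⟨Λ, hΛ0⟩ := by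
      refine ⟨fun t ht => ?_, fun x _ => hcont.clm_apply continuousOn_const, fun t ht x hx => ?_,
        ?_⟩
      · refine LipschitzOnWith.of_dist_le_mul fun x _ y _ => ?_
        rw [dist_eq_norm, dist_eq_norm, ← map_sub]
        exact (f' (Z ε₀ t)).le_of_opNorm_le (hΛ _ (hZ₀ t ht).2) _
      · have hx' : ‖x‖ ≤ 2 * ‖c'‖ + 1 := by
          have h1 : ‖x - c'‖ ≤ ‖c'‖ + 1 := by
            simpa [dist_eq_norm] using hx
          have h2 := norm_le_norm_add_norm_sub' x c'
          linarith
        refine ((f' (Z ε₀ t)).le_of_opNorm_le (hΛ _ (hZ₀ t ht).2) _).trans ?_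
        exact mul_le_mul_of_nonneg_left hx' hΛ0
      · push_cast
        simp only [sub_zero, sub_self]
        rw [max_eq_left hT]
        have : 0 ≤ ‖c'‖ := norm_nonneg _
        change Λ * (2 * ‖c'‖ + 1) * T ≤ ‖c'‖ + 1
        nlinarith
    obtain ⟨J, h1, h2⟩ := hpl.exists_eq_forall_mem_Icc_hasDerivWithinAt₀
    exact ⟨J, h1, h2⟩
  refine ⟨J, hJ0, hJ, fun η hη => ?_⟩
  -- C|ε - ε₀| will bound the distance of the trajectories on [0, T], and B the growth of the error;
  -- the tolerance η/B compensates for this growth.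
  set C : ℝ := |L| * (‖c'‖ + 1) with hC
  have hC0 : 0 ≤ C := by positivity
  set B : ℝ := gronwallBound 1 Λ C T with hB
  have hBmono := gronwallBound_mono zero_le_one hC0 hΛ0
  have hB1 : 1 ≤ B := by
    have := hBmono hT
    rwa [gronwallBound_x0] at this
  set η' : ℝ := η / B with hη'
  have hη'0 : 0 < η' := by positivity
  obtain ⟨r, hr, hunif⟩ := exists_uniform_differentiable hd hc hη'0
  have hinit : ∀ᶠ ε in 𝓝 ε₀, ‖Z ε 0 - Z ε₀ 0 - (ε - ε₀) • c'‖ ≤ η' * |ε - ε₀| := by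
    have := (hasDerivAt_iff_isLittleO.1 h0).bound hη'0
    simpa only [Real.norm_eq_abs] using this
  have hinit' : ∀ᶠ ε in 𝓝 ε₀, ‖Z ε 0 - Z ε₀ 0‖ ≤ (‖c'‖ + 1) * |ε - ε₀| := by
    have := (hasDerivAt_iff_isLittleO.1 h0).bound (zero_lt_one' ℝ)
    filter_upwards [this] with ε hε
    rw [one_mul, Real.norm_eq_abs] at hε
    have h1 := norm_le_norm_add_norm_sub' (Z ε 0 - Z ε₀ 0) ((ε - ε₀) • c')
    rw [norm_smul, Real.norm_eq_abs] at h1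
    linarith
  have hsmall : ∀ᶠ ε in 𝓝 ε₀, C * |ε - ε₀| < r := by
    have : Tendsto (fun ε => C * |ε - ε₀|) (𝓝 ε₀) (𝓝 (C * |ε₀ - ε₀|)) :=
      (Continuous.tendsto (by fun_prop) ε₀)
    refine this.eventually (gt_mem_nhds ?_)
    simpa using hr
  filter_upwards [hZ, hL, hinit, hinit', hsmall] with ε hZ hL hinit hinit' hsmall
  have hdist : ∀ t ∈ Icc 0 T, ‖Z ε t - Z ε₀ t‖ ≤ C * |ε - ε₀| := by
    intro t ht
    calc ‖Z ε t - Z ε₀ t‖ ≤ |L| * ‖Z ε 0 - Z ε₀ 0‖ :=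
          (hL t ht).trans (by gcongr; exact le_abs_self L)
      _ ≤ |L| * ((‖c'‖ + 1) * |ε - ε₀|) := by gcongr
      _ = _ := by rw [hC]; ring
  have hder : ∀ t ∈ Icc 0 T, HasDerivWithinAt (fun t => Z ε t - Z ε₀ t - (ε - ε₀) • J t)
      (f (Z ε t) - f (Z ε₀ t) - (ε - ε₀) • f' (Z ε₀ t) (J t)) (Icc 0 T) t := fun t ht =>
    (((hZ t ht).1.sub (hZ₀ t ht).1).hasDerivWithinAt).sub ((hJ t ht).const_smul (ε - ε₀))
  have hgron := norm_le_gronwallBound_of_norm_deriv_right_le (a := 0) (b := T)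
    (f := fun t => Z ε t - Z ε₀ t - (ε - ε₀) • J t)
    (f' := fun t => f (Z ε t) - f (Z ε₀ t) - (ε - ε₀) • f' (Z ε₀ t) (J t))
    (δ := η' * |ε - ε₀| * 1) (K := Λ) (ε := η' * |ε - ε₀| * C)
    (fun t ht => (hder t ht).continuousWithinAt)
    (fun t ht => (hder t ⟨ht.1, ht.2.le⟩).mono_of_mem_nhdsWithin (Icc_mem_nhdsGE_of_mem ht))
    (by rw [hJ0, mul_one]; exact hinit) (fun t ht => ?_)
  · intro t ht
    refine (hgron t ht).trans ?_
    rw [gronwallBound_mul, sub_zero]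
    have h1 : gronwallBound 1 Λ C t ≤ B := hBmono ht.2
    calc η' * |ε - ε₀| * gronwallBound 1 Λ C t ≤ η' * |ε - ε₀| * B := by gcongr
      _ = η * |ε - ε₀| := by rw [hη']; field_simp
  · have ht' : t ∈ Icc 0 T := ⟨ht.1, ht.2.le⟩
    have h1 := hunif _ (hZ t ht').2 _ (hZ₀ t ht').2 ((hdist t ht').trans_lt hsmall)
    -- The linear part acts on the error itself and is absorbed by Gronwall; the remainder is small
    -- by uniform differentiability along the trajectory.
    have h2 : f (Z ε t) - f (Z ε₀ t) - (ε - ε₀) • f' (Z ε₀ t) (J t)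
        = f' (Z ε₀ t) (Z ε t - Z ε₀ t - (ε - ε₀) • J t)
          + (f (Z ε t) - f (Z ε₀ t) - f' (Z ε₀ t) (Z ε t - Z ε₀ t)) := by
      simp only [map_sub, map_smul]; abel
    rw [h2]
    refine (norm_add_le _ _).trans (add_le_add ?_ ?_)
    · exact (f' (Z ε₀ t)).le_of_opNorm_le (hΛ _ (hZ₀ t ht').2) _
    · refine h1.trans ?_
      calc η' * ‖Z ε t - Z ε₀ t‖ ≤ η' * (C * |ε - ε₀|) := by gcongr; exact hdist t ht'
        _ = _ := by ring

/-- Local flow of a `C¹` vector field near a point, for short times. -/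
theorem exists_local_flow {f : E → E} {z₀ : E} (hf : ContDiffAt ℝ 1 f z₀) {U : Set E}
    (hU : U ∈ 𝓝 z₀) {b : ℝ} (hb : 0 < b) :
    ∃ r > 0, ∃ T > 0, T ≤ b ∧ ∃ (L : ℝ) (Z : E → ℝ → E), ∀ z ∈ Metric.closedBall z₀ r,
      Z z 0 = z ∧
      (∀ t ∈ Icc (-T) T, HasDerivAt (Z z) (f (Z z t)) t ∧ Z z t ∈ U) ∧
      ∀ z' ∈ Metric.closedBall z₀ r, ∀ t ∈ Icc (-T) T, ‖Z z t - Z z' t‖ ≤ L * ‖z - z'‖ := by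
  have : CompleteSpace E := FiniteDimensional.complete ℝ E
  obtain ⟨T₁, hT₁, a, r, M, K, hr, hpl⟩ := IsPicardLindelof.of_contDiffAt_one hf
  obtain ⟨Z, hZ, L, hL⟩ := (hpl 0).exists_forall_mem_closedBall_eq_hasDerivWithinAt_lipschitzOnWith
  simp only [zero_sub, zero_add] at hZ hL
  obtain ⟨ρ, hρ, hρU⟩ := Metric.mem_nhds_iff.1 hU
  have hz₀ := hZ z₀ (Metric.mem_closedBall_self r.2)
  have hcont : ContinuousAt (Z z₀) 0 :=
    ((hz₀.2 0 ⟨by linarith, hT₁.le⟩).hasDerivAt (Icc_mem_nhds (by linarith) hT₁)).continuousAt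
  have h1 : ∀ᶠ t in 𝓝 (0 : ℝ), dist (Z z₀ t) z₀ < ρ / 2 := by
    have := hcont.eventually (Metric.ball_mem_nhds (Z z₀ 0) (half_pos hρ))
    rw [hz₀.1] at this
    exact this
  obtain ⟨T₂, hT₂, h2⟩ := Metric.eventually_nhds_iff.1 h1
  set T := min b (min (T₁ / 2) (T₂ / 2)) with hT
  have hT0 : 0 < T := lt_min hb (lt_min (half_pos hT₁) (half_pos hT₂))
  have hTT₁ : T < T₁ := ((min_le_right _ _).trans (min_le_left _ _)).trans_lt (half_lt_self hT₁)
  have hTT₂ : T < T₂ := ((min_le_right _ _).trans (min_le_right _ _)).trans_lt (half_lt_self hT₂)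
  have hsub : Icc (-T) T ⊆ Icc (-T₁) T₁ := Icc_subset_Icc (by linarith) hTT₁.le
  -- The central trajectory stays within ρ/2 of z₀ for |t| ≤ T; this radius keeps the others within
  -- ρ/2 of it.
  set r' : ℝ := min r (ρ / 2 / (L + 1)) with hr'
  have hr'0 : 0 < r' := lt_min hr (by positivity)
  have hsub' : Metric.closedBall z₀ r' ⊆ Metric.closedBall z₀ r :=
    Metric.closedBall_subset_closedBall (min_le_left _ _)
  refine ⟨r', hr'0, T, hT0, min_le_left _ _, L, Z, fun z hz => ⟨(hZ z (hsub' hz)).1,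
    fun t ht => ⟨?_, hρU ?_⟩, fun z' hz' t ht => ?_⟩⟩
  · exact ((hZ z (hsub' hz)).2 t (hsub ht)).hasDerivAt
      (Icc_mem_nhds (by linarith [ht.1]) (by linarith [ht.2]))
  · have h3 := (hL t (hsub ht)).dist_le_mul z (hsub' hz) z₀ (Metric.mem_closedBall_self r.2)
    have h4 : dist (Z z₀ t) z₀ < ρ / 2 := h2 (by
      rw [Real.dist_eq, sub_zero]
      exact (abs_le.2 ht).trans_lt hTT₂)
    have h5 : (L : ℝ) * dist z z₀ ≤ ρ / 2 := by
      have h6 : dist z z₀ ≤ ρ / 2 / (L + 1) := (Metric.mem_closedBall.1 hz).trans (min_le_right _ _)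
      have h7 : (0 : ℝ) ≤ L := L.2
      calc (L : ℝ) * dist z z₀ ≤ (L + 1) * (ρ / 2 / (L + 1)) := by gcongr; linarith
        _ = ρ / 2 := by field_simp
    calc dist (Z z t) z₀ ≤ dist (Z z t) (Z z₀ t) + dist (Z z₀ t) z₀ := dist_triangle _ _ _
      _ < ρ := by linarith
  · simpa only [dist_eq_norm] using (hL t (hsub ht)).dist_le_mul z (hsub' hz) z' (hsub' hz')

end Flow
end

noncomputable section

/-! ### The metric in coordinates -/

section Chart

set_option linter.unusedSectionVars false

variable {d : ℕ} {M : Type*} [TopologicalSpace M] [ChartedSpace (EuclideanHalfSpace (d + 1)) M]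

variable (d) in
/-- The coordinate half-space. -/
abbrev halfSpace : Set (CoordSpace d) := range (𝓡∂ (d + 1))

theorem mem_halfSpace {x : CoordSpace d} : x ∈ halfSpace d ↔ 0 ≤ x 0 := by
  rw [halfSpace, range_modelWithCornersEuclideanHalfSpace]; rfl

variable (d) in
theorem uniqueDiffOn_halfSpace : UniqueDiffOn ℝ (halfSpace d) := (𝓡∂ (d + 1)).uniqueDiffOn

theorem halfSpace_subset_closure_interior : halfSpace d ⊆ closure (interior (halfSpace d)) := by
  intro x hx
  rw [halfSpace, interior_range_modelWithCornersEuclideanHalfSpace]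
  have := closure_open_halfSpace 2 (0 : ℝ) (0 : Fin (d + 1))
  rw [this]
  exact mem_halfSpace.1 hx

theorem OpenPartialHomeomorph.extend_target_mem_nhdsWithin_of_mem (e : BdChart d M)
    {x : CoordSpace d} (hx : x ∈ (e.extend (𝓡∂ (d + 1))).target) :
    (e.extend (𝓡∂ (d + 1))).target ∈ 𝓝[halfSpace d] x := by
  have h := e.extend_target_mem_nhdsWithin (I := 𝓡∂ (d + 1))
    (y := (e.extend (𝓡∂ (d + 1))).symm x) (by
      rw [← e.extend_source (I := 𝓡∂ (d + 1))]
      exact (e.extend (𝓡∂ (d + 1))).map_target hx)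
  rwa [(e.extend (𝓡∂ (d + 1))).right_inv hx] at h

theorem exists_open_inter_halfSpace (e : BdChart d M) :
    ∃ V : Set (CoordSpace d), IsOpen V ∧ (e.extend (𝓡∂ (d + 1))).target = V ∩ halfSpace d :=
  ⟨(𝓡∂ (d + 1)).symm ⁻¹' e.target, e.open_target.preimage (𝓡∂ (d + 1)).continuous_symm,
    e.extend_target⟩

theorem mdifferentiableWithinAt_extend_symm {e : BdChart d M}
    (he : e ∈ IsManifold.maximalAtlas (𝓡∂ (d + 1)) ∞ M) {x : CoordSpace d}
    (hx : x ∈ (e.extend (𝓡∂ (d + 1))).target) :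
    MDifferentiableWithinAt 𝓘(ℝ, CoordSpace d) (𝓡∂ (d + 1)) (e.extend (𝓡∂ (d + 1))).symm
      (halfSpace d) x := by
  have h := contMDiffOn_extend_symm he
  rw [← e.extend_target'] at h
  exact ((h x hx).mdifferentiableWithinAt (by simp)).mono_of_mem_nhdsWithin
    (e.extend_target_mem_nhdsWithin_of_mem hx)

theorem mfderiv_extend_comp_mfderivWithin_extend_symm {e : BdChart d M}
    (he : e ∈ IsManifold.maximalAtlas (𝓡∂ (d + 1)) ∞ M) {x : CoordSpace d}
    (hx : x ∈ (e.extend (𝓡∂ (d + 1))).target) :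
    (mfderiv (𝓡∂ (d + 1)) 𝓘(ℝ, CoordSpace d) (e.extend (𝓡∂ (d + 1)))
      ((e.extend (𝓡∂ (d + 1))).symm x)) ∘L
    (mfderivWithin 𝓘(ℝ, CoordSpace d) (𝓡∂ (d + 1)) (e.extend (𝓡∂ (d + 1))).symm
      (range (𝓡∂ (d + 1))) x) = ContinuousLinearMap.id _ _ := by
  have U : UniqueMDiffWithinAt 𝓘(ℝ, CoordSpace d) (range (𝓡∂ (d + 1))) x :=
    (𝓡∂ (d + 1)).uniqueMDiffOn x (e.extend_target_subset_range hx)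
  have hs : (e.extend (𝓡∂ (d + 1))).symm x ∈ e.source := by
    rw [← e.extend_source (I := 𝓡∂ (d + 1))]
    exact (e.extend (𝓡∂ (d + 1))).map_target hx
  rw [← mfderiv_comp_mfderivWithin]; rotate_left
  · exact (e.contMDiffAt_extend he hs).mdifferentiableAt (by simp)
  · exact mdifferentiableWithinAt_extend_symm he hx
  · exact U
  rw [← mfderivWithin_id U]
  apply Filter.EventuallyEq.mfderivWithin_eq
  · filter_upwards [e.extend_target_mem_nhdsWithin_of_mem hx] with z hz
    simp only [Function.comp_def, PartialEquiv.right_inv _ hz, id_eq]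
  · simp only [Function.comp_def, PartialEquiv.right_inv _ hx, id_eq]

theorem mfderiv_mfderivWithin_extend_symm_apply {e : BdChart d M}
    (he : e ∈ IsManifold.maximalAtlas (𝓡∂ (d + 1)) ∞ M) {x : CoordSpace d}
    (hx : x ∈ (e.extend (𝓡∂ (d + 1))).target) :
    Function.LeftInverse (mfderiv (𝓡∂ (d + 1)) 𝓘(ℝ, CoordSpace d) (e.extend (𝓡∂ (d + 1)))
      ((e.extend (𝓡∂ (d + 1))).symm x))
    (mfderivWithin 𝓘(ℝ, CoordSpace d) (𝓡∂ (d + 1)) (e.extend (𝓡∂ (d + 1))).symm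
      (range (𝓡∂ (d + 1))) x) :=
  fun u => DFunLike.congr_fun (mfderiv_extend_comp_mfderivWithin_extend_symm he hx) u

theorem SymTensor.inChart_add_left (g : SymTensor d M) (e : BdChart d M)
    (x u u' w : CoordSpace d) :
    g.inChart e x (u + u') w = g.inChart e x u w + g.inChart e x u' w := by
  have h1 := (mfderivWithin 𝓘(ℝ, CoordSpace d) (𝓡∂ (d + 1)) (e.extend (𝓡∂ (d + 1))).symm
      (range (𝓡∂ (d + 1))) x).map_add u u'
  have h2 := (g.val ((e.extend (𝓡∂ (d + 1))).symm x)).map_add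
    (mfderivWithin 𝓘(ℝ, CoordSpace d) (𝓡∂ (d + 1)) (e.extend (𝓡∂ (d + 1))).symm
      (range (𝓡∂ (d + 1))) x u)
    (mfderivWithin 𝓘(ℝ, CoordSpace d) (𝓡∂ (d + 1)) (e.extend (𝓡∂ (d + 1))).symm
      (range (𝓡∂ (d + 1))) x u')
  exact (congrArg (fun a => g.val _ a (mfderivWithin 𝓘(ℝ, CoordSpace d) (𝓡∂ (d + 1))
    (e.extend (𝓡∂ (d + 1))).symm (range (𝓡∂ (d + 1))) x w)) h1).trans
      (DFunLike.congr_fun h2 _)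

theorem SymTensor.inChart_smul_left (g : SymTensor d M) (e : BdChart d M)
    (x : CoordSpace d) (c : ℝ) (u w : CoordSpace d) :
    g.inChart e x (c • u) w = c * g.inChart e x u w := by
  have h1 := (mfderivWithin 𝓘(ℝ, CoordSpace d) (𝓡∂ (d + 1)) (e.extend (𝓡∂ (d + 1))).symm
      (range (𝓡∂ (d + 1))) x).map_smul c u
  have h2 := (g.val ((e.extend (𝓡∂ (d + 1))).symm x)).map_smul c
    (mfderivWithin 𝓘(ℝ, CoordSpace d) (𝓡∂ (d + 1)) (e.extend (𝓡∂ (d + 1))).symm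
      (range (𝓡∂ (d + 1))) x u)
  exact (congrArg (fun a => g.val _ a (mfderivWithin 𝓘(ℝ, CoordSpace d) (𝓡∂ (d + 1))
    (e.extend (𝓡∂ (d + 1))).symm (range (𝓡∂ (d + 1))) x w)) h1).trans
      (DFunLike.congr_fun h2 _)

theorem SymTensor.inChart_symm (g : SymTensor d M) (e : BdChart d M) (x u w : CoordSpace d) :
    g.inChart e x u w = g.inChart e x w u := g.symm _ _ _

/-- The components of the metric in a chart, as a bilinear map. -/
def SymTensor.bilin (g : SymTensor d M) (e : BdChart d M) (x : CoordSpace d) :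
    CoordSpace d →L[ℝ] CoordSpace d →L[ℝ] ℝ :=
  LinearMap.toContinuousLinearMap <|
    (LinearMap.toContinuousLinearMap (𝕜 := ℝ) (E := CoordSpace d) (F' := ℝ)).toLinearMap ∘ₗ
      LinearMap.mk₂ ℝ (g.inChart e x) (g.inChart_add_left e x) (g.inChart_smul_left e x)
        (fun u w w' => by
          rw [g.inChart_symm, g.inChart_add_left, g.inChart_symm e x w, g.inChart_symm e x w'])
        (fun c u w => by
          rw [g.inChart_symm, g.inChart_smul_left, g.inChart_symm e x w, smul_eq_mul])

theorem SymTensor.bilin_apply (g : SymTensor d M) (e : BdChart d M) (x u w : CoordSpace d) :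
    g.bilin e x u w = g.inChart e x u w := rfl

theorem SymTensor.bilin_symm (g : SymTensor d M) (e : BdChart d M) (x u w : CoordSpace d) :
    g.bilin e x u w = g.bilin e x w u := g.symm _ _ _

theorem SymTensor.contDiffOn_bilin (g : SymTensor d M) {e : BdChart d M}
    (he : e ∈ IsManifold.maximalAtlas (𝓡∂ (d + 1)) ∞ M) :
    ContDiffOn ℝ ∞ (g.bilin e) (e.extend (𝓡∂ (d + 1))).target :=
  contDiffOn_clm_apply.2 fun u => contDiffOn_clm_apply.2 fun w => g.smooth e he u w

/-- Nondegeneracy. In the Lorentzian case a vector in the kernel is orthogonal to a timelike vector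
whose orthogonal complement is positive definite, so it must vanish. -/
theorem SymTensor.IsMetric.eq_zero {g : SymTensor d M} {kind : MetricKind} (hg : g.IsMetric kind)
    {q : M} {u : TangentSpace (𝓡∂ (d + 1)) q} (hu : ∀ w, g.val q u w = 0) : u = 0 := by
  by_contra h
  cases kind with
  | riemannian => exact (hg q u h).ne' (hu u)
  | lorentzian =>
    obtain ⟨w, -, hw⟩ := hg.1 q
    exact (hw u (by rw [g.symm]; exact hu w) h).ne' (hu u)

theorem ContinuousLinearMap.isInvertible_of_injective {E F : Type*} [NormedAddCommGroup E]
    [NormedSpace ℝ E] [FiniteDimensional ℝ E] [NormedAddCommGroup F] [NormedSpace ℝ F]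
    [FiniteDimensional ℝ F] (h : Module.finrank ℝ E = Module.finrank ℝ F) {A : E →L[ℝ] F}
    (hA : Function.Injective A) : A.IsInvertible := by
  let e := LinearEquiv.ofInjectiveOfFinrankEq A.toLinearMap hA h
  exact ⟨e.toContinuousLinearEquiv, by ext x; rfl⟩

theorem finrank_continuousDual (E : Type*) [NormedAddCommGroup E]
    [NormedSpace ℝ E] [FiniteDimensional ℝ E] :
    Module.finrank ℝ E = Module.finrank ℝ (E →L[ℝ] ℝ) := by
  rw [← (LinearMap.toContinuousLinearMap (𝕜 := ℝ) (E := E) (F' := ℝ)).finrank_eq]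
  exact (Subspace.dual_finrank_eq (K := ℝ) (V := E)).symm

theorem surjective_mfderivWithin_extend_symm {e : BdChart d M}
    (he : e ∈ IsManifold.maximalAtlas (𝓡∂ (d + 1)) ∞ M) {x : CoordSpace d}
    (hx : x ∈ (e.extend (𝓡∂ (d + 1))).target) :
    Function.Surjective (mfderivWithin 𝓘(ℝ, CoordSpace d) (𝓡∂ (d + 1))
      (e.extend (𝓡∂ (d + 1))).symm (range (𝓡∂ (d + 1))) x) := by
  have hinj : Function.Injective (mfderivWithin 𝓘(ℝ, CoordSpace d) (𝓡∂ (d + 1))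
      (e.extend (𝓡∂ (d + 1))).symm (range (𝓡∂ (d + 1))) x) :=
    (mfderiv_mfderivWithin_extend_symm_apply he hx).injective
  let A : CoordSpace d →L[ℝ] CoordSpace d := mfderivWithin 𝓘(ℝ, CoordSpace d) (𝓡∂ (d + 1))
      (e.extend (𝓡∂ (d + 1))).symm (range (𝓡∂ (d + 1))) x
  have hA : Function.Surjective A :=
    (LinearMap.injective_iff_surjective (K := ℝ) (V := CoordSpace d) (f := A.toLinearMap)).1 hinj
  exact hA

theorem SymTensor.IsMetric.isInvertible_bilin {g : SymTensor d M} {kind : MetricKind}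
    (hg : g.IsMetric kind) {e : BdChart d M}
    (he : e ∈ IsManifold.maximalAtlas (𝓡∂ (d + 1)) ∞ M) {x : CoordSpace d}
    (hx : x ∈ (e.extend (𝓡∂ (d + 1))).target) : (g.bilin e x).IsInvertible := by
  refine ContinuousLinearMap.isInvertible_of_injective (finrank_continuousDual _) ?_
  rw [injective_iff_map_eq_zero]
  intro u hu
  have hframe := hg.eq_zero (q := (e.extend (𝓡∂ (d + 1))).symm x)
    (u := mfderivWithin 𝓘(ℝ, CoordSpace d) (𝓡∂ (d + 1)) (e.extend (𝓡∂ (d + 1))).symm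
      (range (𝓡∂ (d + 1))) x u) (fun w => ?_)
  · have h1 := mfderiv_mfderivWithin_extend_symm_apply he hx u
    rw [hframe] at h1
    exact h1.symm.trans (map_zero _)
  · obtain ⟨w', rfl⟩ := surjective_mfderivWithin_extend_symm he hx w
    exact DFunLike.congr_fun hu w'

end Chart
end

noncomputable section

/-! ### Geodesics in coordinates -/

section Geodesic

set_option linter.unusedSectionVars false

variable {d : ℕ} {M : Type*} [TopologicalSpace M] [ChartedSpace (EuclideanHalfSpace (d + 1)) M]

/-- The derivative, up to the boundary, of the metric components in a chart. -/
def SymTensor.dBilin (g : SymTensor d M) (e : BdChart d M) (x : CoordSpace d) :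
    CoordSpace d →L[ℝ] CoordSpace d →L[ℝ] CoordSpace d →L[ℝ] ℝ :=
  fderivWithin ℝ (g.bilin e) (halfSpace d) x

theorem SymTensor.contDiffWithinAt_bilin (g : SymTensor d M) {e : BdChart d M}
    (he : e ∈ IsManifold.maximalAtlas (𝓡∂ (d + 1)) ∞ M) {x : CoordSpace d}
    (hx : x ∈ (e.extend (𝓡∂ (d + 1))).target) :
    ContDiffWithinAt ℝ ∞ (g.bilin e) (halfSpace d) x :=
  (g.contDiffOn_bilin he x hx).mono_of_mem_nhdsWithin (e.extend_target_mem_nhdsWithin_of_mem hx)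

theorem SymTensor.hasFDerivWithinAt_bilin (g : SymTensor d M) {e : BdChart d M}
    (he : e ∈ IsManifold.maximalAtlas (𝓡∂ (d + 1)) ∞ M) {x : CoordSpace d}
    (hx : x ∈ (e.extend (𝓡∂ (d + 1))).target) :
    HasFDerivWithinAt (g.bilin e) (g.dBilin e x) (halfSpace d) x :=
  ((g.contDiffWithinAt_bilin he hx).differentiableWithinAt (by simp)).hasFDerivWithinAt

theorem SymTensor.fderivWithin_inChart (g : SymTensor d M) {e : BdChart d M}
    (he : e ∈ IsManifold.maximalAtlas (𝓡∂ (d + 1)) ∞ M) {x : CoordSpace d}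
    (hx : x ∈ (e.extend (𝓡∂ (d + 1))).target) (h u w : CoordSpace d) :
    fderivWithin ℝ (fun y => g.inChart e y u w) (halfSpace d) x h = g.dBilin e x h u w := by
  have hH := uniqueDiffOn_halfSpace d x (e.extend_target_subset_range hx)
  have h1 := ((g.hasFDerivWithinAt_bilin he hx).clm_apply
    (hasFDerivWithinAt_const u x _)).clm_apply (hasFDerivWithinAt_const w x _)
  have h2 : HasFDerivWithinAt (fun y => g.inChart e y u w) _ (halfSpace d) x := h1
  rw [h2.fderivWithin hH]
  simp

theorem SymTensor.dBilin_symm (g : SymTensor d M) {e : BdChart d M}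
    (he : e ∈ IsManifold.maximalAtlas (𝓡∂ (d + 1)) ∞ M) {x : CoordSpace d}
    (hx : x ∈ (e.extend (𝓡∂ (d + 1))).target) (h u w : CoordSpace d) :
    g.dBilin e x h u w = g.dBilin e x h w u := by
  rw [← g.fderivWithin_inChart he hx, ← g.fderivWithin_inChart he hx]
  simp only [g.inChart_symm e _ u w]

theorem SymTensor.christoffel_eq (g : SymTensor d M) {e : BdChart d M}
    (he : e ∈ IsManifold.maximalAtlas (𝓡∂ (d + 1)) ∞ M) {x : CoordSpace d}
    (hx : x ∈ (e.extend (𝓡∂ (d + 1))).target) (u v w : CoordSpace d) :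
    g.christoffel e x u v w =
      (g.dBilin e x u v w + g.dBilin e x v u w - g.dBilin e x w u v) / 2 := by
  rw [SymTensor.christoffel, g.fderivWithin_inChart he hx, g.fderivWithin_inChart he hx,
    g.fderivWithin_inChart he hx]

/-- The change of coordinates between two charts. -/
abbrev chartChange (e f : BdChart d M) : PartialEquiv (CoordSpace d) (CoordSpace d) :=
  (𝓡∂ (d + 1)).extendCoordChange e f

/-- The Jacobian of a change of coordinates. -/
def chartJacobian (e e' : BdChart d M) (x : CoordSpace d) : CoordSpace d →L[ℝ] CoordSpace d :=
  fderivWithin ℝ (chartChange e e') (halfSpace d) x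

variable {e e' : BdChart d M} {x : CoordSpace d}

theorem hasFDerivWithinAt_chartChange (he : e ∈ IsManifold.maximalAtlas (𝓡∂ (d + 1)) ∞ M)
    (he' : e' ∈ IsManifold.maximalAtlas (𝓡∂ (d + 1)) ∞ M) (hx : x ∈ (chartChange e e').source) :
    HasFDerivWithinAt (chartChange e e') (chartJacobian e e' x) (halfSpace d) x :=
  (((𝓡∂ (d + 1)).contDiffWithinAt_extendCoordChange he he' hx).differentiableWithinAt
    (by simp)).hasFDerivWithinAt

theorem hasFDerivWithinAt_chartJacobian (he : e ∈ IsManifold.maximalAtlas (𝓡∂ (d + 1)) ∞ M)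
    (he' : e' ∈ IsManifold.maximalAtlas (𝓡∂ (d + 1)) ∞ M) (hx : x ∈ (chartChange e e').source) :
    HasFDerivWithinAt (chartJacobian e e')
      (fderivWithin ℝ (chartJacobian e e') (halfSpace d) x) (halfSpace d) x := by
  have h := ((𝓡∂ (d + 1)).contDiffWithinAt_extendCoordChange he he' hx).fderivWithin_right
    (m := 1) (uniqueDiffOn_halfSpace d) (by norm_cast)
    (e.extend_target_subset_range hx.1)
  exact (h.differentiableWithinAt (by simp)).hasFDerivWithinAt

/-- Symmetry of second derivatives holds up to the boundary, because the half-space lies in the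
closure of its interior. -/
theorem chartJacobian_deriv_symm (he : e ∈ IsManifold.maximalAtlas (𝓡∂ (d + 1)) ∞ M)
    (he' : e' ∈ IsManifold.maximalAtlas (𝓡∂ (d + 1)) ∞ M) (hx : x ∈ (chartChange e e').source)
    (u w : CoordSpace d) :
    fderivWithin ℝ (chartJacobian e e') (halfSpace d) x u w =
      fderivWithin ℝ (chartJacobian e e') (halfSpace d) x w u := by
  have hm : x ∈ halfSpace d := e.extend_target_subset_range hx.1
  exact ((𝓡∂ (d + 1)).contDiffWithinAt_extendCoordChange he he' hx).isSymmSndFDerivWithinAt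
    (by simp; norm_cast) (uniqueDiffOn_halfSpace d)
    (halfSpace_subset_closure_interior hm) hm u w

theorem chartChange_mem_target (hx : x ∈ (chartChange e e').source) :
    chartChange e e' x ∈ (e'.extend (𝓡∂ (d + 1))).target :=
  (e'.extend (𝓡∂ (d + 1))).map_source hx.2

/-- Transformation law of the metric under changes of coordinates. -/
theorem SymTensor.bilin_chartChange (g : SymTensor d M)
    (he : e ∈ IsManifold.maximalAtlas (𝓡∂ (d + 1)) ∞ M)
    (he' : e' ∈ IsManifold.maximalAtlas (𝓡∂ (d + 1)) ∞ M) (hx : x ∈ (chartChange e e').source)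
    (u w : CoordSpace d) :
    g.bilin e x u w =
      g.bilin e' (chartChange e e' x) (chartJacobian e e' x u) (chartJacobian e e' x w) := by
  have U : UniqueMDiffWithinAt 𝓘(ℝ, CoordSpace d) (range (𝓡∂ (d + 1))) x :=
    (𝓡∂ (d + 1)).uniqueMDiffOn x (e.extend_target_subset_range hx.1)
  have hev : ∀ z ∈ (chartChange e e').source, (e.extend (𝓡∂ (d + 1))).symm z =
      ((e'.extend (𝓡∂ (d + 1))).symm ∘ chartChange e e') z := fun z hz =>
    ((e'.extend (𝓡∂ (d + 1))).left_inv hz.2).symm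
  have hD : mfderivWithin 𝓘(ℝ, CoordSpace d) (𝓡∂ (d + 1)) (e.extend (𝓡∂ (d + 1))).symm
      (range (𝓡∂ (d + 1))) x =
      (mfderivWithin 𝓘(ℝ, CoordSpace d) (𝓡∂ (d + 1)) (e'.extend (𝓡∂ (d + 1))).symm
      (range (𝓡∂ (d + 1))) (chartChange e e' x)).comp (chartJacobian e e' x) := by
    have h1 : mfderivWithin 𝓘(ℝ, CoordSpace d) (𝓡∂ (d + 1)) (e.extend (𝓡∂ (d + 1))).symm
        (range (𝓡∂ (d + 1))) x = mfderivWithin 𝓘(ℝ, CoordSpace d) (𝓡∂ (d + 1))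
        ((e'.extend (𝓡∂ (d + 1))).symm ∘ chartChange e e') (range (𝓡∂ (d + 1))) x := by
      apply Filter.EventuallyEq.mfderivWithin_eq
      · filter_upwards [(𝓡∂ (d + 1)).extendCoordChange_source_mem_nhdsWithin hx] with z hz
        exact hev z hz
      · exact hev x hx
    have h2 := mfderivWithin_comp (I := 𝓘(ℝ, CoordSpace d)) (I' := 𝓘(ℝ, CoordSpace d))
      (I'' := 𝓡∂ (d + 1)) (g := (e'.extend (𝓡∂ (d + 1))).symm) (f := chartChange e e')
      (s := range (𝓡∂ (d + 1))) (u := range (𝓡∂ (d + 1))) (x := x)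
      (mdifferentiableWithinAt_extend_symm he' (chartChange_mem_target hx))
      (hasFDerivWithinAt_chartChange he he' hx).differentiableWithinAt.mdifferentiableWithinAt
      (fun z _ => mem_range_self _) U
    rw [mfderivWithin_eq_fderivWithin] at h2
    exact h1.trans h2
  let val : M → CoordSpace d →L[ℝ] CoordSpace d →L[ℝ] ℝ := fun q => g.val q
  let Q : CoordSpace d →L[ℝ] CoordSpace d := mfderivWithin 𝓘(ℝ, CoordSpace d) (𝓡∂ (d + 1))
    (e.extend (𝓡∂ (d + 1))).symm (range (𝓡∂ (d + 1))) x
  let Q' : CoordSpace d →L[ℝ] CoordSpace d := mfderivWithin 𝓘(ℝ, CoordSpace d) (𝓡∂ (d + 1))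
    (e'.extend (𝓡∂ (d + 1))).symm (range (𝓡∂ (d + 1))) (chartChange e e' x)
  have hQ : Q = Q'.comp (chartJacobian e e' x) := hD
  change val ((e.extend (𝓡∂ (d + 1))).symm x) (Q u) (Q w) =
    val ((e'.extend (𝓡∂ (d + 1))).symm (chartChange e e' x)) (Q' (chartJacobian e e' x u))
      (Q' (chartJacobian e e' x w))
  rw [hQ, hev x hx]
  rfl

/-- The product rule in the transformation law of the metric. The two terms with second derivatives
of the coordinate change combine, in the Koszul formula, to the inhomogeneous term of the
Christoffel symbols. -/
theorem SymTensor.dBilin_chartChange (g : SymTensor d M)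
    (he : e ∈ IsManifold.maximalAtlas (𝓡∂ (d + 1)) ∞ M)
    (he' : e' ∈ IsManifold.maximalAtlas (𝓡∂ (d + 1)) ∞ M) (hx : x ∈ (chartChange e e').source)
    (h u w : CoordSpace d) :
    g.dBilin e x h u w =
      g.dBilin e' (chartChange e e' x) (chartJacobian e e' x h) (chartJacobian e e' x u)
        (chartJacobian e e' x w) +
      g.bilin e' (chartChange e e' x)
        (fderivWithin ℝ (chartJacobian e e') (halfSpace d) x h u) (chartJacobian e e' x w) +
      g.bilin e' (chartChange e e' x) (chartJacobian e e' x u)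
        (fderivWithin ℝ (chartJacobian e e') (halfSpace d) x h w) := by
  have hH := uniqueDiffOn_halfSpace d x (e.extend_target_subset_range hx.1)
  have hJ := hasFDerivWithinAt_chartJacobian he he' hx
  have hB : HasFDerivWithinAt (fun y => g.bilin e' (chartChange e e' y))
      ((g.dBilin e' (chartChange e e' x)).comp (chartJacobian e e' x)) (halfSpace d) x := by
    have h1 := g.hasFDerivWithinAt_bilin he' (chartChange_mem_target hx)
    have hm : MapsTo (chartChange e e') (halfSpace d) (halfSpace d) := fun z _ => mem_range_self _
    exact HasFDerivWithinAt.comp (g := g.bilin e') (g' := g.dBilin e' (chartChange e e' x)) x h1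
      (hasFDerivWithinAt_chartChange he he' hx) hm
  have h1 := (hB.clm_apply (hJ.clm_apply (hasFDerivWithinAt_const u x _))).clm_apply
    (hJ.clm_apply (hasFDerivWithinAt_const w x _))
  have h2 : HasFDerivWithinAt (fun y => g.inChart e y u w) _ (halfSpace d) x :=
    h1.congr_of_eventuallyEq (by
      filter_upwards [(𝓡∂ (d + 1)).extendCoordChange_source_mem_nhdsWithin hx] with z hz
      exact g.bilin_chartChange he he' hz u w) (g.bilin_chartChange he he' hx u w)
  rw [← g.fderivWithin_inChart he hx.1, h2.fderivWithin hH]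
  simp
  ring

/-- Transformation law of the Christoffel symbols under changes of coordinates. -/
theorem SymTensor.christoffel_chartChange (g : SymTensor d M)
    (he : e ∈ IsManifold.maximalAtlas (𝓡∂ (d + 1)) ∞ M)
    (he' : e' ∈ IsManifold.maximalAtlas (𝓡∂ (d + 1)) ∞ M) (hx : x ∈ (chartChange e e').source)
    (u w : CoordSpace d) :
    g.christoffel e x u u w =
      g.christoffel e' (chartChange e e' x) (chartJacobian e e' x u) (chartJacobian e e' x u)
        (chartJacobian e e' x w) +
      g.bilin e' (chartChange e e' x)
        (fderivWithin ℝ (chartJacobian e e') (halfSpace d) x u u) (chartJacobian e e' x w) := by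
  rw [g.christoffel_eq he hx.1, g.christoffel_eq he' (chartChange_mem_target hx),
    g.dBilin_chartChange he he' hx, g.dBilin_chartChange he he' hx,
    chartJacobian_deriv_symm he he' hx w u,
    g.bilin_symm e' _ (fderivWithin ℝ (chartJacobian e e') (halfSpace d) x u w)]
  ring

/-- A vector killed by the Jacobian is in the kernel of the metric, hence zero; equal dimensions
give surjectivity. It lets every covector test in the new chart be pulled back to the old one. -/
theorem SymTensor.IsMetric.surjective_chartJacobian {g : SymTensor d M} {kind : MetricKind}
    (hg : g.IsMetric kind) (he : e ∈ IsManifold.maximalAtlas (𝓡∂ (d + 1)) ∞ M)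
    (he' : e' ∈ IsManifold.maximalAtlas (𝓡∂ (d + 1)) ∞ M)
    (hx : x ∈ (chartChange e e').source) : Function.Surjective (chartJacobian e e' x) := by
  refine (LinearMap.injective_iff_surjective (f := (chartJacobian e e' x).toLinearMap)).1 ?_
  rw [injective_iff_map_eq_zero]
  intro u hu
  have hu : chartJacobian e e' x u = 0 := hu
  refine (hg.isInvertible_bilin he hx.1).injective ?_
  ext w
  rw [g.bilin_chartChange he he' hx, hu]
  simp

/-- A curve in the domain of a chart which solves the geodesic equation in this chart is a
geodesic. -/
theorem SymTensor.IsMetric.isGeodesic_of_chart {g : SymTensor d M} {kind : MetricKind}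
    (hg : g.IsMetric kind) (he : e ∈ IsManifold.maximalAtlas (𝓡∂ (d + 1)) ∞ M) {T : ℝ}
    {c u a : ℝ → CoordSpace d} (hc : ∀ t ∈ Icc 0 T, c t ∈ (e.extend (𝓡∂ (d + 1))).target)
    (hu : ∀ t ∈ Icc 0 T, HasDerivWithinAt c (u t) (Icc 0 T) t)
    (ha : ∀ t ∈ Icc 0 T, HasDerivWithinAt u (a t) (Icc 0 T) t)
    (heq : ∀ t ∈ Icc 0 T, ∀ w, g.bilin e (c t) (a t) w + g.christoffel e (c t) (u t) (u t) w = 0) :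
    g.IsGeodesic (fun t => (e.extend (𝓡∂ (d + 1))).symm (c t)) T := by
  have hcont : ContinuousOn (fun t => (e.extend (𝓡∂ (d + 1))).symm (c t)) (Icc 0 T) :=
    (e.continuousOn_extend_symm (I := 𝓡∂ (d + 1))).comp
      (fun t ht => (hu t ht).continuousWithinAt) hc
  refine ⟨hcont, fun e' he' t ht hte => ?_⟩
  have hsrc : ∀ᶠ s in 𝓝[Icc 0 T] t, s ∈ Icc 0 T ∧ c s ∈ (chartChange e e').source := by
    filter_upwards [self_mem_nhdsWithin,
      (hcont t ht).preimage_mem_nhdsWithin (e'.open_source.mem_nhds hte)] with s hs hs'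
    refine ⟨hs, hc s hs, ?_⟩
    rw [e'.extend_source]
    exact hs'
  have hxt := (hsrc.self_of_nhdsWithin ht).2
  have hmaps : MapsTo c (Icc 0 T) (halfSpace d) := fun s hs =>
    e.extend_target_subset_range (hc s hs)
  -- The second-derivative part of the transformed acceleration is exactly the inhomogeneous term of
  -- `christoffel_chartChange`.
  refine ⟨fun s => chartJacobian e e' (c s) (u s),
    fderivWithin ℝ (chartJacobian e e') (halfSpace d) (c t) (u t) (u t) +
      chartJacobian e e' (c t) (a t), ?_, ?_, fun w => ?_⟩
  · filter_upwards [hsrc] with s hs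
    exact (hasFDerivWithinAt_chartChange he he' hs.2).comp_hasDerivWithinAt s (hu s hs.1) hmaps
  · exact ((hasFDerivWithinAt_chartJacobian he he' hxt).comp_hasDerivWithinAt t (hu t ht)
      hmaps).clm_apply (ha t ht)
  · obtain ⟨w, rfl⟩ := hg.surjective_chartJacobian he he' hxt w
    have h := heq t ht w
    rw [g.bilin_chartChange he he' hxt, g.christoffel_chartChange he he' hxt] at h
    change g.bilin e' (chartChange e e' (c t)) _ _ + g.christoffel e' (chartChange e e' (c t))
      _ _ _ = 0
    rw [map_add, add_apply]
    linarith

end Geodesic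
end

noncomputable section

/-! ### The geodesic vector field and uniqueness of geodesics -/

section Spray

set_option linter.unusedSectionVars false
set_option maxSynthPendingDepth 3

variable {d : ℕ} {M : Type*} [TopologicalSpace M] [ChartedSpace (EuclideanHalfSpace (d + 1)) M]

/-- The one-form `w ↦ g(∇_u u, w)` of a constant coordinate field `u`. -/
def SymTensor.lowSpray (g : SymTensor d M) (e : BdChart d M) (z : CoordSpace d × CoordSpace d) :
    CoordSpace d →L[ℝ] ℝ :=
  g.dBilin e z.1 z.2 z.2 - (1 / 2 : ℝ) • ((g.dBilin e z.1).flip z.2).flip z.2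

theorem SymTensor.lowSpray_apply (g : SymTensor d M) (e : BdChart d M)
    (z : CoordSpace d × CoordSpace d) (w : CoordSpace d) :
    g.lowSpray e z w = g.dBilin e z.1 z.2 z.2 w - 1 / 2 * g.dBilin e z.1 w z.2 z.2 := rfl

/-- The acceleration `-Γ(u, u)` of geodesics in coordinates. -/
def SymTensor.spray (g : SymTensor d M) (e : BdChart d M) (z : CoordSpace d × CoordSpace d) :
    CoordSpace d :=
  -(g.bilin e z.1).inverse (g.lowSpray e z)

variable {g : SymTensor d M} {kind : MetricKind} {e : BdChart d M} {x u : CoordSpace d}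

theorem SymTensor.christoffel_self (he : e ∈ IsManifold.maximalAtlas (𝓡∂ (d + 1)) ∞ M)
    (hx : x ∈ (e.extend (𝓡∂ (d + 1))).target) (u w : CoordSpace d) :
    g.christoffel e x u u w = g.lowSpray e (x, u) w := by
  rw [g.christoffel_eq he hx, g.lowSpray_apply]
  ring

theorem SymTensor.IsMetric.bilin_spray (hg : g.IsMetric kind)
    (he : e ∈ IsManifold.maximalAtlas (𝓡∂ (d + 1)) ∞ M)
    (hx : x ∈ (e.extend (𝓡∂ (d + 1))).target) (u w : CoordSpace d) :
    g.bilin e x (g.spray e (x, u)) w = -g.lowSpray e (x, u) w := by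
  have h := (hg.isInvertible_bilin he hx).self_apply_inverse (y := g.lowSpray e (x, u))
  rw [SymTensor.spray, map_neg, h]
  rfl

theorem SymTensor.IsMetric.eq_spray (hg : g.IsMetric kind)
    (he : e ∈ IsManifold.maximalAtlas (𝓡∂ (d + 1)) ∞ M)
    (hx : x ∈ (e.extend (𝓡∂ (d + 1))).target) {a : CoordSpace d}
    (ha : ∀ w, g.inChart e x a w + g.christoffel e x u u w = 0) : a = g.spray e (x, u) := by
  refine (hg.isInvertible_bilin he hx).injective ?_
  ext w
  rw [hg.bilin_spray he hx, ← SymTensor.christoffel_self he hx]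
  linarith [ha w, g.bilin_apply e x a w]

theorem SymTensor.contDiffWithinAt_dBilin (g : SymTensor d M)
    (he : e ∈ IsManifold.maximalAtlas (𝓡∂ (d + 1)) ∞ M)
    (hx : x ∈ (e.extend (𝓡∂ (d + 1))).target) :
    ContDiffWithinAt ℝ ∞ (g.dBilin e) (halfSpace d) x :=
  (g.contDiffWithinAt_bilin he hx).fderivWithin_right (m := ∞) (uniqueDiffOn_halfSpace d)
    (by norm_cast) (e.extend_target_subset_range hx)

theorem SymTensor.IsMetric.contDiffWithinAt_spray (hg : g.IsMetric kind)
    (he : e ∈ IsManifold.maximalAtlas (𝓡∂ (d + 1)) ∞ M)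
    (hx : x ∈ (e.extend (𝓡∂ (d + 1))).target) (u : CoordSpace d) :
    ContDiffWithinAt ℝ ∞ (g.spray e) (halfSpace d ×ˢ univ) (x, u) := by
  have hfst : ContDiffWithinAt ℝ ∞ (fun z : CoordSpace d × CoordSpace d => z.1)
      (halfSpace d ×ˢ univ) (x, u) := contDiffWithinAt_fst
  have hsnd : ContDiffWithinAt ℝ ∞ (fun z : CoordSpace d × CoordSpace d => z.2)
      (halfSpace d ×ˢ univ) (x, u) := contDiffWithinAt_snd
  have hm : MapsTo (fun z : CoordSpace d × CoordSpace d => z.1) (halfSpace d ×ˢ univ)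
      (halfSpace d) := fun z hz => hz.1
  have hB : ContDiffWithinAt ℝ ∞ (fun z : CoordSpace d × CoordSpace d => g.bilin e z.1)
      (halfSpace d ×ˢ univ) (x, u) :=
    ContDiffWithinAt.comp (g := g.bilin e) (x, u) (g.contDiffWithinAt_bilin he hx) hfst hm
  have hD : ContDiffWithinAt ℝ ∞ (fun z : CoordSpace d × CoordSpace d => g.dBilin e z.1)
      (halfSpace d ×ˢ univ) (x, u) :=
    ContDiffWithinAt.comp (g := g.dBilin e) (x, u) (g.contDiffWithinAt_dBilin he hx) hfst hm
  have hI : ContDiffWithinAt ℝ ∞ (fun z : CoordSpace d × CoordSpace d => (g.bilin e z.1).inverse)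
      (halfSpace d ×ˢ univ) (x, u) :=
    ContDiffAt.comp_contDiffWithinAt (g := ContinuousLinearMap.inverse) (x, u)
      ((hg.isInvertible_bilin he hx).contDiffAt_map_inverse (n := ∞)) hB
  have hL : ContDiffWithinAt ℝ ∞ (g.lowSpray e) (halfSpace d ×ˢ univ) (x, u) := by
    have hF1 : ContDiff ℝ ∞ (fun D : CoordSpace d →L[ℝ] CoordSpace d →L[ℝ] CoordSpace d →L[ℝ] ℝ =>
        D.flip) := (ContinuousLinearMap.flipₗᵢ ℝ (CoordSpace d) (CoordSpace d)
        (CoordSpace d →L[ℝ] ℝ)).contDiff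
    have hF2 : ContDiff ℝ ∞ (fun D : CoordSpace d →L[ℝ] CoordSpace d →L[ℝ] ℝ =>
        D.flip) := (ContinuousLinearMap.flipₗᵢ ℝ (CoordSpace d) (CoordSpace d) ℝ).contDiff
    have h1 := (hF1.contDiffAt.comp_contDiffWithinAt (x, u) hD).clm_apply hsnd
    have h2 := (hF2.contDiffAt.comp_contDiffWithinAt (x, u) h1).clm_apply hsnd
    exact ((hD.clm_apply hsnd).clm_apply hsnd).sub (h2.const_smul (1 / 2 : ℝ))
  exact (hI.clm_apply hL).neg

theorem eq_smul_add_coordVec (u : CoordSpace d) :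
    u = u 0 • coordVec 1 0 + coordVec 0 (tangPart u) := by
  ext i
  refine Fin.cases ?_ (fun j => ?_) i <;> simp [coordVec, tangPart]

theorem SymTensor.IsBoundaryNormal.bilin_normal (hn : g.IsBoundaryNormal e)
    (hx : x ∈ (e.extend (𝓡∂ (d + 1))).target) (u : CoordSpace d) :
    g.bilin e x u (coordVec 1 0) = u 0 := by
  obtain ⟨h1, h2⟩ := hn.2 x hx
  rw [g.bilin_symm]
  conv_lhs => rw [eq_smul_add_coordVec u]
  rw [map_add, map_smul, g.bilin_apply, g.bilin_apply, h1, h2]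
  simp

/-- Components of the metric containing ∂ₙ are constant in these coordinates, so only derivatives of
tangential components survive in the geodesic equation. -/
theorem SymTensor.IsBoundaryNormal.dBilin_normal (hn : g.IsBoundaryNormal e)
    (hx : x ∈ (e.extend (𝓡∂ (d + 1))).target) (h u : CoordSpace d) :
    g.dBilin e x h u (coordVec 1 0) = 0 := by
  have hH := uniqueDiffOn_halfSpace d x (e.extend_target_subset_range hx)
  rw [← g.fderivWithin_inChart hn.1 hx]
  have h1 : HasFDerivWithinAt (fun y => g.inChart e y u (coordVec 1 0))
      (0 : CoordSpace d →L[ℝ] ℝ) (halfSpace d) x := by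
    refine (hasFDerivWithinAt_const (u 0) x (halfSpace d)).congr_of_eventuallyEq ?_
      (hn.bilin_normal hx u)
    filter_upwards [e.extend_target_mem_nhdsWithin_of_mem hx] with y hy
    exact hn.bilin_normal hy u
  rw [h1.fderivWithin hH]
  rfl

/-- In boundary normal coordinates the normal acceleration of a geodesic is
`½ ∂ₙg(u, u)`. -/
theorem SymTensor.IsBoundaryNormal.spray_normal (hn : g.IsBoundaryNormal e)
    (hg : g.IsMetric kind) (hx : x ∈ (e.extend (𝓡∂ (d + 1))).target) (u : CoordSpace d) :
    g.spray e (x, u) 0 = 1 / 2 * g.dBilin e x (coordVec 1 0) u u := by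
  rw [← hn.bilin_normal hx, hg.bilin_spray hn.1 hx, g.lowSpray_apply, hn.dBilin_normal hx]
  ring

/-- The energy is constant along geodesics. -/
theorem SymTensor.IsMetric.hasDerivWithinAt_energy (hg : g.IsMetric kind)
    (he : e ∈ IsManifold.maximalAtlas (𝓡∂ (d + 1)) ∞ M) {c u : ℝ → CoordSpace d} {s : Set ℝ} {t : ℝ}
    (hm : MapsTo c s (halfSpace d)) (ht : c t ∈ (e.extend (𝓡∂ (d + 1))).target)
    (hc : HasDerivWithinAt c (u t) s t) (hu : HasDerivWithinAt u (g.spray e (c t, u t)) s t) :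
    HasDerivWithinAt (fun r => g.bilin e (c r) (u r) (u r)) 0 s t := by
  have hB : HasDerivWithinAt (fun r => g.bilin e (c r)) (g.dBilin e (c t) (u t)) s t :=
    HasFDerivWithinAt.comp_hasDerivWithinAt (l := g.bilin e) t (g.hasFDerivWithinAt_bilin he ht)
      hc hm
  refine ((hB.clm_apply hu).clm_apply hu).congr_deriv ?_
  rw [add_apply, g.bilin_symm e _ (u t), hg.bilin_spray he ht, g.lowSpray_apply]
  ring

/-- The coordinates of a geodesic solve the geodesic equation. -/
theorem SymTensor.IsGeodesic.hasDerivWithinAt {γ : ℝ → M} {T : ℝ} (hγ : g.IsGeodesic γ T)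
    (hT : 0 < T) (hg : g.IsMetric kind) (he : e ∈ IsManifold.maximalAtlas (𝓡∂ (d + 1)) ∞ M)
    {t : ℝ} (ht : t ∈ Icc 0 T) (hte : γ t ∈ e.source) :
    HasDerivWithinAt (fun r => e.extend (𝓡∂ (d + 1)) (γ r))
      (derivWithin (fun r => e.extend (𝓡∂ (d + 1)) (γ r)) (Icc 0 T) t) (Icc 0 T) t ∧
    HasDerivWithinAt (derivWithin (fun r => e.extend (𝓡∂ (d + 1)) (γ r)) (Icc 0 T))
      (g.spray e (e.extend (𝓡∂ (d + 1)) (γ t),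
        derivWithin (fun r => e.extend (𝓡∂ (d + 1)) (γ r)) (Icc 0 T) t)) (Icc 0 T) t := by
  obtain ⟨u, a, h1, h2, h3⟩ := hγ.2 e he t ht hte
  have hev : ∀ᶠ s in 𝓝[Icc 0 T] t,
      derivWithin (fun r => e.extend (𝓡∂ (d + 1)) (γ r)) (Icc 0 T) s = u s := by
    filter_upwards [h1, self_mem_nhdsWithin] with s hs hs'
    exact hs.derivWithin (uniqueDiffOn_Icc hT s hs')
  have hut := hev.self_of_nhdsWithin ht
  have hxt : e.extend (𝓡∂ (d + 1)) (γ t) ∈ (e.extend (𝓡∂ (d + 1))).target :=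
    (e.extend (𝓡∂ (d + 1))).map_source (by rwa [e.extend_source])
  rw [hut]
  refine ⟨h1.self_of_nhdsWithin ht, ?_⟩
  rw [← hg.eq_spray he hxt h3]
  exact h2.congr_of_eventuallyEq hev hut

/-- Local uniqueness for the geodesic equation in the half-space. -/
theorem SymTensor.IsMetric.eventually_eq_of_spray (hg : g.IsMetric kind)
    (he : e ∈ IsManifold.maximalAtlas (𝓡∂ (d + 1)) ∞ M) {a b : ℝ} (hab : a < b)
    {c u c' u' : ℝ → CoordSpace d}
    (hca : c a ∈ (e.extend (𝓡∂ (d + 1))).target)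
    (hc : ∀ t ∈ Icc a b, c t ∈ halfSpace d ∧ HasDerivWithinAt c (u t) (Icc a b) t ∧
      HasDerivWithinAt u (g.spray e (c t, u t)) (Icc a b) t)
    (hc' : ∀ t ∈ Icc a b, c' t ∈ halfSpace d ∧ HasDerivWithinAt c' (u' t) (Icc a b) t ∧
      HasDerivWithinAt u' (g.spray e (c' t, u' t)) (Icc a b) t)
    (h0 : c' a = c a) (h0' : u' a = u a) :
    ∃ b' ∈ Ioc a b, ∀ t ∈ Icc a b', c' t = c t ∧ u' t = u t := by
  have hconv : Convex ℝ (halfSpace d ×ˢ (univ : Set (CoordSpace d))) := by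
    have : Convex ℝ (halfSpace d) := by
      rw [halfSpace, range_modelWithCornersEuclideanHalfSpace]
      exact (convex_Ici (0 : ℝ)).is_linear_preimage (f := fun y : CoordSpace d => y 0)
        ⟨fun _ _ => rfl, fun _ _ => rfl⟩
    exact this.prod convex_univ
  -- A C¹ field on a convex set is locally Lipschitz within that set, boundary points included; this
  -- is enough for uniqueness forward in time.
  have hS : ContDiffWithinAt ℝ 1 (fun z => (z.2, g.spray e z)) (halfSpace d ×ˢ univ) (c a, u a) :=
    contDiffWithinAt_snd.prodMk ((hg.contDiffWithinAt_spray he hca (u a)).of_le (by norm_cast))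
  obtain ⟨K, s, hs, hK⟩ := hS.exists_lipschitzOnWith hconv
  have hmem : ∀ (c u : ℝ → CoordSpace d), (∀ t ∈ Icc a b, c t ∈ halfSpace d ∧
      HasDerivWithinAt c (u t) (Icc a b) t ∧
      HasDerivWithinAt u (g.spray e (c t, u t)) (Icc a b) t) →
      s ∈ 𝓝[halfSpace d ×ˢ univ] (c a, u a) → ∀ᶠ t in 𝓝[Icc a b] a, (c t, u t) ∈ s := by
    intro c u hc hs
    have ha : a ∈ Icc a b := ⟨le_rfl, hab.le⟩
    have hcont : ContinuousWithinAt (fun t => (c t, u t)) (Icc a b) a :=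
      (hc a ha).2.1.continuousWithinAt.prodMk (hc a ha).2.2.continuousWithinAt
    have := tendsto_nhdsWithin_of_tendsto_nhds_of_eventually_within _ hcont
      (s := halfSpace d ×ˢ univ) (by
        filter_upwards [self_mem_nhdsWithin] with t ht using ⟨(hc t ht).1, mem_univ _⟩)
    exact this hs
  have hev := (hmem c u hc hs).and (hmem c' u' hc' (by rwa [h0, h0']))
  rw [nhdsWithin_Icc_eq_nhdsGE hab] at hev
  obtain ⟨b', hb', hsub⟩ := (mem_nhdsGE_iff_exists_mem_Ioc_Ico_subset hab).1 hev
  obtain ⟨b'', hb''⟩ := exists_between hb'.1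
  have hle : b'' ≤ b := hb''.2.le.trans hb'.2
  refine ⟨b'', ⟨hb''.1, hle⟩, fun t ht => ?_⟩
  have hder : ∀ (c u : ℝ → CoordSpace d), (∀ t ∈ Icc a b, c t ∈ halfSpace d ∧
      HasDerivWithinAt c (u t) (Icc a b) t ∧
      HasDerivWithinAt u (g.spray e (c t, u t)) (Icc a b) t) →
      ContinuousOn (fun t => (c t, u t)) (Icc a b'') ∧
      ∀ t ∈ Ico a b'', HasDerivWithinAt (fun t => (c t, u t)) (u t, g.spray e (c t, u t))
        (Ici t) t := by
    intro c u hc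
    refine ⟨fun t ht => ?_, fun t ht => ?_⟩
    · have hc := hc t ⟨ht.1, ht.2.trans hle⟩
      exact (hc.2.1.continuousWithinAt.prodMk hc.2.2.continuousWithinAt).mono
        (Icc_subset_Icc_right hle)
    · have hc := hc t ⟨ht.1, ht.2.le.trans hle⟩
      exact (hc.2.1.prodMk hc.2.2).mono_of_mem_nhdsWithin (Icc_mem_nhdsGE_of_mem
        ⟨ht.1, ht.2.trans_le hle⟩)
  have h1 := hder c u hc
  have h2 := hder c' u' hc'
  have hin : ∀ t ∈ Ico a b'', (c t, u t) ∈ s ∧ (c' t, u' t) ∈ s := fun t ht =>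
    hsub ⟨ht.1, ht.2.trans hb''.2⟩
  have := ODE_solution_unique_of_mem_Icc_right (v := fun _ z => (z.2, g.spray e z))
    (s := fun _ => s) (K := K) (fun t _ => hK) h2.1 h2.2 (fun t ht => (hin t ht).2) h1.1 h1.2
    (fun t ht => (hin t ht).1) (by simp [h0, h0']) ht
  exact ⟨congrArg Prod.fst this, congrArg Prod.snd this⟩

end Spray
end

noncomputable section

/-! ### Exit of geodesics through the boundary -/

section Exit

set_option linter.unusedSectionVars false

variable {d : ℕ} {M : Type*} [TopologicalSpace M] [ChartedSpace (EuclideanHalfSpace (d + 1)) M]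

theorem coordVec_zero_tangPart {x : CoordSpace d} (hx : x 0 = 0) : coordVec 0 (tangPart x) = x := by
  ext i
  refine Fin.cases ?_ (fun j => ?_) i <;> simp [coordVec, tangPart, hx]

@[simp]
theorem tangPart_coordVec (a : ℝ) (u : Fin d → ℝ) : tangPart (coordVec a u) = u := by
  ext i; simp [coordVec, tangPart]

@[simp]
theorem coordVec_apply_zero (a : ℝ) (u : Fin d → ℝ) : coordVec a u 0 = a := by simp [coordVec]

/-- `(c, u)` solves the geodesic equation on `[0, T]` in the chart `e`. -/
def SymTensor.IsChartGeodesic (g : SymTensor d M) (e : BdChart d M) (c u : ℝ → CoordSpace d)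
    (T : ℝ) : Prop :=
  ∀ t ∈ Icc 0 T, c t ∈ (e.extend (𝓡∂ (d + 1))).target ∧ HasDerivWithinAt c (u t) (Icc 0 T) t ∧
    HasDerivWithinAt u (g.spray e (c t, u t)) (Icc 0 T) t

variable {g : SymTensor d M} {kind : MetricKind} {e : BdChart d M} {c u : ℝ → CoordSpace d} {T : ℝ}

theorem SymTensor.IsChartGeodesic.isGeodesic (h : g.IsChartGeodesic e c u T)
    (hg : g.IsMetric kind) (he : e ∈ IsManifold.maximalAtlas (𝓡∂ (d + 1)) ∞ M) :
    g.IsGeodesic (fun t => (e.extend (𝓡∂ (d + 1))).symm (c t)) T := by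
  refine hg.isGeodesic_of_chart he (fun t ht => (h t ht).1) (fun t ht => (h t ht).2.1)
    (fun t ht => (h t ht).2.2) (fun t ht w => ?_)
  rw [hg.bilin_spray he (h t ht).1, SymTensor.christoffel_self he (h t ht).1]
  ring

/-- A geodesic of `M` agrees with a geodesic in the chart `e` with the same initial data, as long
as the latter exists. -/
theorem SymTensor.IsChartGeodesic.eq_geodesic [T2Space M] (h : g.IsChartGeodesic e c u T)
    (hg : g.IsMetric kind) (he : e ∈ IsManifold.maximalAtlas (𝓡∂ (d + 1)) ∞ M) (hT : 0 < T)
    {γ : ℝ → M} {T' : ℝ} (hTT' : T ≤ T') (hγ : g.IsGeodesic γ T')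
    (h0 : γ 0 = (e.extend (𝓡∂ (d + 1))).symm (c 0))
    (h0' : derivWithin (fun r => e.extend (𝓡∂ (d + 1)) (γ r)) (Icc 0 T') 0 = u 0) :
    ∀ t ∈ Icc 0 T, γ t = (e.extend (𝓡∂ (d + 1))).symm (c t) ∧
      derivWithin (fun r => e.extend (𝓡∂ (d + 1)) (γ r)) (Icc 0 T') t = u t := by
  set u' := derivWithin (fun r => e.extend (𝓡∂ (d + 1)) (γ r)) (Icc 0 T') with hu'
  have hsub : Icc 0 T ⊆ Icc 0 T' := Icc_subset_Icc_right hTT'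
  have hsrc : ∀ t ∈ Icc 0 T, (e.extend (𝓡∂ (d + 1))).symm (c t) ∈ e.source := fun t ht => by
    rw [← e.extend_source (I := 𝓡∂ (d + 1))]
    exact (e.extend (𝓡∂ (d + 1))).map_target (h t ht).1
  have hcont := (h.isGeodesic hg he).1
  -- Open-closed argument. The points coincide on a closed set since M is Hausdorff; on that set
  -- both velocities in the chart are continuous, so coincidence of position and velocity is closed
  -- too.
  have hK : IsClosed (Icc 0 T ∩ {t | γ t = (e.extend (𝓡∂ (d + 1))).symm (c t)}) :=
    ((hγ.1.mono hsub).prodMk hcont).preimage_isClosed_of_isClosed isClosed_Icc isClosed_diagonal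
  refine IsClosed.Icc_subset_of_forall_exists_gt
    (s := {t | γ t = (e.extend (𝓡∂ (d + 1))).symm (c t) ∧ u' t = u t}) ?_ ⟨h0, h0'⟩ ?_
  · have h1 : ContinuousOn u' (Icc 0 T ∩ {t | γ t = (e.extend (𝓡∂ (d + 1))).symm (c t)}) := by
      intro t ht
      have hte : γ t ∈ e.source := by rw [ht.2]; exact hsrc t ht.1
      exact (hγ.hasDerivWithinAt (hT.trans_le hTT') hg he (hsub ht.1) hte).2.continuousWithinAt.mono
        (inter_subset_left.trans hsub)
    have h2 : ContinuousOn u (Icc 0 T ∩ {t | γ t = (e.extend (𝓡∂ (d + 1))).symm (c t)}) :=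
      fun t ht => (h t ht.1).2.2.continuousWithinAt.mono inter_subset_left
    have h3 := (h1.prodMk h2).preimage_isClosed_of_isClosed hK isClosed_diagonal
    convert h3 using 1
    ext t
    simp only [mem_inter_iff, mem_ofPred_eq, mem_preimage, mem_diagonal_iff]
    tauto
  -- After a time of coincidence both curves remain in the chart for a while and solve the same
  -- equation, so local uniqueness carries the coincidence further.
  · rintro t ⟨⟨ht1, ht2⟩, ht⟩ y hy
    have htT : t ∈ Icc 0 T := ⟨ht.1, ht.2.le⟩
    have hte : γ t ∈ e.source := by rw [ht1]; exact hsrc t htT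
    have hev : ∀ᶠ s in 𝓝[≥] t, s ≤ T ∧ γ s ∈ e.source := by
      have h1 : 𝓝[Icc t T] t ≤ 𝓝[Icc 0 T'] t :=
        nhdsWithin_mono _ ((Icc_subset_Icc_left ht.1).trans hsub)
      have h2 := h1 ((hγ.1 t (hsub htT)).preimage_mem_nhdsWithin (e.open_source.mem_nhds hte))
      have h3 : ∀ᶠ s in 𝓝[Icc t T] t, s ≤ T ∧ γ s ∈ e.source := by
        filter_upwards [h2, self_mem_nhdsWithin] with s hs hs' using ⟨hs'.2, hs⟩
      rwa [nhdsWithin_Icc_eq_nhdsGE ht.2] at h3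
    obtain ⟨b₁, hb₁, hb₁'⟩ := (mem_nhdsGE_iff_exists_mem_Ioc_Ico_subset ht.2).1 hev
    obtain ⟨b, hb⟩ := exists_between hb₁.1
    have hbT : b ≤ T := hb.2.le.trans hb₁.2
    have hs1 : Icc t b ⊆ Icc 0 T := Icc_subset_Icc ht.1 hbT
    have hbe : ∀ s ∈ Icc t b, γ s ∈ e.source := fun s hs =>
      (hb₁' ⟨hs.1, hs.2.trans_lt hb.2⟩).2
    obtain ⟨b', hb', hag⟩ := hg.eventually_eq_of_spray he hb.1 (c := c) (u := u)
      (c' := fun r => e.extend (𝓡∂ (d + 1)) (γ r)) (u' := u') (h t htT).1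
      (fun s hs => ⟨e.extend_target_subset_range (h s (hs1 hs)).1,
        (h s (hs1 hs)).2.1.mono hs1, (h s (hs1 hs)).2.2.mono hs1⟩)
      (fun s hs => by
        have h1 := hγ.hasDerivWithinAt (hT.trans_le hTT') hg he (hsub (hs1 hs)) (hbe s hs)
        exact ⟨mem_range_self _, h1.1.mono (hs1.trans hsub), h1.2.mono (hs1.trans hsub)⟩)
      (by
        change e.extend (𝓡∂ (d + 1)) (γ t) = c t
        rw [ht1, (e.extend (𝓡∂ (d + 1))).right_inv (h t htT).1]) ht2
    have hs : min b' y ∈ Icc t b' := ⟨le_min hb'.1.le hy.le, min_le_left _ _⟩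
    refine ⟨min b' y, ⟨?_, (hag _ hs).2⟩, lt_min hb'.1 hy, min_le_right _ _⟩
    rw [← (hag _ hs).1, (e.extend (𝓡∂ (d + 1))).left_inv]
    rw [e.extend_source]
    exact hbe _ ⟨hs.1, hs.2.trans hb'.2⟩

/-- A geodesic in the chart `e` which hits the boundary transversally exits there, and the exit
data are unique. -/
theorem SymTensor.IsChartGeodesic.exitsAt [T2Space M] (h : g.IsChartGeodesic e c u T)
    (hg : g.IsMetric kind) (he : e ∈ IsManifold.maximalAtlas (𝓡∂ (d + 1)) ∞ M) (hT : 0 < T)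
    {x : Fin d → ℝ} (hx : c 0 = coordVec 0 x) (hcT : c T 0 = 0) (huT : u T 0 < 0) :
    g.ExitsAt e x (u 0) T (tangPart (c T)) (u T) ∧
    ∀ T' y w, g.ExitsAt e x (u 0) T' y w → T' = T ∧ y = tangPart (c T) ∧ w = u T := by
  have h0T : (0 : ℝ) ∈ Icc 0 T := ⟨le_rfl, hT.le⟩
  have hTT : T ∈ Icc 0 T := ⟨hT.le, le_rfl⟩
  have hright : EqOn (fun r => e.extend (𝓡∂ (d + 1)) ((e.extend (𝓡∂ (d + 1))).symm (c r))) c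
      (Icc 0 T) := fun r hr => (e.extend (𝓡∂ (d + 1))).right_inv (h r hr).1
  have hfrom : g.IsGeodesicFrom e x (u 0) (fun t => (e.extend (𝓡∂ (d + 1))).symm (c t)) T := by
    refine ⟨h.isGeodesic hg he, hx ▸ (h 0 h0T).1, by simp only [hx], ?_⟩
    exact (h 0 h0T).2.1.congr hright (hright h0T)
  have huniq : ∀ (γ : ℝ → M) (T' : ℝ), T ≤ T' → g.IsGeodesicFrom e x (u 0) γ T' →
      γ T = (e.extend (𝓡∂ (d + 1))).symm (c T) ∧
      HasDerivWithinAt (fun r => e.extend (𝓡∂ (d + 1)) (γ r)) (u T) (Icc 0 T') T := by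
    intro γ T' hTT' hγ
    have h1 := h.eq_geodesic hg he hT hTT' hγ.1 (hx ▸ hγ.2.2.1)
      (hγ.2.2.2.derivWithin (uniqueDiffOn_Icc (hT.trans_le hTT') 0 ⟨le_rfl, hT.le.trans hTT'⟩))
      T hTT
    refine ⟨h1.1, ?_⟩
    have hte : γ T ∈ e.source := by
      rw [h1.1, ← e.extend_source (I := 𝓡∂ (d + 1))]
      exact (e.extend (𝓡∂ (d + 1))).map_target (h T hTT).1
    have h2 := (hγ.1.hasDerivWithinAt (hT.trans_le hTT') hg he ⟨hT.le, hTT'⟩ hte).1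
    rwa [h1.2] at h2
  -- A longer geodesic would agree with this one up to T. Its normal coordinate would vanish there
  -- with negative slope and become negative at once, which the range of the chart forbids.
  have hmax : ∀ T' > T, ¬ ∃ γ : ℝ → M, g.IsGeodesicFrom e x (u 0) γ T' := by
    rintro T' hT' ⟨γ, hγ⟩
    obtain ⟨h1, h2⟩ := huniq γ T' hT'.le hγ
    have h3 : HasDerivWithinAt (fun r => e.extend (𝓡∂ (d + 1)) (γ r) 0) (u T 0) (Ici T) T := by
      have := (EuclideanSpace.proj (𝕜 := ℝ) (0 : Fin (d + 1))).hasFDerivAt.comp_hasDerivWithinAt T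
        (h2.mono_of_mem_nhdsWithin (s := Ici T) (Icc_mem_nhdsGE_of_mem ⟨hT.le, hT'⟩))
      exact this
    have hval : e.extend (𝓡∂ (d + 1)) (γ T) 0 = 0 := by
      rw [h1, (e.extend (𝓡∂ (d + 1))).right_inv (h T hTT).1, hcT]
    have h4 := (hasDerivWithinAt_iff_tendsto_slope' (s := Ioi T) (by simp)).1
      (h3.mono Ioi_subset_Ici_self)
    have h5 := h4.eventually (gt_mem_nhds huT)
    obtain ⟨s, hs, hsT⟩ := (h5.and self_mem_nhdsWithin).exists
    rw [slope_def_field, hval, sub_zero, div_neg_iff] at hs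
    have h6 : 0 ≤ e.extend (𝓡∂ (d + 1)) (γ s) 0 := mem_halfSpace.1 (mem_range_self _)
    have h7 : 0 < s - T := sub_pos.2 hsT
    rcases hs with hs | hs <;> linarith [hs.1, hs.2]
  refine ⟨⟨hT, ⟨_, hfrom, ?_, ?_, ?_⟩, hmax⟩, ?_⟩
  · rw [← e.extend_source (I := 𝓡∂ (d + 1))]
    exact (e.extend (𝓡∂ (d + 1))).map_target (h T hTT).1
  · rw [coordVec_zero_tangPart hcT]
    exact hright hTT
  · exact (h T hTT).2.1.congr hright (hright hTT)
  · rintro T' y w ⟨hT', ⟨γ, hγ, hγe, hγy, hγw⟩, hmax'⟩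
    have hTT' : T' = T := by
      rcases lt_trichotomy T' T with hlt | heq | hgt
      · exact (hmax' T hlt ⟨_, hfrom⟩).elim
      · exact heq
      · exact (hmax T' hgt ⟨_, hγ⟩).elim
    subst hTT'
    obtain ⟨h1, h2⟩ := huniq γ T' le_rfl hγ
    refine ⟨rfl, ?_, ?_⟩
    · rw [h1, (e.extend (𝓡∂ (d + 1))).right_inv (h T' hTT).1] at hγy
      rw [hγy, tangPart_coordVec]
    · exact (uniqueDiffOn_Icc hT T' hTT).eq_deriv _ hγw h2

end Exit

/-- A function on `[0, T]` with `φ 0 = 0`, positive slope at `0` and second derivative bounded above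
by a negative constant has exactly one further zero, and crosses it transversally. -/
theorem exists_exit_of_concave {φ ψ χ : ℝ → ℝ} {T k ε : ℝ} (hT : 0 < T) (hk : k < 0) (hε : 0 < ε)
    (hεT : 2 * ε < -k * T) (hφ : ∀ t ∈ Icc 0 T, HasDerivAt φ (ψ t) t)
    (hψ : ∀ t ∈ Icc 0 T, HasDerivAt ψ (χ t) t) (hχ : ∀ t ∈ Icc 0 T, χ t ≤ k) (h0 : φ 0 = 0)
    (h0' : ψ 0 = ε) :
    ∃ τ ∈ Ioo 0 T, φ τ = 0 ∧ ψ τ < 0 ∧ (∀ t ∈ Ioo 0 τ, 0 < φ t) ∧ (∀ t ∈ Ioc τ T, φ t < 0) ∧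
      τ * -k ≤ 2 * ε := by
  have hanti : StrictAntiOn ψ (Icc 0 T) := by
    refine strictAntiOn_of_deriv_neg (convex_Icc 0 T)
      (fun t ht => (hψ t ht).continuousAt.continuousWithinAt) fun t ht => ?_
    rw [interior_Icc] at ht
    rw [(hψ t (Ioo_subset_Icc_self ht)).deriv]
    exact (hχ t (Ioo_subset_Icc_self ht)).trans_lt hk
  have hconc : StrictConcaveOn ℝ (Icc 0 T) φ := by
    refine StrictAntiOn.strictConcaveOn_of_deriv (convex_Icc 0 T)
      (fun t ht => (hφ t ht).continuousAt.continuousWithinAt) ?_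
    rw [interior_Icc]
    intro a ha b hb hab
    rw [(hφ a (Ioo_subset_Icc_self ha)).deriv, (hφ b (Ioo_subset_Icc_self hb)).deriv]
    exact hanti (Ioo_subset_Icc_self ha) (Ioo_subset_Icc_self hb) hab
  -- Comparison with constant acceleration k. The resulting parabola is negative at T by `hεT`,
  -- which forces a return to 0, and at the return time it gives the bound τ(-k) ≤ 2ε.
  have hψle : ∀ t ∈ Icc 0 T, ψ t ≤ ε + k * t := by
    intro t ht
    have := image_le_of_deriv_right_le_deriv_boundary (f := ψ) (f' := χ) (a := 0) (b := T)
      (B := fun t => ε + k * t) (B' := fun _ => k)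
      (fun t ht => (hψ t ht).continuousAt.continuousWithinAt)
      (fun t ht => (hψ t (Ico_subset_Icc_self ht)).hasDerivWithinAt) (by simp [h0'])
      (by fun_prop)
      (fun t _ => by
        have h1 : HasDerivAt (fun t : ℝ => ε + k * t) (k * 1) t :=
          ((hasDerivAt_id t).const_mul k).const_add ε
        rw [mul_one] at h1
        exact h1.hasDerivWithinAt)
      (fun t ht => hχ t (Ico_subset_Icc_self ht))
    exact this ht
  have hφle : ∀ t ∈ Icc 0 T, φ t ≤ ε * t + k / 2 * t ^ 2 := by
    intro t ht
    have := image_le_of_deriv_right_le_deriv_boundary (f := φ) (f' := ψ) (a := 0) (b := T)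
      (B := fun t => ε * t + k / 2 * t ^ 2) (B' := fun t => ε + k * t)
      (fun t ht => (hφ t ht).continuousAt.continuousWithinAt)
      (fun t ht => (hφ t (Ico_subset_Icc_self ht)).hasDerivWithinAt) (by simp [h0])
      (by fun_prop)
      (fun t _ => by
        have h1 : HasDerivAt (fun t : ℝ => ε * t + k / 2 * t ^ 2) (ε * 1 + k / 2 * (2 * t)) t := by
          refine (((hasDerivAt_id t).const_mul ε).add
            ((hasDerivAt_pow 2 t).const_mul (k / 2))).congr_deriv ?_
          simp
        refine (h1.congr_deriv ?_).hasDerivWithinAt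
        ring)
      (fun t ht => hψle t (Ico_subset_Icc_self ht))
    exact this ht
  have hφT : φ T < 0 := by
    have := hφle T ⟨hT.le, le_rfl⟩
    nlinarith
  have h0T : (0 : ℝ) ∈ Icc 0 T := ⟨le_rfl, hT.le⟩
  obtain ⟨s, hs, hspos⟩ : ∃ s ∈ Ioo 0 T, 0 < φ s := by
    have h1 := (hasDerivWithinAt_iff_tendsto_slope' (s := Ioi 0) (by simp)).1
      (hφ 0 h0T).hasDerivWithinAt
    have h2 := h1.eventually (lt_mem_nhds (h0'.symm ▸ hε : 0 < ψ 0))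
    have h3 : ∀ᶠ s in 𝓝[>] (0 : ℝ), s ∈ Ioo 0 T := Ioo_mem_nhdsGT hT
    obtain ⟨s, hs, hsT⟩ := (h2.and h3).exists
    refine ⟨s, hsT, ?_⟩
    rw [slope_def_field, h0, sub_zero, sub_zero] at hs
    exact (div_pos_iff_of_pos_right hsT.1).1 hs
  obtain ⟨τ, hτ, hτ0⟩ : ∃ τ ∈ Ioo s T, φ τ = 0 :=
    intermediate_value_Ioo' hs.2.le (fun t ht =>
      (hφ t ⟨hs.1.le.trans ht.1, ht.2⟩).continuousAt.continuousWithinAt) ⟨hφT, hspos⟩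
  have hτT : τ ∈ Ioo 0 T := ⟨hs.1.trans hτ.1, hτ.2⟩
  have hτI := Ioo_subset_Icc_self hτT
  have hpos : ∀ t ∈ Ioo 0 τ, 0 < φ t := by
    intro t ht
    have := hconc.lt_on_openSegment h0T hτI hτT.1.ne (by rwa [openSegment_eq_Ioo hτT.1])
    rwa [h0, hτ0, min_self] at this
  refine ⟨τ, hτT, hτ0, ?_, hpos, fun t ht => ?_, ?_⟩
  -- Rolle gives a zero of ψ before τ; strict decrease of ψ then makes the crossing transversal.
  · obtain ⟨ξ, hξ, hξ0⟩ := exists_hasDerivAt_eq_zero hτT.1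
      (fun t ht => (hφ t ⟨ht.1, ht.2.trans hτI.2⟩).continuousAt.continuousWithinAt)
      (h0.trans hτ0.symm) (fun t ht => hφ t ⟨ht.1.le, ht.2.le.trans hτI.2⟩)
    rw [← hξ0]
    exact hanti ⟨hξ.1.le, hξ.2.le.trans hτI.2⟩ hτI hξ.2
  · by_contra! hneg
    have htI : t ∈ Icc 0 T := ⟨hτT.1.le.trans ht.1.le, ht.2⟩
    have := hconc.lt_on_openSegment h0T htI (hτT.1.trans ht.1).ne
      (by rw [openSegment_eq_Ioo (hτT.1.trans ht.1)]; exact ⟨hτT.1, ht.1⟩)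
    rw [h0, hτ0, min_eq_left hneg] at this
    exact lt_irrefl _ this
  · have h1 := hφle τ hτI
    rw [hτ0] at h1
    have h2 : 0 ≤ τ * (ε + k / 2 * τ) := by nlinarith
    have h3 := nonneg_of_mul_nonneg_right h2 hτT.1
    nlinarith

end

noncomputable section

/-! ### The family of geodesics with initial velocities `v_ε` -/

section Variation

variable {E : Type*} [NormedAddCommGroup E] [NormedSpace ℝ E]

/-- The first-order approximation is uniform in t, so it may be evaluated at a time moving
continuously with the parameter; the change of J along the way is of lower order. -/
theorem hasDerivAt_variation_comp {Y : ℝ → ℝ → E} {J : ℝ → E} {T ε₀ : ℝ} {τ : ℝ → ℝ}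
    (hτ : ContinuousAt τ ε₀) (hτT : τ ε₀ ∈ Ioo 0 T) (hJ : ContinuousAt J (τ ε₀))
    (hvar : ∀ η > 0, ∀ᶠ ε in 𝓝 ε₀, ∀ t ∈ Icc 0 T,
      ‖Y ε t - Y ε₀ t - (ε - ε₀) • J t‖ ≤ η * |ε - ε₀|) :
    HasDerivAt (fun ε => Y ε (τ ε) - Y ε₀ (τ ε)) (J (τ ε₀)) ε₀ := by
  rw [hasDerivAt_iff_isLittleO, isLittleO_iff]
  intro η hη
  have h1 : ∀ᶠ ε in 𝓝 ε₀, ‖J (τ ε) - J (τ ε₀)‖ < η / 2 := by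
    have := (hJ.comp hτ).eventually (Metric.ball_mem_nhds _ (half_pos hη))
    simpa [dist_eq_norm] using this
  filter_upwards [hvar _ (half_pos hη), h1, hτ.eventually (Ioo_mem_nhds hτT.1 hτT.2)]
    with ε h1 h2 h3
  have h4 : (Y ε (τ ε) - Y ε₀ (τ ε) - (Y ε₀ (τ ε₀) - Y ε₀ (τ ε₀)) - (ε - ε₀) • J (τ ε₀)) =
      (Y ε (τ ε) - Y ε₀ (τ ε) - (ε - ε₀) • J (τ ε)) + (ε - ε₀) • (J (τ ε) - J (τ ε₀)) := by
    rw [smul_sub]; abel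
  rw [h4, Real.norm_eq_abs]
  refine (norm_add_le _ _).trans ?_
  rw [norm_smul, Real.norm_eq_abs]
  have := h1 _ (Ioo_subset_Icc_self h3)
  nlinarith [abs_nonneg (ε - ε₀), mul_le_mul_of_nonneg_left h2.le (abs_nonneg (ε - ε₀))]

end Variation

section Family

set_option linter.unusedSectionVars false

variable {d : ℕ} {M : Type*} [TopologicalSpace M] [ChartedSpace (EuclideanHalfSpace (d + 1)) M]

theorem coordVec_smul (a s : ℝ) (w : Fin d → ℝ) :
    coordVec a (s • w) = a • coordVec 1 0 + s • coordVec 0 w := by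
  ext i
  refine Fin.cases ?_ (fun j => ?_) i <;> simp [coordVec]

theorem MetricKind.sign_mul_self (kind : MetricKind) : kind.sign * kind.sign = 1 := by
  cases kind <;> simp [MetricKind.sign]

theorem MetricKind.one_sub_pos (kind : MetricKind) {ε : ℝ} (h0 : 0 ≤ ε) (h1 : ε < 1) :
    0 < 1 - kind.sign * ε ^ 2 := by
  cases kind <;> simp only [MetricKind.sign] <;> nlinarith

theorem exists_hasDerivAt_tiltedDir (kind : MetricKind) (v : Fin d → ℝ) {ε : ℝ} (h0 : 0 ≤ ε)
    (h1 : ε < 1) : ∃ w, HasDerivAt (tiltedDir kind v) w ε := by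
  have hs : HasDerivAt (fun ε : ℝ => 1 - kind.sign * ε ^ 2) (-(kind.sign * (2 * ε))) ε := by
    refine (((hasDerivAt_pow 2 ε).const_mul kind.sign).const_sub 1).congr_deriv ?_
    simp
  have h2 := hs.sqrt (kind.one_sub_pos h0 h1).ne'
  have h3 := ((hasDerivAt_id ε).smul_const (coordVec 1 (0 : Fin d → ℝ))).add
    (h2.smul_const (coordVec 0 v))
  refine ⟨_, h3.congr_of_eventuallyEq (Eventually.of_forall fun r => ?_)⟩
  rw [tiltedDir, coordVec_smul]
  rfl

theorem tiltedDir_zero (kind : MetricKind) (v : Fin d → ℝ) : tiltedDir kind v 0 = coordVec 0 v := by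
  simp [tiltedDir]

/-- The geodesics with initial velocities `v_ε` up to their exit times `τ ε`, in the chart `e`,
together with their variation fields. -/
structure ExitFamily (g : SymTensor d M) (e : BdChart d M) (kind : MetricKind)
    (x v : Fin d → ℝ) where
  δ : ℝ
  T : ℝ
  C : Set (CoordSpace d × CoordSpace d)
  τ : ℝ → ℝ
  X : ℝ → ℝ → CoordSpace d × CoordSpace d
  bound : ℝ
  δ_pos : 0 < δ
  δ_le : δ ≤ 1
  isCompact : IsCompact C
  subset_target : ∀ z ∈ C, z.1 ∈ (e.extend (𝓡∂ (d + 1))).target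
  τ_mem : ∀ ε ∈ Ioo 0 δ, τ ε ∈ Ioo 0 T
  τ_le : ∀ ε ∈ Ioo 0 δ, τ ε ≤ bound * ε
  mem : ∀ ε ∈ Ioo 0 δ, ∀ t ∈ Icc 0 (τ ε), X ε t ∈ C
  zero : ∀ ε ∈ Ioo 0 δ, X ε 0 = (coordVec 0 x, tiltedDir kind v ε)
  -- The curves continue past their exit, up to the common time T, by an extension of the geodesic
  -- field. The true geodesic equation is recorded only up to `τ ε`, whereas the variation field is
  -- available on [0, T], a neighbourhood of the exit time.
  deriv_fst : ∀ ε ∈ Ioo 0 δ, ∀ t ∈ Icc 0 T, HasDerivAt (fun r => (X ε r).1) (X ε t).2 t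
  deriv_snd : ∀ ε ∈ Ioo 0 δ, ∀ t ∈ Icc 0 (τ ε),
    HasDerivAt (fun r => (X ε r).2) (g.spray e (X ε t)) t
  pos : ∀ ε ∈ Ioo 0 δ, ∀ t ∈ Ioo 0 (τ ε), 0 < (X ε t).1 0
  neg : ∀ ε ∈ Ioo 0 δ, ∀ t ∈ Ioc (τ ε) T, (X ε t).1 0 < 0
  exit : ∀ ε ∈ Ioo 0 δ, (X ε (τ ε)).1 0 = 0
  exit_neg : ∀ ε ∈ Ioo 0 δ, (X ε (τ ε)).2 0 < 0
  variation : ∀ ε₀ ∈ Ioo 0 δ, ∃ J : ℝ → CoordSpace d × CoordSpace d, (J 0).1 = 0 ∧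
    ContinuousOn J (Icc 0 T) ∧
    (∀ t ∈ Icc 0 T, HasDerivWithinAt (fun r => (J r).1) (J t).2 (Icc 0 T) t) ∧
    ∀ η > 0, ∀ᶠ ε in 𝓝 ε₀, ∀ t ∈ Icc 0 T, ‖X ε t - X ε₀ t - (ε - ε₀) • J t‖ ≤ η * |ε - ε₀|

variable {g : SymTensor d M} {kind : MetricKind} {e : BdChart d M} {x v : Fin d → ℝ}

/-- The flow must be differentiated at initial points on the boundary and across the exit, so the
field has to be defined on both sides of the boundary; C¹ regularity is enough. -/
theorem SymTensor.IsMetric.exists_spray_extension (hg : g.IsMetric kind)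
    (he : e ∈ IsManifold.maximalAtlas (𝓡∂ (d + 1)) ∞ M)
    (hx : coordVec 0 x ∈ (e.extend (𝓡∂ (d + 1))).target) (u : CoordSpace d) :
    ∃ A : CoordSpace d × CoordSpace d → CoordSpace d, ContDiffAt ℝ 1 A (coordVec 0 x, u) ∧
      ∀ z, 0 ≤ z.1 0 → A z = g.spray e z := by
  obtain ⟨V, hV, hVt⟩ := exists_open_inter_halfSpace e
  have hxV : coordVec 0 x ∈ V := by rw [hVt] at hx; exact hx.1
  have hl : ∀ z : CoordSpace d × CoordSpace d,
      ((EuclideanSpace.proj (𝕜 := ℝ) (0 : Fin (d + 1))).comp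
        (ContinuousLinearMap.fst ℝ (CoordSpace d) (CoordSpace d))) z = z.1 0 := fun z => rfl
  refine exists_contDiffAt_extension (f := g.spray e) (l := (EuclideanSpace.proj (𝕜 := ℝ)
    (0 : Fin (d + 1))).comp (ContinuousLinearMap.fst ℝ (CoordSpace d) (CoordSpace d)))
    (n := (coordVec 1 0, 0)) (V := V ×ˢ univ) ?_ ?_ ?_ ?_
  · rw [hl]; simp
  · rw [hl]; simp
  · exact prod_mem_nhds (hV.mem_nhds hxV) univ_mem
  · rintro ⟨y, w⟩ ⟨hy, hy'⟩
    have hyt : y ∈ (e.extend (𝓡∂ (d + 1))).target := by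
      rw [hVt]; exact ⟨hy.1, mem_halfSpace.2 hy'⟩
    refine ((hg.contDiffWithinAt_spray he hyt w).of_le (by norm_cast)).mono ?_
    rintro ⟨y', w'⟩ ⟨-, h'⟩
    exact ⟨mem_halfSpace.2 h', mem_univ _⟩

/-- Near the initial state the extended normal acceleration stays below K/2 < 0, so for small ε the
normal coordinate meets the conditions of `exists_exit_of_concave` on the fixed interval of
existence of the local flow. -/
theorem SymTensor.IsMetric.exists_exitFamily (hg : g.IsMetric kind)
    (he : e ∈ IsManifold.maximalAtlas (𝓡∂ (d + 1)) ∞ M)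
    (hx : coordVec 0 x ∈ (e.extend (𝓡∂ (d + 1))).target)
    (hK : g.spray e (coordVec 0 x, coordVec 0 v) 0 < 0) :
    Nonempty (ExitFamily g e kind x v) := by
  obtain ⟨V, hV, hVt⟩ := exists_open_inter_halfSpace e
  have hxV : coordVec 0 x ∈ V := by rw [hVt] at hx; exact hx.1
  obtain ⟨A, hA, hAs⟩ := hg.exists_spray_extension he hx (coordVec 0 v)
  set z₀ : CoordSpace d × CoordSpace d := (coordVec 0 x, coordVec 0 v) with hz₀
  set K := g.spray e z₀ 0 with hKdef
  have hA0 : A z₀ 0 = K := by rw [hAs z₀ (by simp [hz₀])]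
  set G : CoordSpace d × CoordSpace d → CoordSpace d × CoordSpace d := fun z => (z.2, A z) with hG
  have hGc : ContDiffAt ℝ 1 G z₀ := contDiffAt_snd.prodMk hA
  set Λ := ‖fderiv ℝ G z₀‖ + 1 with hΛ
  have hΛ0 : 0 < Λ := by positivity
  have hev : ∀ᶠ z in 𝓝 z₀, ContDiffAt ℝ 1 G z ∧ z.1 ∈ V ∧ A z 0 < K / 2 ∧ ‖fderiv ℝ G z‖ < Λ := by
    have h1 : ContinuousAt (fun z => A z 0) z₀ :=
      (EuclideanSpace.proj (𝕜 := ℝ) (0 : Fin (d + 1))).continuous.continuousAt.comp hA.continuousAt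
    have h2 : ContinuousAt (fun z => ‖fderiv ℝ G z‖) z₀ :=
      (hGc.continuousAt_fderiv (by norm_num)).norm
    filter_upwards [hGc.eventually (by simp), continuousAt_fst.eventually (hV.mem_nhds hxV),
      h1.eventually (gt_mem_nhds (by rw [hA0]; linarith : A z₀ 0 < K / 2)),
      h2.eventually (gt_mem_nhds (by rw [hΛ]; linarith : ‖fderiv ℝ G z₀‖ < Λ))]
      with z a1 a2 a3 a4 using ⟨a1, a2, a3, a4⟩
  obtain ⟨ρ, hρ, hρs⟩ := Metric.nhds_basis_closedBall.eventually_iff.1 hev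
  -- The bound T ≤ 1/(2Λ) secures the hypothesis ΛT ≤ 1/2 of `exists_variation`.
  obtain ⟨r, hr, T, hT, hTb, L, Z, hZ⟩ := exists_local_flow hGc
    (Metric.closedBall_mem_nhds z₀ hρ) (b := 1 / (2 * Λ)) (by positivity)
  have hcont : ContinuousAt (fun ε => (coordVec 0 x, tiltedDir kind v ε)) 0 := by
    obtain ⟨w, hw⟩ := exists_hasDerivAt_tiltedDir kind v le_rfl one_pos
    exact continuousAt_const.prodMk hw.continuousAt
  have hball : ∀ᶠ ε in 𝓝 (0 : ℝ), (coordVec 0 x, tiltedDir kind v ε) ∈ Metric.closedBall z₀ r := by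
    refine hcont.eventually (Filter.Eventually.filter_mono (le_of_eq ?_)
      (Metric.closedBall_mem_nhds z₀ hr))
    simp only [tiltedDir_zero, hz₀]
  obtain ⟨δ₁, hδ₁, hδ₁s⟩ := Metric.eventually_nhds_iff.1 hball
  -- The bound -KT/4 is the condition 2ε < -kT with k = K/2; the bound 1 keeps the square root in
  -- `v_ε` differentiable.
  set δ := min δ₁ (min 1 (-K * T / 4)) with hδ
  have hδ0 : 0 < δ := lt_min hδ₁ (lt_min one_pos (by nlinarith))
  have hz : ∀ ε ∈ Ioo 0 δ, (coordVec 0 x, tiltedDir kind v ε) ∈ Metric.closedBall z₀ r :=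
    fun ε hε => hδ₁s (by
      rw [Real.dist_eq, sub_zero, abs_of_pos hε.1]; exact hε.2.trans_le (min_le_left _ _))
  set X : ℝ → ℝ → CoordSpace d × CoordSpace d :=
    fun ε => Z (coordVec 0 x, tiltedDir kind v ε) with hX
  have hsub : Icc 0 T ⊆ Icc (-T) T := Icc_subset_Icc_left (by linarith)
  have hXd : ∀ ε ∈ Ioo 0 δ, ∀ t ∈ Icc 0 T,
      HasDerivAt (X ε) (G (X ε t)) t ∧ X ε t ∈ Metric.closedBall z₀ ρ := fun ε hε t ht =>
    (hZ _ (hz ε hε)).2.1 t (hsub ht)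
  have hX0 : ∀ ε ∈ Ioo 0 δ, X ε 0 = (coordVec 0 x, tiltedDir kind v ε) := fun ε hε =>
    (hZ _ (hz ε hε)).1
  have hexit : ∀ ε ∈ Ioo 0 δ, ∃ τ ∈ Ioo 0 T, (X ε τ).1 0 = 0 ∧ (X ε τ).2 0 < 0 ∧
      (∀ t ∈ Ioo 0 τ, 0 < (X ε t).1 0) ∧ (∀ t ∈ Ioc τ T, (X ε t).1 0 < 0) ∧
      τ * -(K / 2) ≤ 2 * ε := by
    intro ε hε
    refine exists_exit_of_concave (φ := fun t => (X ε t).1 0) (ψ := fun t => (X ε t).2 0)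
      (χ := fun t => A (X ε t) 0) hT (by linarith) hε.1 ?_ (fun t ht => ?_) (fun t ht => ?_)
      (fun t ht => (hρs (hXd ε hε t ht).2).2.2.1.le) ?_ ?_
    · have := hε.2.trans_le ((min_le_right _ _).trans (min_le_right _ _))
      linarith
    · exact ((EuclideanSpace.proj (𝕜 := ℝ) (0 : Fin (d + 1))).comp
        (ContinuousLinearMap.fst ℝ (CoordSpace d) (CoordSpace d))).hasFDerivAt.comp_hasDerivAt t
        (hXd ε hε t ht).1
    · exact ((EuclideanSpace.proj (𝕜 := ℝ) (0 : Fin (d + 1))).comp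
        (ContinuousLinearMap.snd ℝ (CoordSpace d) (CoordSpace d))).hasFDerivAt.comp_hasDerivAt t
        (hXd ε hε t ht).1
    · simp only [hX0 ε hε, coordVec_apply_zero]
    · simp only [hX0 ε hε, tiltedDir, coordVec_apply_zero]
  choose! τ hτ using hexit
  have hnn : ∀ ε ∈ Ioo 0 δ, ∀ t ∈ Icc 0 (τ ε), 0 ≤ (X ε t).1 0 := by
    intro ε hε t ht
    rcases eq_or_lt_of_le ht.1 with h | h
    · rw [← h, hX0 ε hε]; simp
    rcases eq_or_lt_of_le ht.2 with h' | h'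
    · rw [h', (hτ ε hε).2.1]
    · exact ((hτ ε hε).2.2.2.1 t ⟨h, h'⟩).le
  have hτs : ∀ ε ∈ Ioo 0 δ, Icc 0 (τ ε) ⊆ Icc 0 T := fun ε hε =>
    Icc_subset_Icc_right (hτ ε hε).1.2.le
  -- The constant -4/K rewrites τ(-K/2) ≤ 2ε.
  refine ⟨⟨δ, T, Metric.closedBall z₀ ρ ∩ {z | 0 ≤ z.1 0}, τ, X, -4 / K, hδ0,
    (min_le_right _ _).trans (min_le_left _ _), ?_, ?_, ?_, ?_, ?_, ?_, ?_, ?_, ?_, ?_, ?_, ?_, ?_⟩⟩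
  · refine (isCompact_closedBall z₀ ρ).inter_right ?_
    exact isClosed_le continuous_const
      ((EuclideanSpace.proj (𝕜 := ℝ) (0 : Fin (d + 1))).continuous.comp continuous_fst)
  · rintro z ⟨hz1, hz2⟩
    rw [hVt]
    exact ⟨(hρs hz1).2.1, mem_halfSpace.2 hz2⟩
  · exact fun ε hε => (hτ ε hε).1
  · intro ε hε
    have := (hτ ε hε).2.2.2.2.2
    rw [div_mul_eq_mul_div, le_div_iff_of_neg hK]
    linarith
  · exact fun ε hε t ht => ⟨(hXd ε hε t (hτs ε hε ht)).2, hnn ε hε t ht⟩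
  · exact hX0
  · exact fun ε hε t ht => (hXd ε hε t ht).1.fst
  · intro ε hε t ht
    have := (hXd ε hε t (hτs ε hε ht)).1.snd
    rw [← hAs _ (hnn ε hε t ht)]
    exact this
  · exact fun ε hε => (hτ ε hε).2.2.2.1
  · exact fun ε hε => (hτ ε hε).2.2.2.2.1
  · exact fun ε hε => (hτ ε hε).2.1
  · exact fun ε hε => (hτ ε hε).2.2.1
  · intro ε₀ hε₀
    obtain ⟨w, hw⟩ := exists_hasDerivAt_tiltedDir kind v hε₀.1.le
      (hε₀.2.trans_le ((min_le_right _ _).trans (min_le_left _ _)))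
    have hnear : ∀ᶠ ε in 𝓝 ε₀, ε ∈ Ioo 0 δ := Ioo_mem_nhds hε₀.1 hε₀.2
    obtain ⟨J, hJ0, hJ, hJv⟩ := exists_variation (f := G) (f' := fderiv ℝ G) (z₀ := z₀) (ρ := ρ)
      (Λ := Λ) (T := T) (L := L) (Z := X) (ε₀ := ε₀) (c' := (0, w))
      (fun z hz => ((hρs hz).1.differentiableAt (by norm_num)).hasFDerivAt)
      (fun z hz => ((hρs hz).1.continuousAt_fderiv (by norm_num)).continuousWithinAt)
      (fun z hz => (hρs hz).2.2.2.le) hT.le (by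
        calc Λ * T ≤ Λ * (1 / (2 * Λ)) := by gcongr
          _ = 1 / 2 := by field_simp)
      (hnear.mono hXd)
      (hnear.mono fun ε hε t ht => by
        have := (hZ _ (hz ε hε)).2.2 _ (hz ε₀ hε₀) t (hsub ht)
        rw [hX0 ε hε, hX0 ε₀ hε₀]
        exact this)
      (by
        refine HasDerivAt.congr_of_eventuallyEq ((hasDerivAt_const ε₀ (coordVec 0 x)).prodMk hw) ?_
        filter_upwards [hnear] with ε hε using hX0 ε hε)
    refine ⟨J, by rw [hJ0], fun t ht => (hJ t ht).continuousWithinAt, fun t ht => ?_, hJv⟩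
    have hJ1 : HasDerivWithinAt (fun r => (J r).1) (fderiv ℝ G (X ε₀ t) (J t)).1 (Icc 0 T) t :=
      (ContinuousLinearMap.fst ℝ (CoordSpace d) (CoordSpace d)).hasFDerivAt.comp_hasDerivWithinAt t
        (hJ t ht)
    refine hJ1.congr_deriv ?_
    -- The first component of the field is the projection to the velocity, so the linearized
    -- equation gives the position part of J the velocity part as derivative.
    have hGz := (hρs (hXd ε₀ hε₀ t ht).2).1
    have h1 : HasFDerivAt (fun z => (G z).1) ((ContinuousLinearMap.fst ℝ _ _).comp
        (fderiv ℝ G (X ε₀ t))) (X ε₀ t) :=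
      (ContinuousLinearMap.fst ℝ (CoordSpace d) (CoordSpace d)).hasFDerivAt.comp _
        (hGz.differentiableAt (by norm_num)).hasFDerivAt
    have h2 : HasFDerivAt (fun z => (G z).1) (ContinuousLinearMap.snd ℝ _ _) (X ε₀ t) :=
      (ContinuousLinearMap.snd ℝ (CoordSpace d) (CoordSpace d)).hasFDerivAt
    exact DFunLike.congr_fun (h1.unique h2) (J t)

end Family
end

noncomputable section

/-! ### The first variation formula for the exit time -/

namespace ExitFamily

set_option linter.unusedSectionVars false
set_option maxSynthPendingDepth 3

variable {d : ℕ} {M : Type*} [TopologicalSpace M] [ChartedSpace (EuclideanHalfSpace (d + 1)) M]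
  {g : SymTensor d M} {kind : MetricKind} {e : BdChart d M} {x v : Fin d → ℝ}
  (F : ExitFamily g e kind x v)

theorem isChartGeodesic {ε : ℝ} (hε : ε ∈ Ioo 0 F.δ) :
    g.IsChartGeodesic e (fun t => (F.X ε t).1) (fun t => (F.X ε t).2) (F.τ ε) := fun t ht =>
  ⟨F.subset_target _ (F.mem ε hε t ht),
    (F.deriv_fst ε hε t ⟨ht.1, ht.2.trans (F.τ_mem ε hε).2.le⟩).hasDerivWithinAt,
    (F.deriv_snd ε hε t ht).hasDerivWithinAt⟩

theorem exitsAt [T2Space M] (hg : g.IsMetric kind)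
    (he : e ∈ IsManifold.maximalAtlas (𝓡∂ (d + 1)) ∞ M) {ε : ℝ} (hε : ε ∈ Ioo 0 F.δ) :
    g.ExitsAt e x (tiltedDir kind v ε) (F.τ ε) (tangPart (F.X ε (F.τ ε)).1) (F.X ε (F.τ ε)).2 ∧
    ∀ T' y w, g.ExitsAt e x (tiltedDir kind v ε) T' y w →
      T' = F.τ ε ∧ y = tangPart (F.X ε (F.τ ε)).1 ∧ w = (F.X ε (F.τ ε)).2 := by
  have h := (F.isChartGeodesic hε).exitsAt hg he (F.τ_mem ε hε).1 (x := x)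
    (by simp only [F.zero ε hε]) (F.exit ε hε) (F.exit_neg ε hε)
  simp only [F.zero ε hε] at h
  exact h

theorem continuousAt_apply {ε₀ t : ℝ} (hε₀ : ε₀ ∈ Ioo 0 F.δ) (ht : t ∈ Ioo 0 F.T) :
    ContinuousAt (fun ε => F.X ε t) ε₀ := by
  obtain ⟨J, -, hJ, -, hv⟩ := F.variation ε₀ hε₀
  have h := hasDerivAt_variation_comp (Y := F.X) (τ := fun _ => t) continuousAt_const ht
    (hJ.continuousAt (Icc_mem_nhds ht.1 ht.2)) hv
  have h2 := h.continuousAt.add (continuousAt_const (y := F.X ε₀ t))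
  refine h2.congr (Eventually.of_forall fun ε => ?_)
  simp

/-- Just before and just after `τ ε₀` the normal coordinate of the reference curve is strictly
positive, respectively negative. These signs persist for nearby ε at the fixed times, and trap `τ ε`
between them. -/
theorem continuousAt_τ {ε₀ : ℝ} (hε₀ : ε₀ ∈ Ioo 0 F.δ) : ContinuousAt F.τ ε₀ := by
  have hτ := F.τ_mem ε₀ hε₀
  have hnear : ∀ᶠ ε in 𝓝 ε₀, ε ∈ Ioo 0 F.δ := Ioo_mem_nhds hε₀.1 hε₀.2
  have hcoord : ∀ t ∈ Ioo 0 F.T, ContinuousAt (fun ε => (F.X ε t).1 0) ε₀ := fun t ht =>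
    ((EuclideanSpace.proj (𝕜 := ℝ) (0 : Fin (d + 1))).comp
      (ContinuousLinearMap.fst ℝ (CoordSpace d) (CoordSpace d))).continuous.continuousAt.comp
      (F.continuousAt_apply hε₀ ht)
  refine tendsto_order.2 ⟨fun a ha => ?_, fun a ha => ?_⟩
  · obtain ⟨b, hb1, hb2⟩ := exists_between (max_lt ha hτ.1)
    have hb0 := (le_max_right _ _).trans_lt hb1
    filter_upwards [hnear, (hcoord b ⟨hb0, hb2.trans hτ.2⟩).eventually
      (lt_mem_nhds (F.pos ε₀ hε₀ b ⟨hb0, hb2⟩))] with ε hε hpos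
    by_contra! hle
    have := F.neg ε hε b ⟨(hle.trans (le_max_left _ _)).trans_lt hb1, (hb2.trans hτ.2).le⟩
    linarith
  · obtain ⟨b, hb1, hb2⟩ := exists_between (lt_min ha hτ.2)
    have hb0 := hb2.trans_le (min_le_right _ _)
    filter_upwards [hnear, (hcoord b ⟨hτ.1.trans hb1, hb0⟩).eventually
      (gt_mem_nhds (F.neg ε₀ hε₀ b ⟨hb1, hb0.le⟩))] with ε hε hneg
    by_contra! hle
    have := F.pos ε hε b ⟨hτ.1.trans hb1, (hb2.trans_le (min_le_left _ _)).trans_le hle⟩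
    linarith

/-- The factor under the root is chosen for this: σ(1 - σε²) + ε² = σ because σ² = 1. -/
theorem bilin_tiltedDir (hn : g.IsBoundaryNormal e)
    (hx : coordVec 0 x ∈ (e.extend (𝓡∂ (d + 1))).target)
    (hv : g.bdMetric e x v v = kind.sign) {ε : ℝ} (h0 : 0 ≤ ε) (h1 : ε < 1) :
    g.bilin e (coordVec 0 x) (tiltedDir kind v ε) (tiltedDir kind v ε) = kind.sign := by
  have hnn : g.bilin e (coordVec 0 x) (coordVec 1 0) (coordVec 1 0) = 1 := by
    rw [hn.bilin_normal hx]; simp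
  have hvn : g.bilin e (coordVec 0 x) (coordVec 0 v) (coordVec 1 0) = 0 := by
    rw [hn.bilin_normal hx]; simp
  have hnv : g.bilin e (coordVec 0 x) (coordVec 1 0) (coordVec 0 v) = 0 := by
    rw [g.bilin_symm, hvn]
  have hvv : g.bilin e (coordVec 0 x) (coordVec 0 v) (coordVec 0 v) = kind.sign := hv
  have hs := Real.mul_self_sqrt (kind.one_sub_pos h0 h1).le
  rw [tiltedDir, coordVec_smul]
  simp only [map_add, map_smul, add_apply, smul_apply, smul_eq_mul, hnn, hvn, hnv, hvv]
  linear_combination kind.sign * hs - ε ^ 2 * kind.sign_mul_self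

theorem energy (hg : g.IsMetric kind) (hn : g.IsBoundaryNormal e)
    (hx : coordVec 0 x ∈ (e.extend (𝓡∂ (d + 1))).target)
    (hv : g.bdMetric e x v v = kind.sign) {ε : ℝ} (hε : ε ∈ Ioo 0 F.δ) {t : ℝ}
    (ht : t ∈ Icc 0 (F.τ ε)) :
    g.bilin e (F.X ε t).1 (F.X ε t).2 (F.X ε t).2 = kind.sign := by
  have hd : ∀ t ∈ Icc 0 (F.τ ε), HasDerivWithinAt
      (fun r => g.bilin e (F.X ε r).1 (F.X ε r).2 (F.X ε r).2) 0 (Icc 0 (F.τ ε)) t := by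
    intro t ht
    have h := F.isChartGeodesic hε
    exact hg.hasDerivWithinAt_energy hn.1 (c := fun t => (F.X ε t).1) (u := fun t => (F.X ε t).2)
      (fun s hs => e.extend_target_subset_range (h s hs).1) (h t ht).1 (h t ht).2.1 (h t ht).2.2
  have := constant_of_has_deriv_right_zero (fun t ht => (hd t ht).continuousWithinAt)
    (fun t ht => (hd t (Ico_subset_Icc_self ht)).mono_of_mem_nhdsWithin
      (Icc_mem_nhdsGE_of_mem ht)) t ht
  rw [this, F.zero ε hε]
  exact bilin_tiltedDir hn hx hv hε.1.le (hε.2.trans_le F.δ_le)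

/-- The variation field is orthogonal to the geodesic. -/
theorem bilin_variation (hg : g.IsMetric kind) (hn : g.IsBoundaryNormal e)
    (hx : coordVec 0 x ∈ (e.extend (𝓡∂ (d + 1))).target)
    (hv : g.bdMetric e x v v = kind.sign) {ε₀ : ℝ} (hε₀ : ε₀ ∈ Ioo 0 F.δ)
    {J : ℝ → CoordSpace d × CoordSpace d} (hJ0 : (J 0).1 = 0) (hJc : ContinuousOn J (Icc 0 F.T))
    (hJ : ∀ t ∈ Icc 0 F.T, HasDerivWithinAt (fun r => (J r).1) (J t).2 (Icc 0 F.T) t)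
    (hJv : ∀ η > 0, ∀ᶠ ε in 𝓝 ε₀, ∀ t ∈ Icc 0 F.T,
      ‖F.X ε t - F.X ε₀ t - (ε - ε₀) • J t‖ ≤ η * |ε - ε₀|) :
    g.bilin e (F.X ε₀ (F.τ ε₀)).1 (J (F.τ ε₀)).1 (F.X ε₀ (F.τ ε₀)).2 = 0 := by
  have hτ := F.τ_mem ε₀ hε₀
  have hgeo := F.isChartGeodesic hε₀
  have hsub : Icc 0 (F.τ ε₀) ⊆ Icc 0 F.T := Icc_subset_Icc_right hτ.2.le
  have hcont : ContinuousOn (fun t => g.bilin e (F.X ε₀ t).1 (J t).1 (F.X ε₀ t).2)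
      (Icc 0 (F.τ ε₀)) := by
    have hB : ContinuousOn (fun t => g.bilin e (F.X ε₀ t).1) (Icc 0 (F.τ ε₀)) :=
      (g.contDiffOn_bilin hn.1).continuousOn.comp
        (fun t ht => (hgeo t ht).2.1.continuousWithinAt) fun t ht => (hgeo t ht).1
    exact (hB.clm_apply (continuous_fst.comp_continuousOn (hJc.mono hsub))).clm_apply
      fun t ht => (hgeo t ht).2.2.continuousWithinAt
  -- Only interior times are differentiated. There the curve lies in the open half-space, so the
  -- metric is differentiable in all directions, and by continuity of τ the neighbouring geodesics
  -- have not yet left M and still have energy σ.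
  have hderiv : ∀ t ∈ Ioo 0 (F.τ ε₀),
      HasDerivAt (fun t => g.bilin e (F.X ε₀ t).1 (J t).1 (F.X ε₀ t).2) 0 t := by
    intro t ht
    have htI := Ioo_subset_Icc_self ht
    have htT : t ∈ Ioo 0 F.T := ⟨ht.1, ht.2.trans hτ.2⟩
    have hxt := (hgeo t htI).1
    have hB : HasFDerivAt (g.bilin e) (g.dBilin e (F.X ε₀ t).1) (F.X ε₀ t).1 := by
      refine (g.hasFDerivWithinAt_bilin hn.1 hxt).hasFDerivAt ?_
      have h1 : ContinuousAt (fun y : CoordSpace d => y 0) (F.X ε₀ t).1 :=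
        (EuclideanSpace.proj (𝕜 := ℝ) (0 : Fin (d + 1))).continuous.continuousAt
      filter_upwards [h1.eventually (lt_mem_nhds (F.pos ε₀ hε₀ t ht))] with y hy
      exact mem_halfSpace.2 (le_of_lt hy)
    have hX1 := F.deriv_fst ε₀ hε₀ t (hsub htI)
    have hX2 := F.deriv_snd ε₀ hε₀ t htI
    have hJ1 := (hJ t (hsub htI)).hasDerivAt (Icc_mem_nhds htT.1 htT.2)
    have hBt : HasDerivAt (fun r => g.bilin e (F.X ε₀ r).1)
        (g.dBilin e (F.X ε₀ t).1 (F.X ε₀ t).2) t :=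
      HasFDerivAt.comp_hasDerivAt (l := g.bilin e) t hB hX1
    have hvar : HasDerivAt (fun ε => F.X ε t) (J t) ε₀ := by
      have h := (hasDerivAt_variation_comp (Y := F.X) (τ := fun _ => t) continuousAt_const htT
        (hJc.continuousAt (Icc_mem_nhds htT.1 htT.2)) hJv).add_const (F.X ε₀ t)
      simpa using h
    have hv1 : HasDerivAt (fun ε => (F.X ε t).1) (J t).1 ε₀ :=
      (ContinuousLinearMap.fst ℝ (CoordSpace d) (CoordSpace d)).hasFDerivAt.comp_hasDerivAt ε₀ hvar
    have hv2 : HasDerivAt (fun ε => (F.X ε t).2) (J t).2 ε₀ :=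
      (ContinuousLinearMap.snd ℝ (CoordSpace d) (CoordSpace d)).hasFDerivAt.comp_hasDerivAt ε₀ hvar
    have hBε : HasDerivAt (fun ε => g.bilin e (F.X ε t).1)
        (g.dBilin e (F.X ε₀ t).1 (J t).1) ε₀ :=
      HasFDerivAt.comp_hasDerivAt (l := g.bilin e) ε₀ hB hv1
    have hE := (hBε.clm_apply hv2).clm_apply hv2
    have hE0 : HasDerivAt (fun ε => g.bilin e (F.X ε t).1 (F.X ε t).2 (F.X ε t).2) 0 ε₀ := by
      refine (hasDerivAt_const ε₀ kind.sign).congr_of_eventuallyEq ?_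
      filter_upwards [Ioo_mem_nhds hε₀.1 hε₀.2,
        (F.continuousAt_τ hε₀).eventually (lt_mem_nhds ht.2)] with ε hε hεt
      exact F.energy hg hn hx hv hε ⟨ht.1.le, le_of_lt hεt⟩
    -- The ε-derivative of the energy is zero; by the geodesic equation it equals twice the
    -- t-derivative of the product with the variation field.
    have hzero := hE.unique hE0
    refine ((hBt.clm_apply hJ1).clm_apply hX2).congr_deriv ?_
    rw [add_apply] at hzero ⊢
    rw [g.bilin_symm e _ (J t).1, hg.bilin_spray hn.1 hxt, g.lowSpray_apply,
      g.dBilin_symm hn.1 hxt _ (J t).1]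
    rw [g.bilin_symm e _ (F.X ε₀ t).2] at hzero
    linear_combination hzero / 2
  obtain ⟨ξ, -, hξ⟩ := exists_hasDerivAt_eq_slope _ (fun _ => 0) hτ.1 hcont hderiv
  rw [eq_comm, div_eq_zero_iff] at hξ
  rcases hξ with hξ | hξ
  · rw [sub_eq_zero.1 hξ, hJ0]
    simp
  · linarith [hτ.1]

theorem bdMetric_tangPart (hn : g.IsBoundaryNormal e) {y w u : CoordSpace d}
    (hy : y ∈ (e.extend (𝓡∂ (d + 1))).target) (hy0 : y 0 = 0) (hw : w 0 = 0) :
    g.bdMetric e (tangPart y) (tangPart w) (tangPart u) = g.bilin e y w u := by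
  rw [SymTensor.bdMetric, coordVec_zero_tangPart hy0, coordVec_zero_tangPart hw, ← g.bilin_apply]
  conv_rhs => rw [eq_smul_add_coordVec u]
  rw [map_add, map_smul, hn.bilin_normal hy, hw]
  simp

/-- The first variation formula. -/
theorem exists_hasDerivAt (hg : g.IsMetric kind) (hn : g.IsBoundaryNormal e)
    (hx : coordVec 0 x ∈ (e.extend (𝓡∂ (d + 1))).target)
    (hv : g.bdMetric e x v v = kind.sign) {ε₀ : ℝ} (hε₀ : ε₀ ∈ Ioo 0 F.δ) :
    ∃ y' : Fin d → ℝ, HasDerivAt (fun ε => tangPart (F.X ε (F.τ ε)).1) y' ε₀ ∧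
      HasDerivAt F.τ (kind.sign * g.bdMetric e (tangPart (F.X ε₀ (F.τ ε₀)).1) y'
        (tangPart (F.X ε₀ (F.τ ε₀)).2)) ε₀ := by
  obtain ⟨J, hJ0, hJc, hJ, hJv⟩ := F.variation ε₀ hε₀
  have hτ := F.τ_mem ε₀ hε₀
  have hτI : F.τ ε₀ ∈ Icc 0 (F.τ ε₀) := ⟨hτ.1.le, le_rfl⟩
  have hnear : ∀ᶠ ε in 𝓝 ε₀, ε ∈ Ioo 0 F.δ := Ioo_mem_nhds hε₀.1 hε₀.2
  have hcτ := F.continuousAt_τ hε₀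
  have hD := hasDerivAt_variation_comp (Y := F.X) hcτ hτ
    (hJc.continuousAt (Icc_mem_nhds hτ.1 hτ.2)) hJv
  have hD1 : HasDerivAt (fun ε => (F.X ε (F.τ ε)).1 - (F.X ε₀ (F.τ ε)).1) (J (F.τ ε₀)).1 ε₀ :=
    (ContinuousLinearMap.fst ℝ (CoordSpace d) (CoordSpace d)).hasFDerivAt.comp_hasDerivAt ε₀ hD
  have hX1 := F.deriv_fst ε₀ hε₀ (F.τ ε₀) ⟨hτ.1.le, hτ.2.le⟩
  have hφ : HasDerivAt (fun t => (F.X ε₀ t).1 0) ((F.X ε₀ (F.τ ε₀)).2 0) (F.τ ε₀) :=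
    (EuclideanSpace.proj (𝕜 := ℝ) (0 : Fin (d + 1))).hasFDerivAt.comp_hasDerivAt _ hX1
  -- Every curve has normal coordinate 0 at its own exit, so the reference curve at time `τ ε` has
  -- minus the normal coordinate of the difference, which is differentiable. Transversality then
  -- transfers differentiability to τ.
  have hφτ : HasDerivAt (fun ε => (F.X ε₀ (F.τ ε)).1 0) (-(J (F.τ ε₀)).1 0) ε₀ := by
    have h1 : HasDerivAt (fun ε => ((F.X ε (F.τ ε)).1 - (F.X ε₀ (F.τ ε)).1) 0)
        ((J (F.τ ε₀)).1 0) ε₀ :=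
      (EuclideanSpace.proj (𝕜 := ℝ) (0 : Fin (d + 1))).hasFDerivAt.comp_hasDerivAt _ hD1
    refine h1.neg.congr_of_eventuallyEq ?_
    filter_upwards [hnear] with ε hε
    have := F.exit ε hε
    simp [this]
  have hne : (F.X ε₀ (F.τ ε₀)).2 0 ≠ 0 := (F.exit_neg ε₀ hε₀).ne
  have hτ' := HasDerivAt.of_comp_left hcτ hφ hφτ hne (Eventually.of_forall fun _ => rfl)
  set τ' := -(J (F.τ ε₀)).1 0 / (F.X ε₀ (F.τ ε₀)).2 0 with hτ'def
  have hY : HasDerivAt (fun ε => (F.X ε (F.τ ε)).1)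
      ((J (F.τ ε₀)).1 + τ' • (F.X ε₀ (F.τ ε₀)).2) ε₀ := by
    have h1 := hD1.add (hX1.scomp ε₀ hτ')
    refine h1.congr_of_eventuallyEq (Eventually.of_forall fun ε => ?_)
    simp
  have hY0 : ((J (F.τ ε₀)).1 + τ' • (F.X ε₀ (F.τ ε₀)).2) 0 = 0 := by
    simp only [PiLp.add_apply, PiLp.smul_apply, smul_eq_mul, hτ'def]
    field_simp
    ring
  refine ⟨tangPart ((J (F.τ ε₀)).1 + τ' • (F.X ε₀ (F.τ ε₀)).2), ?_, ?_⟩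
  · refine hasDerivAt_pi.2 fun α => ?_
    exact (EuclideanSpace.proj (𝕜 := ℝ) (α.succ : Fin (d + 1))).hasFDerivAt.comp_hasDerivAt _ hY
  -- Here y' = J + τ'η with J orthogonal to η and g(η, η) = σ, so g(y', η) = στ'. As y' is
  -- tangential, only the tangential part of η enters.
  · refine hτ'.congr_deriv ?_
    rw [bdMetric_tangPart hn (F.isChartGeodesic hε₀ _ hτI).1 (F.exit ε₀ hε₀) hY0, map_add, map_smul,
      add_apply, smul_apply, F.bilin_variation hg hn hx hv hε₀ hJ0 hJc hJ hJv,
      F.energy hg hn hx hv hε₀ hτI, smul_eq_mul]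
    linear_combination -τ' * kind.sign_mul_self

end ExitFamily
end

noncomputable section

/-! ### Jets of the metric along the boundary -/

section Jets

set_option linter.unusedSectionVars false
set_option maxSynthPendingDepth 3

variable {d : ℕ} {M : Type*} [TopologicalSpace M] [ChartedSpace (EuclideanHalfSpace (d + 1)) M]
  {F : Type*} [NormedAddCommGroup F] [NormedSpace ℝ F]

/-- The directional derivative, up to the boundary, of a function on the half-space. -/
def halfPartial (w : CoordSpace d) (f : CoordSpace d → F) (y : CoordSpace d) : F :=
  fderivWithin ℝ f (halfSpace d) y w

/-- `f` is smooth up to the boundary on the range of the chart `e`. -/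
def SmoothInChart (e : BdChart d M) (f : CoordSpace d → F) : Prop :=
  ∀ y ∈ (e.extend (𝓡∂ (d + 1))).target, ContDiffWithinAt ℝ ∞ f (halfSpace d) y

variable {e : BdChart d M} {f f' : CoordSpace d → F} {y : CoordSpace d}

theorem SmoothInChart.hasFDerivWithinAt (hf : SmoothInChart e f)
    (hy : y ∈ (e.extend (𝓡∂ (d + 1))).target) :
    HasFDerivWithinAt f (fderivWithin ℝ f (halfSpace d) y) (halfSpace d) y :=
  ((hf y hy).differentiableWithinAt (by simp)).hasFDerivWithinAt

theorem SmoothInChart.halfPartial (hf : SmoothInChart e f) (w : CoordSpace d) :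
    SmoothInChart e (halfPartial w f) := fun y hy =>
  ((hf y hy).fderivWithin_right (m := ∞) (uniqueDiffOn_halfSpace d) (by norm_cast)
    (e.extend_target_subset_range hy)).clm_apply contDiffWithinAt_const

theorem SmoothInChart.continuousOn (hf : SmoothInChart e f) :
    ContinuousOn f (e.extend (𝓡∂ (d + 1))).target := fun y hy =>
  (hf y hy).continuousWithinAt.mono e.extend_target_subset_range

theorem halfPartial_congr (h : EqOn f f' (e.extend (𝓡∂ (d + 1))).target)
    (hy : y ∈ (e.extend (𝓡∂ (d + 1))).target) (w : CoordSpace d) :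
    halfPartial w f y = halfPartial w f' y := by
  have : f =ᶠ[𝓝[halfSpace d] y] f' := by
    filter_upwards [e.extend_target_mem_nhdsWithin_of_mem hy] with z hz using h hz
  rw [halfPartial, halfPartial, this.fderivWithin_eq (h hy)]

theorem SmoothInChart.halfPartial_comm (hf : SmoothInChart e f)
    (hy : y ∈ (e.extend (𝓡∂ (d + 1))).target) (w w' : CoordSpace d) :
    _root_.halfPartial w (_root_.halfPartial w' f) y =
      _root_.halfPartial w' (_root_.halfPartial w f) y := by
  have hm : y ∈ halfSpace d := e.extend_target_subset_range hy
  have hsymm := (hf y hy).isSymmSndFDerivWithinAt (by simp; norm_cast)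
    (uniqueDiffOn_halfSpace d) (halfSpace_subset_closure_interior hm) hm w w'
  have key : ∀ w w' : CoordSpace d, _root_.halfPartial w (_root_.halfPartial w' f) y =
      fderivWithin ℝ (fderivWithin ℝ f (halfSpace d)) (halfSpace d) y w w' := by
    intro w w'
    have h1 : HasFDerivWithinAt (fderivWithin ℝ f (halfSpace d)) _ (halfSpace d) y :=
      (((hf y hy).fderivWithin_right (m := ∞) (uniqueDiffOn_halfSpace d) (by norm_cast)
        hm).differentiableWithinAt (by simp)).hasFDerivWithinAt
    have h2 := h1.clm_apply (hasFDerivWithinAt_const w' y (halfSpace d))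
    have h3 : fderivWithin ℝ (_root_.halfPartial w' f) (halfSpace d) y = _ :=
      h2.fderivWithin (uniqueDiffOn_halfSpace d y hm)
    rw [_root_.halfPartial, h3]
    simp
  rw [key, key]
  exact hsymm

/-- The coordinate vector `∂_α`. -/
abbrev tangVec (α : Fin d) : CoordSpace d := coordVec 0 (Pi.single α 1)

/-- The derivative `∂_l ∂ₙᵏ f`. -/
def halfJet (f : CoordSpace d → F) (k : ℕ) : List (Fin d) → CoordSpace d → F
  | [] => (halfPartial (coordVec 1 0))^[k] f
  | α :: l => halfPartial (tangVec α) (halfJet f k l)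

theorem SmoothInChart.halfJet (hf : SmoothInChart e f) (k : ℕ) (l : List (Fin d)) :
    SmoothInChart e (halfJet f k l) := by
  induction l with
  | nil =>
    induction k with
    | zero => exact hf
    | succ k ih =>
      rw [_root_.halfJet, Function.iterate_succ_apply']
      exact ih.halfPartial _
  | cons α l ih => exact ih.halfPartial _

/-- In `halfJet` normal derivatives are applied first; commuting partial derivatives lets a further
one pass below the tangential ones. -/
theorem SmoothInChart.halfPartial_normal_halfJet (hf : SmoothInChart e f) (k : ℕ)
    (l : List (Fin d)) (hy : y ∈ (e.extend (𝓡∂ (d + 1))).target) :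
    _root_.halfPartial (coordVec 1 0) (_root_.halfJet f k l) y = _root_.halfJet f (k + 1) l y := by
  induction l generalizing y with
  | nil => rw [_root_.halfJet, _root_.halfJet, Function.iterate_succ_apply']
  | cons α l ih =>
    rw [_root_.halfJet, (hf.halfJet k l).halfPartial_comm hy, _root_.halfJet]
    exact halfPartial_congr (fun z hz => ih hz) hy _

theorem eq_sum_tangVec (u : CoordSpace d) :
    u = u 0 • coordVec 1 0 + ∑ γ, u γ.succ • tangVec γ := by
  ext i
  refine Fin.cases ?_ (fun j => ?_) i
  · simp [coordVec, tangVec]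
  · simp [coordVec, tangVec, Pi.single_apply]

theorem coordVec_zero_eq_sum (u : Fin d → ℝ) : coordVec 0 u = ∑ γ, u γ • tangVec γ := by
  have := eq_sum_tangVec (coordVec 0 u)
  simpa [coordVec] using this

theorem SmoothInChart.fderivWithin_halfJet (hf : SmoothInChart e f) (k : ℕ) (l : List (Fin d))
    (hy : y ∈ (e.extend (𝓡∂ (d + 1))).target) (u : CoordSpace d) :
    fderivWithin ℝ (_root_.halfJet f k l) (halfSpace d) y u =
      u 0 • _root_.halfJet f (k + 1) l y + ∑ γ, u γ.succ • _root_.halfJet f k (γ :: l) y := by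
  conv_lhs => rw [eq_sum_tangVec u]
  rw [map_add, map_smul, map_sum]
  simp only [map_smul]
  rw [← hf.halfPartial_normal_halfJet k l hy]
  rfl

variable (d) in
/-- The inclusion of the tangential coordinates. -/
def tangIncl : (Fin d → ℝ) →L[ℝ] CoordSpace d :=
  LinearMap.toContinuousLinearMap
    { toFun := coordVec 0
      map_add' := fun u w => by
        ext i
        refine Fin.cases ?_ (fun j => ?_) i <;> simp [coordVec]
      map_smul' := fun c u => by
        ext i
        refine Fin.cases ?_ (fun j => ?_) i <;> simp [coordVec] }

@[simp]
theorem tangIncl_apply (u : Fin d → ℝ) : tangIncl d u = coordVec 0 u := rfl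

theorem hasDerivAt_coordVec (z : Fin d → ℝ) (t : ℝ) :
    HasDerivAt (fun t => coordVec t z) (coordVec 1 0) t := by
  have h := ((hasDerivAt_id t).smul_const (coordVec 1 (0 : Fin d → ℝ))).add_const (coordVec 0 z)
  rw [one_smul] at h
  refine h.congr_of_eventuallyEq (Eventually.of_forall fun r => ?_)
  simpa using coordVec_smul r 1 z

theorem coordVec_mem_halfSpace {t : ℝ} (ht : 0 ≤ t) (z : Fin d → ℝ) : coordVec t z ∈ halfSpace d :=
  mem_halfSpace.2 (by simpa using ht)

theorem isOpen_boundary_target (e : BdChart d M) :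
    IsOpen {z : Fin d → ℝ | coordVec 0 z ∈ (e.extend (𝓡∂ (d + 1))).target} := by
  obtain ⟨V, hV, hVt⟩ := exists_open_inter_halfSpace e
  have : {z : Fin d → ℝ | coordVec 0 z ∈ (e.extend (𝓡∂ (d + 1))).target} = tangIncl d ⁻¹' V := by
    ext z
    rw [mem_ofPred_eq, hVt]
    exact ⟨fun h => h.1, fun h => ⟨h, coordVec_mem_halfSpace le_rfl z⟩⟩
  rw [this]
  exact hV.preimage (tangIncl d).continuous

/-- The identity is proved at all `t ≥ 0` near the boundary point, not only at 0, so that it can be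
differentiated once more in the induction. -/
theorem SmoothInChart.iteratedDerivWithin_eq (hf : SmoothInChart e f) (L : F →L[ℝ] ℝ) (k : ℕ)
    {z : Fin d → ℝ} {t : ℝ} (ht : 0 ≤ t) (hz : coordVec t z ∈ (e.extend (𝓡∂ (d + 1))).target) :
    iteratedDerivWithin k (fun t => L (f (coordVec t z))) (Ici 0) t =
      L (_root_.halfJet f k [] (coordVec t z)) := by
  induction k generalizing t with
  | zero => simp [_root_.halfJet]
  | succ k ih =>
    have hm : MapsTo (fun t => coordVec t z) (Ici 0) (halfSpace d) := fun s hs =>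
      coordVec_mem_halfSpace hs z
    have hev : iteratedDerivWithin k (fun t => L (f (coordVec t z))) (Ici 0) =ᶠ[𝓝[Ici 0] t]
        fun s => L (_root_.halfJet f k [] (coordVec s z)) := by
      have h1 := tendsto_nhdsWithin_of_tendsto_nhds_of_eventually_within _
        ((hasDerivAt_coordVec z t).continuousAt.continuousWithinAt (s := Ici 0))
        (eventually_mem_nhdsWithin.mono fun s hs => hm hs)
      filter_upwards [h1 (e.extend_target_mem_nhdsWithin_of_mem hz), self_mem_nhdsWithin]
        with s hs hs' using ih hs' hs
    have hd : HasDerivWithinAt (fun s => L (_root_.halfJet f k [] (coordVec s z)))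
        (L (_root_.halfJet f (k + 1) [] (coordVec t z))) (Ici 0) t := by
      have h1 := ((hf.halfJet k []).hasFDerivWithinAt hz).comp_hasDerivWithinAt t
        (hasDerivAt_coordVec z t).hasDerivWithinAt hm
      have h2 := L.hasFDerivAt.comp_hasDerivWithinAt t h1
      refine h2.congr_deriv ?_
      rw [← hf.halfPartial_normal_halfJet k [] hz]
      rfl
    rw [iteratedDerivWithin_succ, hev.derivWithin_eq (ih ht hz)]
    exact hd.derivWithin (uniqueDiffOn_Ici 0 t ht)

theorem SmoothInChart.iterPartial_eq (hf : SmoothInChart e f) (L : F →L[ℝ] ℝ) (k : ℕ)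
    {q : (Fin d → ℝ) → ℝ}
    (hq : ∀ z, coordVec 0 z ∈ (e.extend (𝓡∂ (d + 1))).target →
      q z = L (_root_.halfJet f k [] (coordVec 0 z)))
    (l : List (Fin d)) {z : Fin d → ℝ} (hz : coordVec 0 z ∈ (e.extend (𝓡∂ (d + 1))).target) :
    iterPartial l q z = L (_root_.halfJet f k l (coordVec 0 z)) := by
  induction l generalizing z with
  | nil => exact hq z hz
  | cons α l ih =>
    have hev : iterPartial l q =ᶠ[𝓝 z] fun z => L (_root_.halfJet f k l (coordVec 0 z)) := by
      filter_upwards [(isOpen_boundary_target e).mem_nhds hz] with z' hz' using ih hz'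
    have hd : HasFDerivAt (fun z => L (_root_.halfJet f k l (coordVec 0 z)))
        (L.comp ((fderivWithin ℝ (_root_.halfJet f k l) (halfSpace d) (coordVec 0 z)).comp
          (tangIncl d))) z := by
      have h1 := ((hf.halfJet k l).hasFDerivWithinAt hz).comp (t := halfSpace d) (s := univ) z
        ((tangIncl d).hasFDerivAt.hasFDerivWithinAt) (fun z' _ => coordVec_mem_halfSpace le_rfl z')
      exact L.hasFDerivAt.comp z (hasFDerivWithinAt_univ.1 h1)
    change fderiv ℝ (iterPartial l q) z (Pi.single α 1) = _
    rw [hev.fderiv_eq, hd.fderiv]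
    rfl

variable {g : SymTensor d M}

theorem SymTensor.smoothInChart_bilin (g : SymTensor d M)
    (he : e ∈ IsManifold.maximalAtlas (𝓡∂ (d + 1)) ∞ M) : SmoothInChart e (g.bilin e) :=
  fun _ hy => g.contDiffWithinAt_bilin he hy

/-- Evaluation of a bilinear form. -/
def evalForm (u w : CoordSpace d) : (CoordSpace d →L[ℝ] CoordSpace d →L[ℝ] ℝ) →L[ℝ] ℝ :=
  (ContinuousLinearMap.apply ℝ ℝ w).comp
    (ContinuousLinearMap.apply ℝ (CoordSpace d →L[ℝ] ℝ) u)

@[simp]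
theorem evalForm_apply (u w : CoordSpace d) (b : CoordSpace d →L[ℝ] CoordSpace d →L[ℝ] ℝ) :
    evalForm u w b = b u w := rfl

theorem SymTensor.normalDeriv_eq (g : SymTensor d M)
    (he : e ∈ IsManifold.maximalAtlas (𝓡∂ (d + 1)) ∞ M) (m : ℕ) {z : Fin d → ℝ}
    (hz : coordVec 0 z ∈ (e.extend (𝓡∂ (d + 1))).target) (u w : Fin d → ℝ) :
    g.normalDeriv e m z u w =
      halfJet (g.bilin e) m [] (coordVec 0 z) (coordVec 0 u) (coordVec 0 w) :=
  (g.smoothInChart_bilin he).iteratedDerivWithin_eq (evalForm (coordVec 0 u) (coordVec 0 w)) m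
    le_rfl hz

theorem SymTensor.jetVal_jet (g : SymTensor d M)
    (he : e ∈ IsManifold.maximalAtlas (𝓡∂ (d + 1)) ∞ M) {z : Fin d → ℝ}
    (hz : coordVec 0 z ∈ (e.extend (𝓡∂ (d + 1))).target) (w : Fin d → ℝ) (k : ℕ)
    (l : List (Fin d)) (α β : Fin d) :
    g.jetVal e z w (.jet k l α β) =
      halfJet (g.bilin e) k l (coordVec 0 z) (tangVec α) (tangVec β) :=
  (g.smoothInChart_bilin he).iterPartial_eq (evalForm (tangVec α) (tangVec β)) k
    (fun _ hz => g.normalDeriv_eq he k hz _ _) l hz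

theorem bilin_eq_sum (b : CoordSpace d →L[ℝ] CoordSpace d →L[ℝ] ℝ) (u w : Fin d → ℝ) :
    b (coordVec 0 u) (coordVec 0 w) =
      ∑ α, ∑ β, b (tangVec α) (tangVec β) * (u α * w β) := by
  rw [coordVec_zero_eq_sum u, coordVec_zero_eq_sum w]
  simp only [map_sum, map_smul, sum_apply, smul_apply, smul_eq_mul,
    Finset.mul_sum]
  rw [Finset.sum_comm]
  refine Finset.sum_congr rfl fun α _ => Finset.sum_congr rfl fun β _ => ?_
  ring

theorem SymTensor.normalDeriv_eq_sum (g : SymTensor d M)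
    (he : e ∈ IsManifold.maximalAtlas (𝓡∂ (d + 1)) ∞ M) (m : ℕ) {z : Fin d → ℝ}
    (hz : coordVec 0 z ∈ (e.extend (𝓡∂ (d + 1))).target) (u w : Fin d → ℝ) :
    g.normalDeriv e m z u w =
      ∑ α, ∑ β, g.normalDeriv e m z (Pi.single α 1) (Pi.single β 1) * (u α * w β) := by
  simp only [g.normalDeriv_eq he m hz]
  exact bilin_eq_sum _ u w

end Jets
end

noncomputable section

/-! ### The geodesics as a boundary flow -/

section MatrixInverse

variable {n : Type*} [Fintype n] [DecidableEq n]

theorem Matrix.continuousAt_inv_apply {A : Matrix n n ℝ} (hA : A.det ≠ 0) (i j : n) :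
    ContinuousAt (fun B : Matrix n n ℝ => B⁻¹ i j) A := by
  have h1 : ContinuousAt (fun B : Matrix n n ℝ => B.det⁻¹ * B.adjugate i j) A :=
    ((continuous_id.matrix_det).continuousAt.inv₀ hA).mul
      ((continuous_id.matrix_adjugate).matrix_elem i j).continuousAt
  refine h1.congr (Eventually.of_forall fun B => ?_)
  simp [Matrix.inv_def, Ring.inverse_eq_inv']

theorem Matrix.inv_sub_inv_apply {A B : Matrix n n ℝ} (hA : A.det ≠ 0) (hB : B.det ≠ 0) (i j : n) :
    B⁻¹ i j - A⁻¹ i j = -∑ γ, ∑ μ, B⁻¹ i γ * A⁻¹ μ j * (B γ μ - A γ μ) := by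
  have h : B⁻¹ - A⁻¹ = -(B⁻¹ * (B - A) * A⁻¹) := by
    rw [Matrix.mul_sub, Matrix.sub_mul, Matrix.nonsing_inv_mul _ (isUnit_iff_ne_zero.2 hB),
      Matrix.mul_assoc, Matrix.mul_nonsing_inv _ (isUnit_iff_ne_zero.2 hA)]
    simp
  have h' := congrFun (congrFun h i) j
  rw [Matrix.sub_apply] at h'
  rw [h', Matrix.neg_apply, Matrix.mul_apply]
  simp only [Matrix.mul_apply, Matrix.sub_apply, Finset.sum_mul]
  rw [Finset.sum_comm]
  congr 1
  refine Finset.sum_congr rfl fun γ _ => Finset.sum_congr rfl fun μ _ => ?_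
  ring

/-- The limit of the difference quotients in B⁻¹ - A⁻¹ = -B⁻¹(B - A)A⁻¹; only continuity of the
inverse is needed. -/
theorem Matrix.hasDerivWithinAt_inv_apply {A : ℝ → Matrix n n ℝ} {A' : Matrix n n ℝ} {s : Set ℝ}
    {t : ℝ} (h : ∀ i j, HasDerivWithinAt (fun r => A r i j) (A' i j) s t) (ht : t ∈ s)
    (hdet : ∀ r ∈ s, (A r).det ≠ 0) (i j : n) :
    HasDerivWithinAt (fun r => (A r)⁻¹ i j)
      (-∑ γ, ∑ μ, (A t)⁻¹ i γ * (A t)⁻¹ μ j * A' γ μ) s t := by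
  have hA : ContinuousWithinAt A s t :=
    continuousWithinAt_pi.2 fun i => continuousWithinAt_pi.2 fun j => (h i j).continuousWithinAt
  have hinv : ∀ i j, Tendsto (fun r => (A r)⁻¹ i j) (𝓝[s \ {t}] t) (𝓝 ((A t)⁻¹ i j)) := fun i j =>
    ((Matrix.continuousAt_inv_apply (hdet t ht) i j).tendsto.comp hA).mono_left
      (nhdsWithin_mono _ sdiff_subset)
  rw [hasDerivWithinAt_iff_tendsto_slope]
  have hlim : Tendsto (fun r => -∑ γ, ∑ μ, (A r)⁻¹ i γ * (A t)⁻¹ μ j *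
      slope (fun r => A r γ μ) t r) (𝓝[s \ {t}] t)
      (𝓝 (-∑ γ, ∑ μ, (A t)⁻¹ i γ * (A t)⁻¹ μ j * A' γ μ)) := by
    refine (tendsto_finsetSum _ fun γ _ => tendsto_finsetSum _ fun μ _ => ?_).neg
    exact ((hinv i γ).mul_const _).mul (hasDerivWithinAt_iff_tendsto_slope.1 (h γ μ))
  refine hlim.congr' ?_
  filter_upwards [self_mem_nhdsWithin] with r hr
  rw [slope_def_field, Matrix.inv_sub_inv_apply (hdet t ht) (hdet r hr.1), neg_div, Finset.sum_div]
  congr 1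
  refine Finset.sum_congr rfl fun γ _ => ?_
  rw [Finset.sum_div]
  refine Finset.sum_congr rfl fun μ _ => ?_
  rw [slope_def_field]
  ring

end MatrixInverse

section Components

set_option linter.unusedSectionVars false
set_option maxSynthPendingDepth 3

variable {d : ℕ} {M : Type*} [TopologicalSpace M] [ChartedSpace (EuclideanHalfSpace (d + 1)) M]
  {g : SymTensor d M} {kind : MetricKind} {e : BdChart d M} {y : CoordSpace d}

/-- The matrix of the tangential components of the metric. -/
def SymTensor.tangMatrix (g : SymTensor d M) (e : BdChart d M) (y : CoordSpace d) :
    Matrix (Fin d) (Fin d) ℝ :=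
  Matrix.of fun i j => g.bilin e y (tangVec i) (tangVec j)

theorem SymTensor.IsBoundaryNormal.bilin_tangVec (hn : g.IsBoundaryNormal e)
    (hy : y ∈ (e.extend (𝓡∂ (d + 1))).target) (u : CoordSpace d) (μ : Fin d) :
    g.bilin e y u (tangVec μ) = (g.tangMatrix e y).mulVec (tangPart u) μ := by
  rw [g.bilin_symm]
  conv_lhs => rw [eq_smul_add_coordVec u, coordVec_zero_eq_sum]
  rw [map_add, map_smul, hn.bilin_normal hy, map_sum]
  simp [Matrix.mulVec, dotProduct, SymTensor.tangMatrix, mul_comm]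

/-- A kernel vector of the tangential block is also orthogonal to ∂ₙ, hence to everything, against
nondegeneracy. -/
theorem SymTensor.IsBoundaryNormal.det_tangMatrix_ne_zero (hn : g.IsBoundaryNormal e)
    (hg : g.IsMetric kind) (hy : y ∈ (e.extend (𝓡∂ (d + 1))).target) :
    (g.tangMatrix e y).det ≠ 0 := by
  intro h0
  obtain ⟨w, hw, hw0⟩ := Matrix.exists_mulVec_eq_zero_iff.2 h0
  refine hw ?_
  have h1 : g.bilin e y (coordVec 0 w) = 0 := by
    ext u
    have h2 : ∀ μ, g.bilin e y (coordVec 0 w) (tangVec μ) = 0 := fun μ => by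
      rw [hn.bilin_tangVec hy, tangPart_coordVec, hw0]; rfl
    conv_lhs => rw [eq_smul_add_coordVec u, coordVec_zero_eq_sum (tangPart u)]
    rw [map_add, map_smul, hn.bilin_normal hy, map_sum]
    simp [h2]
  have h3 := (hg.isInvertible_bilin hn.1 hy).injective (h1.trans (map_zero _).symm)
  have h4 := congrArg tangPart h3
  rw [tangPart_coordVec] at h4
  rw [h4]
  rfl

theorem SymTensor.IsBoundaryNormal.dBilin_eq_sum (hn : g.IsBoundaryNormal e)
    (hy : y ∈ (e.extend (𝓡∂ (d + 1))).target) (h u w : CoordSpace d) :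
    g.dBilin e y h u w =
      ∑ α, ∑ β, g.dBilin e y h (tangVec α) (tangVec β) * (u α.succ * w β.succ) := by
  have h1 : ∀ u w, g.dBilin e y h u w = g.dBilin e y h u (coordVec 0 (tangPart w)) := by
    intro u w
    conv_lhs => rw [eq_smul_add_coordVec w]
    rw [map_add, map_smul, hn.dBilin_normal hy]
    simp
  rw [h1, g.dBilin_symm hn.1 hy, h1, bilin_eq_sum]
  rw [Finset.sum_comm]
  refine Finset.sum_congr rfl fun α _ => Finset.sum_congr rfl fun β _ => ?_
  rw [g.dBilin_symm hn.1 hy, tangPart, tangPart, mul_comm (w _)]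

theorem SymTensor.dBilin_eq_halfJet (g : SymTensor d M) (e : BdChart d M)
    (y u a b : CoordSpace d) :
    g.dBilin e y u a b = halfJet (g.bilin e) 1 [] y a b * u 0 +
      ∑ γ, u γ.succ * halfJet (g.bilin e) 0 [γ] y a b := by
  conv_lhs => rw [eq_sum_tangVec u]
  rw [map_add, map_smul, map_sum]
  simp only [map_smul, add_apply, smul_apply, sum_apply, smul_eq_mul]
  rw [mul_comm]
  rfl

/-- The lowered acceleration is explicit in first derivatives of the metric. As the normal direction
decouples, the index is raised with the inverse of the tangential block alone. -/
theorem SymTensor.IsBoundaryNormal.spray_succ (hn : g.IsBoundaryNormal e)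
    (hg : g.IsMetric kind) (hy : y ∈ (e.extend (𝓡∂ (d + 1))).target) (u : CoordSpace d)
    (α : Fin d) :
    g.spray e (y, u) α.succ = ∑ μ, (g.tangMatrix e y)⁻¹ α μ *
      (1 / 2 * (∑ β, ∑ γ, u β.succ * u γ.succ *
          halfJet (g.bilin e) 0 [μ] y (tangVec β) (tangVec γ))
        - ∑ β, u β.succ * (halfJet (g.bilin e) 1 [] y (tangVec β) (tangVec μ) * u 0
          + ∑ γ, u γ.succ * halfJet (g.bilin e) 0 [γ] y (tangVec β) (tangVec μ))) := by
  have hdet := hn.det_tangMatrix_ne_zero hg hy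
  have h1 : tangPart (g.spray e (y, u)) = (g.tangMatrix e y)⁻¹.mulVec
      ((g.tangMatrix e y).mulVec (tangPart (g.spray e (y, u)))) := by
    rw [Matrix.mulVec_mulVec, Matrix.nonsing_inv_mul _ (isUnit_iff_ne_zero.2 hdet),
      Matrix.one_mulVec]
  have h2 := congrFun h1 α
  rw [tangPart] at h2
  rw [h2, Matrix.mulVec, dotProduct]
  refine Finset.sum_congr rfl fun μ _ => ?_
  rw [← hn.bilin_tangVec hy, hg.bilin_spray hn.1 hy, g.lowSpray_apply]
  congr 1
  have h3 : g.dBilin e y (tangVec μ) u u = ∑ β, ∑ γ, u β.succ * u γ.succ *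
      halfJet (g.bilin e) 0 [μ] y (tangVec β) (tangVec γ) := by
    rw [hn.dBilin_eq_sum hy]
    refine Finset.sum_congr rfl fun β _ => Finset.sum_congr rfl fun γ _ => ?_
    rw [mul_comm]
    rfl
  have h4 : g.dBilin e y u u (tangVec μ) = ∑ β, u β.succ *
      (halfJet (g.bilin e) 1 [] y (tangVec β) (tangVec μ) * u 0
          + ∑ γ, u γ.succ * halfJet (g.bilin e) 0 [γ] y (tangVec β) (tangVec μ)) := by
    rw [hn.dBilin_eq_sum hy]
    refine Finset.sum_congr rfl fun β _ => ?_
    rw [← g.dBilin_eq_halfJet, Finset.sum_eq_single μ]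
    · simp [coordVec, mul_comm]
    · intro γ _ hγ
      simp [coordVec, hγ]
    · simp
  change -(g.dBilin e y u u (tangVec μ) - 1 / 2 * g.dBilin e y (tangVec μ) u u) = _
  rw [h3, h4]
  ring

/-- The values of the jet variables along a curve. -/
def SymTensor.jetField (g : SymTensor d M) (e : BdChart d M) :
    JetVar d → CoordSpace d × CoordSpace d → ℝ
  | .dir α => fun z => z.2 α.succ
  | .inv α β => fun z => (g.tangMatrix e z.1)⁻¹ α β
  -- A default value: the indeterminate `recip` enters only through its base value and has no
  -- equation of motion.
  | .recip => 0
  | .jet k l α β => fun z => halfJet (g.bilin e) k l z.1 (tangVec α) (tangVec β)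

theorem SymTensor.continuousOn_jetField (hn : g.IsBoundaryNormal e) (hg : g.IsMetric kind)
    (i : JetVar d) :
    ContinuousOn (g.jetField e i) {z | z.1 ∈ (e.extend (𝓡∂ (d + 1))).target} := by
  have hjet : ∀ k l α β, ContinuousOn (g.jetField e (.jet k l α β))
      {z | z.1 ∈ (e.extend (𝓡∂ (d + 1))).target} := fun k l α β =>
    (evalForm (tangVec α) (tangVec β)).continuous.comp_continuousOn
      (((g.smoothInChart_bilin hn.1).halfJet k l).continuousOn.comp continuousOn_fst
        (fun z hz => hz))
  cases i with
  | dir α =>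
    exact ((EuclideanSpace.proj (𝕜 := ℝ) (α.succ : Fin (d + 1))).continuous.comp
      continuous_snd).continuousOn
  | inv α β =>
    intro z hz
    have h1 : ContinuousWithinAt (fun z : CoordSpace d × CoordSpace d => g.tangMatrix e z.1)
        {z | z.1 ∈ (e.extend (𝓡∂ (d + 1))).target} z :=
      continuousWithinAt_pi.2 fun i => continuousWithinAt_pi.2 fun j => hjet 0 [] i j z hz
    exact ContinuousAt.comp_continuousWithinAt
      (g := fun B : Matrix (Fin d) (Fin d) ℝ => B⁻¹ α β)
      (Matrix.continuousAt_inv_apply (hn.det_tangMatrix_ne_zero hg hz) α β) h1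
  | recip => exact continuousOn_const
  | jet k l α β => exact hjet k l α β

/-- The outward normal is the constant field -∂ₙ, so only the Christoffel term contributes, with
reversed sign: strict convexity means K < 0. -/
theorem SymTensor.secondForm_eq (hn : g.IsBoundaryNormal e) {x : Fin d → ℝ}
    (hx : coordVec 0 x ∈ (e.extend (𝓡∂ (d + 1))).target) (v : Fin d → ℝ) :
    g.secondForm e x v v = -g.convexityConst e x v := by
  have h1 : g.normalDeriv e 1 x v v =
      g.dBilin e (coordVec 0 x) (coordVec 1 0) (coordVec 0 v) (coordVec 0 v) :=
    g.normalDeriv_eq hn.1 1 hx v v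
  have h2 := hn.dBilin_normal hx (coordVec 0 v) (coordVec 0 v)
  rw [SymTensor.secondForm, SymTensor.covDeriv, g.christoffel_eq hn.1 hx, SymTensor.convexityConst,
    h1]
  simp only [fderivWithin_const_apply, zero_apply, map_neg, neg_apply]
  rw [← g.bilin_apply, map_zero, zero_apply, h2, g.dBilin_symm hn.1 hx _ (coordVec 1 0), h2]
  ring

theorem SymTensor.spray_tangential (hn : g.IsBoundaryNormal e) (hg : g.IsMetric kind)
    {x : Fin d → ℝ} (hx : coordVec 0 x ∈ (e.extend (𝓡∂ (d + 1))).target) (v : Fin d → ℝ) :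
    g.spray e (coordVec 0 x, coordVec 0 v) 0 = g.convexityConst e x v := by
  rw [hn.spray_normal hg hx, SymTensor.convexityConst, g.normalDeriv_eq hn.1 1 hx v v, mul_comm,
    mul_one_div]
  rfl

end Components

/-- The sign of a metric kind, as a rational number. -/
def MetricKind.ratSign : MetricKind → ℚ
  | .riemannian => 1
  | .lorentzian => -1

@[simp]
theorem MetricKind.cast_ratSign (kind : MetricKind) : (kind.ratSign : ℝ) = kind.sign := by
  cases kind <;> simp [MetricKind.ratSign, MetricKind.sign]

namespace ExitFamily

set_option linter.unusedSectionVars false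
set_option maxSynthPendingDepth 3

variable {d : ℕ} {M : Type*} [TopologicalSpace M] [ChartedSpace (EuclideanHalfSpace (d + 1)) M]
  {g : SymTensor d M} {kind : MetricKind} {e : BdChart d M} {x v : Fin d → ℝ}
  (F : ExitFamily g e kind x v)

theorem hasDerivWithinAt_halfJet (he : e ∈ IsManifold.maximalAtlas (𝓡∂ (d + 1)) ∞ M) {ε : ℝ}
    (hε : ε ∈ Ioo 0 F.δ) {t : ℝ} (ht : t ∈ Icc 0 (F.τ ε)) (k : ℕ) (l : List (Fin d))
    (a b : CoordSpace d) :
    HasDerivWithinAt (fun r => halfJet (g.bilin e) k l (F.X ε r).1 a b)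
      (halfJet (g.bilin e) (k + 1) l (F.X ε t).1 a b * (F.X ε t).2 0 +
        ∑ γ, halfJet (g.bilin e) k (γ :: l) (F.X ε t).1 a b * (F.X ε t).2 γ.succ)
      (Icc 0 (F.τ ε)) t := by
  have hgeo := F.isChartGeodesic hε
  have hs := g.smoothInChart_bilin he
  have h1 : HasDerivWithinAt (fun r => halfJet (g.bilin e) k l (F.X ε r).1) _
      (Icc 0 (F.τ ε)) t :=
    HasFDerivWithinAt.comp_hasDerivWithinAt (l := halfJet (g.bilin e) k l) t
      ((hs.halfJet k l).hasFDerivWithinAt (hgeo t ht).1) (hgeo t ht).2.1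
      (fun s hs => e.extend_target_subset_range (hgeo s hs).1)
  have h2 := (evalForm a b).hasFDerivAt.comp_hasDerivWithinAt t h1
  refine h2.congr_deriv ?_
  rw [hs.fderivWithin_halfJet k l (hgeo t ht).1]
  simp only [evalForm_apply, add_apply, smul_apply, sum_apply, smul_eq_mul, mul_comm]

/-- The polynomial system solved by the jets of the metric along the geodesics of the family. -/
def boundaryFlow (hg : g.IsMetric kind) (hn : g.IsBoundaryNormal e)
    (hx : coordVec 0 x ∈ (e.extend (𝓡∂ (d + 1))).target) (hK : g.convexityConst e x v < 0) :
    BoundaryFlow d kind.ratSign where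
  baseVal := g.jetVal e x v
  τ := F.τ
  pos := fun z => (F.X z.1 z.2).1 0
  nvel := fun z => (F.X z.1 z.2).2 0
  jets := fun i z => g.jetField e i (F.X z.1 z.2)
  δ := F.δ
  δ_pos := F.δ_pos
  τ_pos := fun ε hε => (F.τ_mem ε hε).1
  τ_bound := by
    refine IsBigO.of_bound F.bound ?_
    filter_upwards [Ioo_mem_nhdsGT F.δ_pos] with ε hε
    rw [Real.norm_of_nonneg (F.τ_mem ε hε).1.le, Real.norm_of_nonneg hε.1.le]
    exact F.τ_le ε hε
  jets_bound := fun i => by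
    obtain ⟨C, hC⟩ := F.isCompact.exists_bound_of_continuousOn
      ((g.continuousOn_jetField hn hg i).mono F.subset_target)
    refine isBigO_shortTimes_iff.2 ⟨max C 0, le_max_right _ _, ?_⟩
    filter_upwards [Ioo_mem_nhdsGT F.δ_pos] with ε hε t ht
    rw [pow_zero, mul_one]
    exact (hC _ (F.mem ε hε t ht)).trans (le_max_left _ _)
  pos_zero := fun ε hε => by simp [F.zero ε hε]
  pos_τ := fun ε hε => F.exit ε hε
  nvel_zero := fun ε hε => by simp [F.zero ε hε, tiltedDir]
  dir_zero := fun ε hε α => by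
    simp [F.zero ε hε, tiltedDir, SymTensor.jetField, SymTensor.jetVal, coordVec]
  inv_zero := fun ε hε α β => by
    simp only [F.zero ε hε]
    rfl
  jet_zero := fun ε hε k l α β => by
    simp only [F.zero ε hε]
    exact (g.jetVal_jet hn.1 hx v k l α β).symm
  pos_deriv := fun ε hε t ht =>
    (EuclideanSpace.proj (𝕜 := ℝ) (0 : Fin (d + 1))).hasFDerivAt.comp_hasDerivWithinAt t
      (F.isChartGeodesic hε t ht).2.1
  nvel_deriv := fun ε hε t ht => by
    have hgeo := F.isChartGeodesic hε t ht
    have h : HasDerivWithinAt (fun r => (F.X ε r).2 0) (g.spray e (F.X ε t) 0) (Icc 0 (F.τ ε)) t :=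
      (EuclideanSpace.proj (𝕜 := ℝ) (0 : Fin (d + 1))).hasFDerivAt.comp_hasDerivWithinAt t hgeo.2.2
    refine h.congr_deriv ?_
    exact (hn.spray_normal hg hgeo.1 _).trans (by rw [hn.dBilin_eq_sum hgeo.1]; rfl)
  dir_deriv := fun ε hε t ht α => by
    have hgeo := F.isChartGeodesic hε t ht
    have h : HasDerivWithinAt (fun r => (F.X ε r).2 α.succ) (g.spray e (F.X ε t) α.succ)
        (Icc 0 (F.τ ε)) t :=
      (EuclideanSpace.proj (𝕜 := ℝ) (α.succ : Fin (d + 1))).hasFDerivAt.comp_hasDerivWithinAt t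
        hgeo.2.2
    exact h.congr_deriv (hn.spray_succ hg hgeo.1 _ α)
  inv_deriv := fun ε hε t ht α β =>
    Matrix.hasDerivWithinAt_inv_apply (A := fun r => g.tangMatrix e (F.X ε r).1)
      (A' := Matrix.of fun γ μ => _)
      (fun i j => F.hasDerivWithinAt_halfJet hn.1 hε ht 0 [] (tangVec i) (tangVec j)) ht
      (fun r hr => hn.det_tangMatrix_ne_zero hg (F.isChartGeodesic hε r hr).1) α β
  jet_deriv := fun ε hε t ht k l α β =>
    F.hasDerivWithinAt_halfJet hn.1 hε ht k l (tangVec α) (tangVec β)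
  convex := by
    have h := g.normalDeriv_eq_sum hn.1 1 hx v v
    rw [SymTensor.convexityConst, h] at hK
    change ∑ α, ∑ β, g.normalDeriv e 1 x (Pi.single α 1) (Pi.single β 1) * (v α * v β) < 0
    linarith
  recip_eq := by
    have h := g.normalDeriv_eq_sum hn.1 1 hx v v
    change (g.convexityConst e x v)⁻¹ = (1 / 2 * ∑ α, ∑ β,
      g.normalDeriv e 1 x (Pi.single α 1) (Pi.single β 1) * (v α * v β))⁻¹
    rw [SymTensor.convexityConst, h]
    ring

end ExitFamily
end

noncomputable section

/-! ### Reparametrization of geodesics -/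

section Scaling

set_option linter.unusedSectionVars false
set_option maxSynthPendingDepth 3

variable {d : ℕ} {M : Type*} [TopologicalSpace M] [ChartedSpace (EuclideanHalfSpace (d + 1)) M]
  {g : SymTensor d M} {e : BdChart d M} {γ : ℝ → M} {T c : ℝ}

theorem mapsTo_mul_Icc (hc : 0 < c) : MapsTo (fun t => c * t) (Icc 0 (T / c)) (Icc 0 T) :=
  fun t ht => ⟨mul_nonneg hc.le ht.1, by
    have := mul_le_mul_of_nonneg_left ht.2 hc.le
    rwa [mul_div_cancel₀ _ hc.ne'] at this⟩

theorem HasDerivWithinAt.comp_mul_Icc {E : Type*} [NormedAddCommGroup E] [NormedSpace ℝ E]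
    {f : ℝ → E} {f' : E} {t : ℝ} (hc : 0 < c) (h : HasDerivWithinAt f f' (Icc 0 T) (c * t)) :
    HasDerivWithinAt (fun r => f (c * r)) (c • f') (Icc 0 (T / c)) t := by
  have h1 : HasDerivWithinAt (fun r : ℝ => c * r) c (Icc 0 (T / c)) t := by
    simpa using ((hasDerivAt_id t).const_mul c).hasDerivWithinAt
  exact h.scomp t h1 (mapsTo_mul_Icc hc)

theorem SymTensor.IsGeodesic.comp_mul (hγ : g.IsGeodesic γ T) (hc : 0 < c) :
    g.IsGeodesic (fun t => γ (c * t)) (T / c) := by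
  refine ⟨hγ.1.comp (by fun_prop) (mapsTo_mul_Icc hc), fun e' he' t ht hte => ?_⟩
  obtain ⟨u, a, h1, h2, h3⟩ := hγ.2 e' he' (c * t) (mapsTo_mul_Icc hc ht) hte
  have htend : Tendsto (fun t => c * t) (𝓝[Icc 0 (T / c)] t) (𝓝[Icc 0 T] (c * t)) :=
    tendsto_nhdsWithin_of_tendsto_nhds_of_eventually_within _
      ((by fun_prop : Continuous fun t => c * t).continuousAt.continuousWithinAt)
      (eventually_mem_nhdsWithin.mono fun s hs => mapsTo_mul_Icc hc hs)
  have hx : e'.extend (𝓡∂ (d + 1)) (γ (c * t)) ∈ (e'.extend (𝓡∂ (d + 1))).target :=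
    (e'.extend (𝓡∂ (d + 1))).map_source (by rwa [e'.extend_source])
  refine ⟨fun s => c • u (c * s), c • c • a, ?_, ?_, fun w => ?_⟩
  · filter_upwards [htend.eventually h1] with s hs
    exact hs.comp_mul_Icc hc
  · exact (h2.comp_mul_Icc hc).const_smul c
  · have h4 := h3 w
    rw [g.christoffel_eq he' hx, ← g.bilin_apply] at h4 ⊢
    simp only [map_smul, smul_apply, smul_eq_mul]
    linear_combination c ^ 2 * h4

theorem SymTensor.IsGeodesicFrom.comp_mul {x : Fin d → ℝ} {w : CoordSpace d}
    (hγ : g.IsGeodesicFrom e x w γ T) (hc : 0 < c) :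
    g.IsGeodesicFrom e x (c • w) (fun t => γ (c * t)) (T / c) := by
  refine ⟨hγ.1.comp_mul hc, hγ.2.1, by simpa using hγ.2.2.1, ?_⟩
  have h : HasDerivWithinAt (fun r => e.extend (𝓡∂ (d + 1)) (γ r)) w (Icc 0 T) (c * 0) := by
    rw [mul_zero]; exact hγ.2.2.2
  exact h.comp_mul_Icc hc

/-- The expansion needs unit directions, while the scattering relation is given near an arbitrary
convex direction; rescaling time passes between the two. -/
theorem SymTensor.ExitsAt.smul {x y : Fin d → ℝ} {w η : CoordSpace d}
    (h : g.ExitsAt e x w T y η) (hc : 0 < c) : g.ExitsAt e x (c • w) (T / c) y (c • η) := by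
  obtain ⟨hT, ⟨γ, hγ, hγe, hγy, hγη⟩, hmax⟩ := h
  have hcT : c * (T / c) = T := mul_div_cancel₀ _ hc.ne'
  refine ⟨div_pos hT hc, ⟨fun t => γ (c * t), hγ.comp_mul hc, ?_, ?_, ?_⟩, ?_⟩
  · simpa only [hcT] using hγe
  · simpa only [hcT] using hγy
  · rw [← hcT] at hγη
    have h := hγη.comp_mul_Icc (c := c) (T := c * (T / c)) hc
    rwa [hcT] at h
  · rintro T' hT' ⟨γ', hγ'⟩
    refine hmax (T' / c⁻¹) ?_ ⟨fun t => γ' (c⁻¹ * t), ?_⟩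
    · rw [div_inv_eq_mul]
      exact (div_lt_iff₀ hc).1 hT'
    · have := hγ'.comp_mul (inv_pos.2 hc)
      rwa [inv_smul_smul₀ hc.ne'] at this

end Scaling

namespace ExitFamily

set_option linter.unusedSectionVars false

variable {d : ℕ} {M : Type*} [TopologicalSpace M] [ChartedSpace (EuclideanHalfSpace (d + 1)) M]
  {g : SymTensor d M} {kind : MetricKind} {e : BdChart d M} {x v : Fin d → ℝ}
  (F : ExitFamily g e kind x v)

theorem tendsto_τ : Tendsto F.τ (𝓝[>] 0) (𝓝 0) := by
  have h1 : Tendsto (fun ε : ℝ => F.bound * ε) (𝓝[>] 0) (𝓝 0) := by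
    have : Tendsto (fun ε : ℝ => F.bound * ε) (𝓝 0) (𝓝 (F.bound * 0)) :=
      (continuous_const.mul continuous_id).tendsto 0
    rw [mul_zero] at this
    exact this.mono_left nhdsWithin_le_nhds
  refine squeeze_zero' ?_ ?_ h1
  · filter_upwards [Ioo_mem_nhdsGT F.δ_pos] with ε hε using (F.τ_mem ε hε).1.le
  · filter_upwards [Ioo_mem_nhdsGT F.δ_pos] with ε hε using F.τ_le ε hε

theorem tendsto_exit :
    Tendsto (fun ε => tangPart (F.X ε (F.τ ε)).1) (𝓝[>] 0) (𝓝 x) := by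
  obtain ⟨C, hC⟩ := F.isCompact.exists_bound_of_continuousOn (f := Prod.snd) continuousOn_snd
  have hX : Tendsto (fun ε => (F.X ε (F.τ ε)).1) (𝓝[>] 0) (𝓝 (coordVec 0 x)) := by
    rw [tendsto_iff_norm_sub_tendsto_zero]
    refine squeeze_zero' (Eventually.of_forall fun _ => norm_nonneg _) ?_
      (by simpa using F.tendsto_τ.const_mul C)
    filter_upwards [Ioo_mem_nhdsGT F.δ_pos] with ε hε
    have hgeo := F.isChartGeodesic hε
    have h := norm_image_sub_le_of_norm_deriv_le_segment' (f := fun t => (F.X ε t).1)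
      (C := C) (fun t ht => (hgeo t ht).2.1)
      (fun t ht => hC _ (F.mem ε hε t (Ico_subset_Icc_self ht))) (F.τ ε)
      ⟨(F.τ_mem ε hε).1.le, le_rfl⟩
    rw [sub_zero] at h
    simpa only [F.zero ε hε] using h
  have hcont : Continuous (tangPart : CoordSpace d → Fin d → ℝ) :=
    continuous_pi fun α => (EuclideanSpace.proj (𝕜 := ℝ) (α.succ : Fin (d + 1))).continuous
  have := (hcont.tendsto (coordVec 0 x)).comp hX
  rw [tangPart_coordVec] at this
  exact this

end ExitFamily

/-- Two functions with the same expansion data have the same coefficients. -/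
theorem expansion_coeff_unique {τ : ℝ → ℝ} {a b : ℕ → ℝ}
    (ha : ∀ N : ℕ, (fun ε => τ ε - ∑ k ∈ Finset.range (N + 1), a k * ε ^ k)
      =O[𝓝[>] 0] fun ε => ε ^ (N + 1))
    (hb : ∀ N : ℕ, (fun ε => τ ε - ∑ k ∈ Finset.range (N + 1), b k * ε ^ k)
      =O[𝓝[>] 0] fun ε => ε ^ (N + 1)) : a = b := by
  ext n
  have h := (hb n).sub (ha n)
  set p : Polynomial ℝ := ∑ k ∈ Finset.range (n + 1), Polynomial.C (a k - b k) * Polynomial.X ^ k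
    with hp
  have hpe : p.eval =O[𝓝[>] 0] fun ε : ℝ => ε ^ (n + 1) := by
    refine h.congr_left fun ε => ?_
    simp only [hp, Polynomial.eval_finsetSum, Polynomial.eval_mul, Polynomial.eval_C,
      Polynomial.eval_pow, Polynomial.eval_X, sub_mul, Finset.sum_sub_distrib]
    ring
  have h0 := Polynomial.coeff_eq_zero_of_isBigO hpe n (Nat.lt_succ_self n)
  have h1 : p.coeff n = a n - b n := by
    rw [hp, Polynomial.finsetSum_coeff]
    simp only [Polynomial.coeff_C_mul_X_pow]
    simp
  exact sub_eq_zero.1 (h1 ▸ h0)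

end

noncomputable section

/-! ### Expansion of the exit time and determination of the normal jet -/

/-- The polynomials in the lower order jets that enter the expansion of the exit time. -/
def coeffPoly (d : ℕ) (s : ℚ) : ℕ → MvPolynomial (JetVar d) ℚ :=
  (BoundaryFlow.exists_coefficients d s).choose

theorem normalOrder_lt_of_mem_vars_coeffPoly {d : ℕ} {s : ℚ} {m : ℕ} {i : JetVar d}
    (hi : i ∈ (coeffPoly d s m).vars) : i.normalOrder < m :=
  (BoundaryFlow.exists_coefficients d s).choose_spec.1 m i hi

section Determination

set_option linter.unusedSectionVars false
set_option maxSynthPendingDepth 3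

variable {d : ℕ} {M : Type*} [TopologicalSpace M] [ChartedSpace (EuclideanHalfSpace (d + 1)) M]
  {g : SymTensor d M} {kind : MetricKind} {e : BdChart d M} {x v : Fin d → ℝ}

theorem ExitFamily.exists_expansion (F : ExitFamily g e kind x v) (hg : g.IsMetric kind)
    (hn : g.IsBoundaryNormal e) (hx : coordVec 0 x ∈ (e.extend (𝓡∂ (d + 1))).target)
    (hK : g.convexityConst e x v < 0) :
    ∃ a : ℕ → ℝ,
      (∀ N : ℕ, (fun ε => F.τ ε - ∑ k ∈ Finset.range (N + 1), a k * ε ^ k)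
        =O[𝓝[>] 0] fun ε => ε ^ (N + 1)) ∧
      a 0 = 0 ∧ a 1 = -2 / g.convexityConst e x v ∧
      ∀ m, 2 ≤ m → a (2 * m - 1) =
        1 / 2 * (-2 / g.convexityConst e x v) ^ (m + 1)
            * ((m.factorial : ℝ) / ((2 * m).factorial : ℝ)) * g.normalDeriv e m x v v
          + MvPolynomial.aeval (g.jetVal e x v) (coeffPoly d kind.ratSign m) := by
  obtain ⟨a, h1, h2, h3, h4⟩ := (BoundaryFlow.exists_coefficients d kind.ratSign).choose_spec.2
    (F.boundaryFlow hg hn hx hK)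
  have htop : ∀ m, (F.boundaryFlow hg hn hx hK).topJet m = g.normalDeriv e m x v v := fun m =>
    (g.normalDeriv_eq_sum hn.1 m hx v v).symm
  have hKK : (F.boundaryFlow hg hn hx hK).K = g.convexityConst e x v := by
    have h := htop 1
    rw [BoundaryFlow.topJet] at h
    rw [BoundaryFlow.K, h, SymTensor.convexityConst]
    ring
  rw [hKK] at h3
  refine ⟨a, h1, h2, h3, fun m hm => ?_⟩
  have h5 := h4 m hm
  rw [hKK, htop] at h5
  exact h5

theorem iterPartial_congr {f f' : (Fin d → ℝ) → ℝ} (h : f =ᶠ[𝓝 x] f') (l : List (Fin d)) :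
    iterPartial l f =ᶠ[𝓝 x] iterPartial l f' := by
  induction l with
  | nil => exact h
  | cons α l ih =>
    filter_upwards [ih.eventuallyEq_nhds] with y hy
    change fderiv ℝ (iterPartial l f) y (Pi.single α 1) =
      fderiv ℝ (iterPartial l f') y (Pi.single α 1)
    rw [hy.fderiv_eq]

theorem SymTensor.normalDeriv_symm (g : SymTensor d M) (e : BdChart d M) (m : ℕ)
    (x u w : Fin d → ℝ) : g.normalDeriv e m x u w = g.normalDeriv e m x w u := by
  simp only [SymTensor.normalDeriv, g.inChart_symm e _ (coordVec 0 u)]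

theorem SymTensor.normalDeriv_zero (g : SymTensor d M) (e : BdChart d M) (x u w : Fin d → ℝ) :
    g.normalDeriv e 0 x u w = g.bdMetric e x u w := by
  simp [SymTensor.normalDeriv, SymTensor.bdMetric]

theorem SymTensor.normalDeriv_smul (g : SymTensor d M)
    (he : e ∈ IsManifold.maximalAtlas (𝓡∂ (d + 1)) ∞ M) (m : ℕ)
    (hx : coordVec 0 x ∈ (e.extend (𝓡∂ (d + 1))).target) (c : ℝ) (u : Fin d → ℝ) :
    g.normalDeriv e m x (c • u) (c • u) = c ^ 2 * g.normalDeriv e m x u u := by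
  rw [g.normalDeriv_eq_sum he m hx, g.normalDeriv_eq_sum he m hx u u, Finset.mul_sum]
  refine Finset.sum_congr rfl fun α _ => ?_
  rw [Finset.mul_sum]
  refine Finset.sum_congr rfl fun β _ => ?_
  simp only [Pi.smul_apply, smul_eq_mul]
  ring

/-- The metric `g` gives rise to the boundary metric `h` and to the scattering relation `S` near
the strictly convex direction `(x, v)`. -/
structure SymTensor.IsDatum (g : SymTensor d M) (kind : MetricKind) (e : BdChart d M)
    (h : (Fin d → ℝ) → (Fin d → ℝ) → (Fin d → ℝ) → ℝ)
    (S : (Fin d → ℝ) → CoordSpace d → (Fin d → ℝ) → CoordSpace d → Prop) (x v : Fin d → ℝ) :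
    Prop where
  isMetric : g.IsMetric kind
  isBoundaryNormal : g.IsBoundaryNormal e
  mem_target : coordVec 0 x ∈ (e.extend (𝓡∂ (d + 1))).target
  convex : 0 < g.secondForm e x v v
  timelike : kind = MetricKind.lorentzian → g.bdMetric e x v v < 0
  bdMetric_eq : ∀ᶠ y in 𝓝 x, ∀ u w, h y u w = g.bdMetric e y u w
  scatters_iff : ∀ᶠ q in 𝓝 (x, coordVec 0 v), 0 < q.2 0 →
    ∀ y w, S q.1 q.2 y w ↔ g.Scatters e q.1 q.2 y w

variable {h : (Fin d → ℝ) → (Fin d → ℝ) → (Fin d → ℝ) → ℝ}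
  {S : (Fin d → ℝ) → CoordSpace d → (Fin d → ℝ) → CoordSpace d → Prop}

/-- Strict convexity, the timelike condition and agreement of the data near a point are all open, so
the determination applies at every nearby boundary point and direction. -/
theorem SymTensor.IsDatum.eventually (hD : g.IsDatum kind e h S x v) :
    ∀ᶠ p in 𝓝 (x, v), g.IsDatum kind e h S p.1 p.2 := by
  have hn := hD.isBoundaryNormal
  have hs := g.smoothInChart_bilin hn.1
  have hfst : Tendsto (Prod.fst : (Fin d → ℝ) × (Fin d → ℝ) → Fin d → ℝ) (𝓝 (x, v)) (𝓝 x) :=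
    continuousAt_fst
  have htar : ∀ᶠ p : (Fin d → ℝ) × (Fin d → ℝ) in 𝓝 (x, v),
      coordVec 0 p.1 ∈ (e.extend (𝓡∂ (d + 1))).target :=
    hfst.eventually ((isOpen_boundary_target e).mem_nhds hD.mem_target)
  have hcont : ∀ m, ContinuousAt (fun p : (Fin d → ℝ) × (Fin d → ℝ) =>
      halfJet (g.bilin e) m [] (coordVec 0 p.1) (coordVec 0 p.2) (coordVec 0 p.2)) (x, v) := by
    intro m
    have h1 : ContinuousAt (fun p : (Fin d → ℝ) × (Fin d → ℝ) =>
        halfJet (g.bilin e) m [] (coordVec 0 p.1)) (x, v) := by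
      have h2 : ContinuousWithinAt (fun p : (Fin d → ℝ) × (Fin d → ℝ) =>
          halfJet (g.bilin e) m [] (coordVec 0 p.1)) univ (x, v) :=
        ContinuousWithinAt.comp (t := halfSpace d) (g := halfJet (g.bilin e) m [])
          (f := fun p : (Fin d → ℝ) × (Fin d → ℝ) => coordVec 0 p.1)
          ((hs.halfJet m []) _ hD.mem_target).continuousWithinAt
          ((tangIncl d).continuous.comp continuous_fst).continuousWithinAt
          (fun p _ => coordVec_mem_halfSpace le_rfl p.1)
      exact continuousWithinAt_univ _ _ |>.1 h2
    have h2 : ContinuousAt (fun p : (Fin d → ℝ) × (Fin d → ℝ) => coordVec 0 p.2) (x, v) :=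
      ((tangIncl d).continuous.comp continuous_snd).continuousAt
    exact (h1.clm_apply h2).clm_apply h2
  have hconv : ∀ᶠ p : (Fin d → ℝ) × (Fin d → ℝ) in 𝓝 (x, v), 0 < g.secondForm e p.1 p.2 p.2 := by
    have hneg : halfJet (g.bilin e) 1 [] (coordVec 0 x) (coordVec 0 v) (coordVec 0 v) < 0 := by
      have h1 := hD.convex
      rw [SymTensor.secondForm_eq hn hD.mem_target, SymTensor.convexityConst,
        g.normalDeriv_eq hn.1 1 hD.mem_target] at h1
      linarith
    filter_upwards [htar, (hcont 1).eventually (gt_mem_nhds hneg)] with p hp hp'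
    rw [SymTensor.secondForm_eq hn hp, SymTensor.convexityConst, g.normalDeriv_eq hn.1 1 hp]
    linarith
  have htime : ∀ᶠ p : (Fin d → ℝ) × (Fin d → ℝ) in 𝓝 (x, v),
      kind = MetricKind.lorentzian → g.bdMetric e p.1 p.2 p.2 < 0 := by
    by_cases hk : kind = MetricKind.lorentzian
    · filter_upwards [(hcont 0).eventually (gt_mem_nhds (hD.timelike hk))] with p hp _ using hp
    · exact Eventually.of_forall fun p h => (hk h).elim
  have hbd := hfst.eventually (eventually_eventually_nhds.2 hD.bdMetric_eq)
  have hsc : ∀ᶠ p : (Fin d → ℝ) × (Fin d → ℝ) in 𝓝 (x, v), ∀ᶠ q in 𝓝 (p.1, coordVec 0 p.2),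
      0 < q.2 0 → ∀ y w, S q.1 q.2 y w ↔ g.Scatters e q.1 q.2 y w := by
    have h1 : ContinuousAt (fun p : (Fin d → ℝ) × (Fin d → ℝ) => (p.1, coordVec 0 p.2)) (x, v) :=
      continuousAt_fst.prodMk ((tangIncl d).continuous.comp continuous_snd).continuousAt
    exact h1.eventually (eventually_eventually_nhds.2 hD.scatters_iff)
  filter_upwards [htar, hconv, htime, hbd, hsc] with p h1 h2 h3 h4 h5
  exact ⟨hD.isMetric, hn, h1, h2, h3, h4, h5⟩

theorem SymTensor.bdMetric_smul (g : SymTensor d M) (e : BdChart d M) (c : ℝ)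
    (x v : Fin d → ℝ) : g.bdMetric e x (c • v) (c • v) = c ^ 2 * g.bdMetric e x v v := by
  have h1 : coordVec 0 (c • v) = c • coordVec 0 v := (tangIncl d).map_smul c v
  rw [SymTensor.bdMetric, h1, ← g.bilin_apply, map_smul, map_smul, smul_apply]
  change c * (c * g.bdMetric e x v v) = _
  ring

/-- In the Riemannian case strict convexity excludes `v = 0`; in the Lorentzian case this is the
timelike hypothesis. -/
theorem SymTensor.IsDatum.sign_mul_pos (hD : g.IsDatum kind e h S x v) :
    0 < kind.sign * g.bdMetric e x v v := by
  cases hk : kind with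
  | lorentzian =>
    have := hD.timelike hk
    simp only [MetricKind.sign]
    linarith
  | riemannian =>
    have hn := hD.isBoundaryNormal
    have hv : v ≠ 0 := by
      rintro rfl
      have h1 := hD.convex
      rw [SymTensor.secondForm_eq hn hD.mem_target, SymTensor.convexityConst,
        g.normalDeriv_eq_sum hn.1 1 hD.mem_target] at h1
      simp at h1
    have hg := hD.isMetric
    subst hk
    rw [MetricKind.sign, one_mul]
    refine hg _ _ fun h0 => hv ?_
    have h1 := mfderiv_mfderivWithin_extend_symm_apply hn.1 hD.mem_target (coordVec 0 v)
    have h2 : (coordVec 0 v : CoordSpace d) = 0 :=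
      h1.symm.trans ((congrArg _ h0).trans (map_zero _))
    have h3 := congrArg tangPart h2
    rw [tangPart_coordVec] at h3
    rw [h3]
    rfl

/-- Normalization of a strictly convex direction. -/
theorem SymTensor.IsDatum.exists_unit (hD : g.IsDatum kind e h S x v) :
    0 < √(kind.sign * h x v v) ∧
    g.bdMetric e x ((√(kind.sign * h x v v))⁻¹ • v) ((√(kind.sign * h x v v))⁻¹ • v)
      = kind.sign := by
  have hpos := hD.sign_mul_pos
  have hh : h x v v = g.bdMetric e x v v := hD.bdMetric_eq.self_of_nhds v v
  rw [hh]
  refine ⟨Real.sqrt_pos.2 hpos, ?_⟩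
  rw [g.bdMetric_smul, inv_pow, Real.sq_sqrt hpos.le, inv_mul_eq_iff_eq_mul₀ hpos.ne']
  linear_combination -g.bdMetric e x v v * kind.sign_mul_self

/-- Averaging b at v + tu and v - tu leaves t²b(u, u), so vanishing on an open set of directions
suffices for polarization. -/
theorem LinearMap.eq_zero_of_eventually_diag_eq_zero {E : Type*} [NormedAddCommGroup E]
    [NormedSpace ℝ E] {b : E →ₗ[ℝ] E →ₗ[ℝ] ℝ} (hsymm : ∀ u w, b u w = b w u) {v : E}
    (hb : ∀ᶠ w in 𝓝 v, b w w = 0) (u w : E) : b u w = 0 := by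
  have hdiag : ∀ u, b u u = 0 := by
    intro u
    have hc : ∀ s : ℝ, Tendsto (fun t : ℝ => v + (s * t) • u) (𝓝[>] 0) (𝓝 v) := by
      intro s
      have : Tendsto (fun t : ℝ => v + (s * t) • u) (𝓝 0) (𝓝 (v + (s * 0) • u)) :=
        Continuous.tendsto (by fun_prop) 0
      rw [mul_zero, zero_smul, add_zero] at this
      exact this.mono_left nhdsWithin_le_nhds
    obtain ⟨t, ht1, ht2, ht⟩ := (((hc 1).eventually hb).and
      (((hc (-1)).eventually hb).and self_mem_nhdsWithin)).exists
    have h0 := hb.self_of_nhds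
    simp only [map_add, map_smul, LinearMap.add_apply, LinearMap.smul_apply, smul_eq_mul, h0]
      at ht1 ht2
    have ht' : t ^ 2 ≠ 0 := pow_ne_zero 2 (ne_of_gt ht)
    refine (mul_eq_zero_iff_left ht').1 ?_
    linear_combination (ht1 + ht2) / 2
  have h1 := hdiag (u + w)
  simp only [map_add, LinearMap.add_apply, hdiag, hsymm w u] at h1
  linarith

end Determination
end

/-! ### Metrics with the same data have the same normal jet -/

noncomputable section

section Uniqueness

set_option linter.unusedSectionVars false
set_option maxSynthPendingDepth 3

variable {d : ℕ} {kind : MetricKind} {x v : Fin d → ℝ}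
  {M₁ : Type*} [TopologicalSpace M₁] [ChartedSpace (EuclideanHalfSpace (d + 1)) M₁]
  {g₁ : SymTensor d M₁} {e₁ : BdChart d M₁}
  {M₂ : Type*} [TopologicalSpace M₂] [ChartedSpace (EuclideanHalfSpace (d + 1)) M₂]
  {g₂ : SymTensor d M₂} {e₂ : BdChart d M₂}
  {h : (Fin d → ℝ) → (Fin d → ℝ) → (Fin d → ℝ) → ℝ}
  {S : (Fin d → ℝ) → CoordSpace d → (Fin d → ℝ) → CoordSpace d → Prop}

/-- Metrics with the same scattering relation have the same exit points and velocities. -/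
theorem SymTensor.IsDatum.eventually_exit_eq [T2Space M₁] [T2Space M₂]
    (h₁ : g₁.IsDatum kind e₁ h S x v) (h₂ : g₂.IsDatum kind e₂ h S x v) {c : ℝ} (hc : 0 < c)
    (F₁ : ExitFamily g₁ e₁ kind x (c⁻¹ • v)) (F₂ : ExitFamily g₂ e₂ kind x (c⁻¹ • v)) :
    ∀ᶠ ε in 𝓝[>] (0 : ℝ), tangPart (F₁.X ε (F₁.τ ε)).1 = tangPart (F₂.X ε (F₂.τ ε)).1 ∧
      (F₁.X ε (F₁.τ ε)).2 = (F₂.X ε (F₂.τ ε)).2 := by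
  -- Rescaled by c, the unit directions converge to v and enter the region where S is the scattering
  -- relation of both metrics.
  have htend : Tendsto (fun ε => (x, c • tiltedDir kind (c⁻¹ • v) ε)) (𝓝[>] 0)
      (𝓝 (x, coordVec 0 v)) := by
    obtain ⟨w, hw⟩ := exists_hasDerivAt_tiltedDir kind (c⁻¹ • v) le_rfl one_pos
    have h1 : Tendsto (fun ε => c • tiltedDir kind (c⁻¹ • v) ε) (𝓝 0)
        (𝓝 (c • tiltedDir kind (c⁻¹ • v) 0)) := hw.continuousAt.const_smul c
    have h2 : c • tiltedDir kind (c⁻¹ • v) 0 = coordVec 0 v := by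
      rw [tiltedDir_zero, ← tangIncl_apply, ← map_smul, smul_inv_smul₀ hc.ne', tangIncl_apply]
    rw [h2] at h1
    exact tendsto_const_nhds.prodMk_nhds (h1.mono_left nhdsWithin_le_nhds)
  filter_upwards [htend.eventually h₁.scatters_iff, htend.eventually h₂.scatters_iff,
    Ioo_mem_nhdsGT F₁.δ_pos, Ioo_mem_nhdsGT F₂.δ_pos] with ε hs1 hs2 hε1 hε2
  have hpos : 0 < (c • tiltedDir kind (c⁻¹ • v) ε) 0 := by
    simpa [tiltedDir] using mul_pos hc hε1.1
  have hex := (F₁.exitsAt h₁.isMetric h₁.isBoundaryNormal.1 hε1).1.smul hc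
  obtain ⟨T', hT'⟩ := (hs2 hpos _ _).1 ((hs1 hpos _ _).2 ⟨_, hex⟩)
  have hT'' := hT'.smul (inv_pos.2 hc)
  rw [inv_smul_smul₀ hc.ne', inv_smul_smul₀ hc.ne'] at hT''
  exact ((F₂.exitsAt h₂.isMetric h₂.isBoundaryNormal.1 hε2).2 _ _ _ hT'').2

/-- Metrics with the same boundary metric and scattering relation have the same exit times. -/
theorem SymTensor.IsDatum.eventually_exitTime_eq [T2Space M₁] [T2Space M₂]
    (h₁ : g₁.IsDatum kind e₁ h S x v) (h₂ : g₂.IsDatum kind e₂ h S x v) {c : ℝ} (hc : 0 < c)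
    (hu₁ : g₁.bdMetric e₁ x (c⁻¹ • v) (c⁻¹ • v) = kind.sign)
    (hu₂ : g₂.bdMetric e₂ x (c⁻¹ • v) (c⁻¹ • v) = kind.sign)
    (F₁ : ExitFamily g₁ e₁ kind x (c⁻¹ • v)) (F₂ : ExitFamily g₂ e₂ kind x (c⁻¹ • v)) :
    F₁.τ =ᶠ[𝓝[>] 0] F₂.τ := by
  have hev : ∀ᶠ ε in 𝓝[>] (0 : ℝ), (tangPart (F₁.X ε (F₁.τ ε)).1 = tangPart (F₂.X ε (F₂.τ ε)).1 ∧
      (F₁.X ε (F₁.τ ε)).2 = (F₂.X ε (F₂.τ ε)).2) ∧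
      (∀ u w, g₁.bdMetric e₁ (tangPart (F₁.X ε (F₁.τ ε)).1) u w =
        g₂.bdMetric e₂ (tangPart (F₁.X ε (F₁.τ ε)).1) u w) ∧ ε < F₁.δ ∧ ε < F₂.δ := by
    filter_upwards [h₁.eventually_exit_eq h₂ hc F₁ F₂, F₁.tendsto_exit.eventually h₁.bdMetric_eq,
      F₁.tendsto_exit.eventually h₂.bdMetric_eq, Ioo_mem_nhdsGT F₁.δ_pos, Ioo_mem_nhdsGT F₂.δ_pos]
      with ε a1 a2 a3 a4 a5
    exact ⟨a1, fun u w => (a2 u w).symm.trans (a3 u w), a4.2, a5.2⟩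
  obtain ⟨δ, hδ, hsub⟩ := mem_nhdsGT_iff_exists_Ioo_subset.1 hev
  have hδ : 0 < δ := hδ
  -- Exit points agree on a whole interval of ε, hence also their derivatives; with equal exit
  -- velocities and boundary metrics the first variation formula gives both exit times the same
  -- derivative.
  have hderiv : ∀ ε ∈ Ioo 0 δ, HasDerivAt (fun ε => F₁.τ ε - F₂.τ ε) 0 ε := by
    intro ε hε
    obtain ⟨⟨hy, hη⟩, hm, hδ1, hδ2⟩ := hsub hε
    obtain ⟨y₁, hy₁, hτ₁⟩ := F₁.exists_hasDerivAt h₁.isMetric h₁.isBoundaryNormal h₁.mem_target hu₁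
      ⟨hε.1, hδ1⟩
    obtain ⟨y₂, hy₂, hτ₂⟩ := F₂.exists_hasDerivAt h₂.isMetric h₂.isBoundaryNormal h₂.mem_target hu₂
      ⟨hε.1, hδ2⟩
    have hyy : y₁ = y₂ := by
      refine hy₁.unique (hy₂.congr_of_eventuallyEq ?_)
      filter_upwards [Ioo_mem_nhds hε.1 hε.2] with r hr using (hsub hr).1.1
    refine (hτ₁.sub hτ₂).congr_deriv ?_
    rw [hm, hyy, hy, hη, sub_self]
  have hconst : ∀ ε ∈ Ioo 0 δ, ∀ r ∈ Ioo 0 ε, F₁.τ r - F₂.τ r = F₁.τ ε - F₂.τ ε := by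
    intro ε hε r hr
    have hI : Icc r ε ⊆ Ioo 0 δ := fun s hs => ⟨hr.1.trans_le hs.1, hs.2.trans_lt hε.2⟩
    obtain ⟨ξ, -, hξ⟩ := exists_hasDerivAt_eq_slope (fun ε => F₁.τ ε - F₂.τ ε) (fun _ => 0) hr.2
      (fun s hs => (hderiv s (hI hs)).continuousAt.continuousWithinAt)
      (fun s hs => hderiv s (hI (Ioo_subset_Icc_self hs)))
    rw [eq_comm, div_eq_zero_iff] at hξ
    rcases hξ with hξ | hξ
    · exact (sub_eq_zero.1 hξ).symm
    · linarith [hr.2]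
  filter_upwards [Ioo_mem_nhdsGT hδ] with ε hε
  -- The constant difference is 0, since both exit times tend to 0 with ε.
  have h1 : Tendsto (fun r => F₁.τ r - F₂.τ r) (𝓝[>] 0) (𝓝 (F₁.τ ε - F₂.τ ε)) := by
    refine tendsto_const_nhds.congr' ?_
    filter_upwards [Ioo_mem_nhdsGT hε.1] with r hr using (hconst ε hε r hr).symm
  have h2 := tendsto_nhds_unique h1 (F₁.tendsto_τ.sub F₂.tendsto_τ)
  rw [sub_zero] at h2
  exact sub_eq_zero.1 h2

theorem SymTensor.IsDatum.exists_exitFamily (h₁ : g₁.IsDatum kind e₁ h S x v) {c : ℝ}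
    (hc : 0 < c) : g₁.convexityConst e₁ x (c⁻¹ • v) < 0 ∧
      Nonempty (ExitFamily g₁ e₁ kind x (c⁻¹ • v)) := by
  have hn := h₁.isBoundaryNormal
  have hK : g₁.convexityConst e₁ x (c⁻¹ • v) < 0 := by
    have h2 := h₁.convex
    rw [SymTensor.secondForm_eq hn h₁.mem_target, SymTensor.convexityConst] at h2
    rw [SymTensor.convexityConst, g₁.normalDeriv_smul hn.1 1 h₁.mem_target]
    have : 0 < c⁻¹ ^ 2 := by positivity
    nlinarith
  refine ⟨hK, h₁.isMetric.exists_exitFamily hn.1 h₁.mem_target ?_⟩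
  rwa [SymTensor.spray_tangential hn h₁.isMetric h₁.mem_target]

/-- Equal exit times have equal coefficients. The first one determines K; for m ≥ 2 the polynomial
in lower jets takes equal values on both sides, and the nonzero factor of the remaining term can be
cancelled. -/
theorem SymTensor.IsDatum.normalDeriv_diag_eq [T2Space M₁] [T2Space M₂]
    (h₁ : g₁.IsDatum kind e₁ h S x v) (h₂ : g₂.IsDatum kind e₂ h S x v) {m : ℕ} (hm : 1 ≤ m)
    (hlow : ∀ k < m, ∀ᶠ y in 𝓝 x, ∀ u w, g₁.normalDeriv e₁ k y u w = g₂.normalDeriv e₂ k y u w) :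
    g₁.normalDeriv e₁ m x v v = g₂.normalDeriv e₂ m x v v := by
  obtain ⟨hc, hu₁⟩ := h₁.exists_unit
  have hu₂ := h₂.exists_unit.2
  set c := √(kind.sign * h x v v)
  obtain ⟨hK₁, ⟨F₁⟩⟩ := h₁.exists_exitFamily hc
  obtain ⟨hK₂, ⟨F₂⟩⟩ := h₂.exists_exitFamily hc
  have hτ := h₁.eventually_exitTime_eq h₂ hc hu₁ hu₂ F₁ F₂
  obtain ⟨a, ha, -, ha1, ham⟩ :=
    F₁.exists_expansion h₁.isMetric h₁.isBoundaryNormal h₁.mem_target hK₁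
  obtain ⟨b, hb, -, hb1, hbm⟩ :=
    F₂.exists_expansion h₂.isMetric h₂.isBoundaryNormal h₂.mem_target hK₂
  have hab : a = b := by
    refine expansion_coeff_unique ha fun N => (hb N).congr' ?_ (EventuallyEq.refl _ _)
    filter_upwards [hτ] with ε hε
    rw [hε]
  suffices hunit : g₁.normalDeriv e₁ m x (c⁻¹ • v) (c⁻¹ • v) =
      g₂.normalDeriv e₂ m x (c⁻¹ • v) (c⁻¹ • v) by
    rw [g₁.normalDeriv_smul h₁.isBoundaryNormal.1 m h₁.mem_target,
      g₂.normalDeriv_smul h₂.isBoundaryNormal.1 m h₂.mem_target] at hunit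
    exact mul_left_cancel₀ (pow_ne_zero 2 (inv_ne_zero hc.ne')) hunit
  rcases hm.eq_or_lt with rfl | hm2
  · have h3 : -2 / g₁.convexityConst e₁ x (c⁻¹ • v) = -2 / g₂.convexityConst e₂ x (c⁻¹ • v) := by
      rw [← ha1, ← hb1, hab]
    rw [div_eq_div_iff hK₁.ne hK₂.ne, SymTensor.convexityConst, SymTensor.convexityConst] at h3
    linarith
  · have hconst : g₁.convexityConst e₁ x (c⁻¹ • v) = g₂.convexityConst e₂ x (c⁻¹ • v) := by
      rw [SymTensor.convexityConst, SymTensor.convexityConst, (hlow 1 hm2).self_of_nhds]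
    -- Agreement in a neighbourhood, not merely at the point, is what yields the tangential
    -- derivatives.
    have hjet : ∀ i : JetVar d, i.normalOrder < m →
        g₁.jetVal e₁ x (c⁻¹ • v) i = g₂.jetVal e₂ x (c⁻¹ • v) i := by
      intro i hi
      cases i with
      | dir α => rfl
      | inv α β =>
        have h0 := (hlow 0 (by omega)).self_of_nhds
        simp only [SymTensor.normalDeriv_zero] at h0
        simp only [SymTensor.jetVal, h0]
      | recip => simp only [SymTensor.jetVal, hconst]
      | jet k l α β =>
        refine (iterPartial_congr ?_ l).self_of_nhds
        filter_upwards [hlow k hi] with y hy using hy _ _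
    have haeval : MvPolynomial.aeval (g₁.jetVal e₁ x (c⁻¹ • v)) (coeffPoly d kind.ratSign m) =
        MvPolynomial.aeval (g₂.jetVal e₂ x (c⁻¹ • v)) (coeffPoly d kind.ratSign m) :=
      MvPolynomial.eval₂Hom_congr' rfl
        (fun i hi _ => hjet i (normalOrder_lt_of_mem_vars_coeffPoly hi)) rfl
    have h3 := (ham m hm2).symm.trans ((congrFun hab _).trans (hbm m hm2))
    rw [haeval, hconst, add_left_inj] at h3
    refine mul_left_cancel₀ ?_ h3
    have h4 := hK₂.ne
    have h5 : (m.factorial : ℝ) ≠ 0 := by positivity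
    have h6 : ((2 * m).factorial : ℝ) ≠ 0 := by positivity
    have h7 : (-2 : ℝ) ≠ 0 := by norm_num
    positivity

/-- Strong induction on m, with a conclusion near x because the next step consumes tangential
derivatives. -/
theorem SymTensor.IsDatum.eventually_normalDeriv_eq [T2Space M₁] [T2Space M₂]
    (h₁ : g₁.IsDatum kind e₁ h S x v) (h₂ : g₂.IsDatum kind e₂ h S x v) (m : ℕ) :
    ∀ᶠ y in 𝓝 x, ∀ u w, g₁.normalDeriv e₁ m y u w = g₂.normalDeriv e₂ m y u w := by
  induction m using Nat.strong_induction_on with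
  | _ m ih =>
    rcases Nat.eq_zero_or_pos m with rfl | hm
    · filter_upwards [h₁.bdMetric_eq, h₂.bdMetric_eq] with y a1 a2 u w
      rw [g₁.normalDeriv_zero, g₂.normalDeriv_zero, ← a1, ← a2]
    have hlow : ∀ᶠ y in 𝓝 x, ∀ k < m, ∀ᶠ z in 𝓝 y, ∀ u w,
        g₁.normalDeriv e₁ k z u w = g₂.normalDeriv e₂ k z u w := by
      have h1 : ∀ᶠ y in 𝓝 x, ∀ k ∈ Finset.range m, ∀ u w,
          g₁.normalDeriv e₁ k y u w = g₂.normalDeriv e₂ k y u w :=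
        (Finset.eventually_all _).2 fun k hk => ih k (Finset.mem_range.1 hk)
      filter_upwards [eventually_eventually_nhds.2 h1] with y hy k hk
      filter_upwards [hy] with z hz using hz k (Finset.mem_range.2 hk)
    have hfst : Tendsto (Prod.fst : (Fin d → ℝ) × (Fin d → ℝ) → Fin d → ℝ) (𝓝 (x, v)) (𝓝 x) :=
      continuousAt_fst
    have hdiag : ∀ᶠ p in 𝓝 (x, v),
        g₁.normalDeriv e₁ m p.1 p.2 p.2 = g₂.normalDeriv e₂ m p.1 p.2 p.2 := by
      filter_upwards [h₁.eventually, h₂.eventually, hfst.eventually hlow] with p a1 a2 a3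
      exact a1.normalDeriv_diag_eq a2 hm a3
    -- For each y near x the diagonal values agree for all directions in some neighbourhood of v,
    -- which is the input for polarization.
    rw [nhds_prod_eq] at hdiag
    filter_upwards [hdiag.curry, (isOpen_boundary_target e₁).mem_nhds h₁.mem_target,
      (isOpen_boundary_target e₂).mem_nhds h₂.mem_target] with y hy hy₁ hy₂ u w
    have hb : ∀ u w, (LinearMap.mk₂ ℝ (fun u w : Fin d → ℝ =>
        (halfJet (g₁.bilin e₁) m [] (coordVec 0 y) - halfJet (g₂.bilin e₂) m [] (coordVec 0 y))
          (tangIncl d u) (tangIncl d w)) (by intros; simp only [map_add, add_apply])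
        (by intros; simp only [map_smul, smul_apply]) (by intros; simp only [map_add])
        (by intros; simp only [map_smul])) u w =
        g₁.normalDeriv e₁ m y u w - g₂.normalDeriv e₂ m y u w := by
      intro u w
      rw [g₁.normalDeriv_eq h₁.isBoundaryNormal.1 m hy₁,
        g₂.normalDeriv_eq h₂.isBoundaryNormal.1 m hy₂]
      rfl
    have hz := LinearMap.eq_zero_of_eventually_diag_eq_zero (fun u w => by
      rw [hb, hb, g₁.normalDeriv_symm, g₂.normalDeriv_symm]) (v := v)
      (hy.mono fun w hw => by rw [hb, hw, sub_self]) u w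
    rw [hb] at hz
    exact sub_eq_zero.1 hz

end Uniqueness

/-- `r` is the value at `(u, w)` of the `m`-th normal derivative at `x` of a metric with boundary
metric `h` and scattering relation `S` near `(x, v)`. -/
def IsNormalJetValue.{u} {d : ℕ} (kind : MetricKind)
    (h : (Fin d → ℝ) → (Fin d → ℝ) → (Fin d → ℝ) → ℝ)
    (S : (Fin d → ℝ) → CoordSpace d → (Fin d → ℝ) → CoordSpace d → Prop)
    (x v : Fin d → ℝ) (m : ℕ) (u w : Fin d → ℝ) (r : ℝ) : Prop :=
  ∃ (M : Type u) (_ : TopologicalSpace M) (_ : T2Space M)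
    (_ : ChartedSpace (EuclideanHalfSpace (d + 1)) M) (g : SymTensor d M) (e : BdChart d M),
    g.IsDatum kind e h S x v ∧ r = g.normalDeriv e m x u w

theorem IsNormalJetValue.unique.{u} {d : ℕ} {kind : MetricKind}
    {h : (Fin d → ℝ) → (Fin d → ℝ) → (Fin d → ℝ) → ℝ}
    {S : (Fin d → ℝ) → CoordSpace d → (Fin d → ℝ) → CoordSpace d → Prop}
    {x v : Fin d → ℝ} {m : ℕ} {u w : Fin d → ℝ} {r r' : ℝ}
    (hr : IsNormalJetValue.{u} kind h S x v m u w r)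
    (hr' : IsNormalJetValue.{u} kind h S x v m u w r') : r = r' := by
  obtain ⟨M₁, _, _, _, g₁, e₁, h₁, rfl⟩ := hr
  obtain ⟨M₂, _, _, _, g₂, e₂, h₂, rfl⟩ := hr'
  exact (h₁.eventually_normalDeriv_eq h₂ m).self_of_nhds u w

end

theorem theoremB (d : ℕ) (kind : MetricKind) :
    ∃ (P : ℕ → MvPolynomial (JetVar d) ℚ)
      (R : ((Fin d → ℝ) → (Fin d → ℝ) → (Fin d → ℝ) → ℝ) →
        ((Fin d → ℝ) → CoordSpace d → (Fin d → ℝ) → CoordSpace d → Prop) →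
        (Fin d → ℝ) → (Fin d → ℝ) → ℕ → (Fin d → ℝ) → (Fin d → ℝ) → ℝ),
      (∀ m, 2 ≤ m → ∀ i ∈ (P m).vars, i.normalOrder < m) ∧
      ∀ (M : Type*) [TopologicalSpace M] [T2Space M]
        [ChartedSpace (EuclideanHalfSpace (d + 1)) M] [IsManifold (𝓡∂ (d + 1)) ∞ M]
        (g : SymTensor d M), g.IsMetric kind →
      ∀ e : BdChart d M, g.IsBoundaryNormal e →
      ∀ x : Fin d → ℝ, coordVec 0 x ∈ (e.extend (𝓡∂ (d + 1))).target →
      ∀ v : Fin d → ℝ, 0 < g.secondForm e x v v →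
      (kind = MetricKind.lorentzian → g.bdMetric e x v v < 0) →
      -- the normal jet is a function of the boundary metric near `x` and of the scattering
      -- relation for inward directions near `(x, v)`
      (∀ (h : (Fin d → ℝ) → (Fin d → ℝ) → (Fin d → ℝ) → ℝ)
        (S : (Fin d → ℝ) → CoordSpace d → (Fin d → ℝ) → CoordSpace d → Prop),
        (∀ᶠ y in 𝓝 x, ∀ u w, h y u w = g.bdMetric e y u w) →
        (∀ᶠ q in 𝓝 (x, coordVec 0 v), 0 < q.2 0 →
          ∀ y w, S q.1 q.2 y w ↔ g.Scatters e q.1 q.2 y w) →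
        ∀ m u w, g.normalDeriv e m x u w = R h S x v m u w) ∧
      -- exit time for unit `v`: first variation formula, expansion, and its odd coefficients
      (g.bdMetric e x v v = kind.sign →
        ∃ (δ : ℝ) (τ : ℝ → ℝ) (y y' : ℝ → Fin d → ℝ) (η : ℝ → CoordSpace d) (a : ℕ → ℝ),
          0 < δ ∧
          (∀ ε ∈ Ioo 0 δ, g.ExitsAt e x (tiltedDir kind v ε) (τ ε) (y ε) (η ε)) ∧
          (∀ ε ∈ Ioo 0 δ, HasDerivAt y (y' ε) ε ∧
            HasDerivAt τ (kind.sign * g.bdMetric e (y ε) (y' ε) (tangPart (η ε))) ε) ∧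
          (∀ N : ℕ, (fun ε => τ ε - ∑ k ∈ Finset.range (N + 1), a k * ε ^ k)
            =O[𝓝[>] 0] fun ε => ε ^ (N + 1)) ∧
          a 0 = 0 ∧
          a 1 = -2 / g.convexityConst e x v ∧
          ∀ m, 2 ≤ m →
            a (2 * m - 1) =
              1 / 2 * (-2 / g.convexityConst e x v) ^ (m + 1)
                  * ((m.factorial : ℝ) / ((2 * m).factorial : ℝ)) * g.normalDeriv e m x v v
                + MvPolynomial.aeval (g.jetVal e x v) (P m)) := by
  -- Determination is uniqueness of the value among all manifolds with the given data, so R may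
  -- select any realized value; off realizable data the choice is irrelevant.
  refine ⟨coeffPoly d kind.ratSign, fun h S x v m u w =>
    Classical.epsilon (IsNormalJetValue kind h S x v m u w),
    fun m _ i hi => normalOrder_lt_of_mem_vars_coeffPoly hi, ?_⟩
  intro M _ _ _ _ g hg e hn x hx v hconv htime
  refine ⟨fun h S hh hS m u w => ?_, fun hv => ?_⟩
  · have hval : IsNormalJetValue kind h S x v m u w (g.normalDeriv e m x u w) :=
      ⟨M, _, ‹_›, _, g, e, ⟨hg, hn, hx, hconv, htime, hh, hS⟩, rfl⟩
    exact hval.unique (Classical.epsilon_spec ⟨_, hval⟩)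
  · have hK : g.convexityConst e x v < 0 := by
      rw [SymTensor.secondForm_eq hn hx] at hconv
      linarith
    obtain ⟨F⟩ := hg.exists_exitFamily (v := v) hn.1 hx
      (by rwa [SymTensor.spray_tangential hn hg hx])
    obtain ⟨a, ha, ha0, ha1, ham⟩ := F.exists_expansion hg hn hx hK
    choose! y' hy' hτ' using fun ε (hε : ε ∈ Ioo 0 F.δ) => F.exists_hasDerivAt hg hn hx hv hε
    exact ⟨F.δ, F.τ, fun ε => tangPart (F.X ε (F.τ ε)).1, y', fun ε => (F.X ε (F.τ ε)).2, a,
      F.δ_pos, fun ε hε => (F.exitsAt hg hn.1 hε).1, fun ε hε => ⟨hy' ε hε, hτ' ε hε⟩,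
      ha, ha0, ha1, ham⟩
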